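/- Let $k$ be a field and let $X$ be a regular irreducible surface over $k$, that is, a regular irreducible scheme of dimension $2$ and of finite type over $k$. Let $\mathcal F$ be a locally free sheaf of finite rank on $X$. For $I=\{i_0<\dots<i_p\}\subset\{0,1,2\}$ let ${\mathbf A}_X(I,\mathcal F)$ be the Beilinson--Huber adelic group of $\mathcal F$ for the set of flags $(\eta_0,\dots,\eta_p)$ of points of $X$ with $\eta_{j+1}\in\overline{\{\eta_j\}}$, $\eta_{j+1}\neq\eta_j$ and $\operatorname{codim}_X\overline{\{\eta_j\}}=i_j$. (For a set $K$ of flags, ${\mathbf A}_X(K,-)$ is defined recursively: for coherent $\mathcal G$ it is $\prod_{x\in K}\varprojlim_n\mathcal G_x/\mathfrak m_x^n\mathcal G_x$ if the flags have one point, and otherwise $\prod_{x\in X}\varprojlim_n{\mathbf A}_X({}_xK,j_{x,n*}j_{x,n}^*\mathcal G)$, where $j_{x,n}\colon\operatorname{Spec}(\mathcal O_{X,x}/\mathfrak m_x^n)\to X$ and ${}_xK=\{(\eta_1,\dots,\eta_p):(x,\eta_1,\dots,\eta_p)\in K\}$; it is extended to quasi-coherent sheaves by filtered colimits over coherent subsheaves.)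 In particular ${\mathbf A}_X(\{1\},\mathcal F)=\prod_C\widehat{\mathcal F}_C$ and ${\mathbf A}_X(\{2\},\mathcal F)=\prod_x\widehat{\mathcal F}_x$, where $C$ runs over the irreducible curves on $X$, $x$ over the closed points of $X$, and $\widehat{\mathcal F}_C$, $\widehat{\mathcal F}_x$ are the completed stalks. Let ${\mathbf A}_X(\{1\},\mathcal F)\cap{\mathbf A}_X(\{2\},\mathcal F)$ be the intersection of the images of the canonical maps ${\mathbf A}_X(\{i\},\mathcal F)\to{\mathbf A}_X(\{0,1,2\},\mathcal F)$, $i=1,2$. Then there is a canonical isomorphism of abelian groups $$ {\mathbf A}_X(\{1\},\mathcal F)\cap{\mathbf A}_X(\{2\},\mathcal F)\;\cong\;\varprojlim_Z H^0(Z,\mathcal F|_Z), $$ where the limit is taken over all closed subschemes $Z\subset X$ (not necessarily reduced or irreducible) with $Z\neq X$, and $\mathcal F|_Z$ is the pullback of $\mathcal F$ to $Z$. More precisely, there is exactly one isomorphism with the following property: if $c$ in the intersection corresponds to $(s_Z)_Z$, then $c$ is the image of some $a=(a_x)\in{\mathbf A}_X(\{1\},\mathcal F)$ and of some $b=(b_x)\in{\mathbf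 A}_X(\{2\},\mathcal F)$ such that, for every $n\ge 0$, every closed subscheme $Z\neq X$ and every point $x$ of codimension $1$ (respectively $2$) for which $j_{x,n}$ factors through $Z$, the elements $a_x$ (respectively $b_x$) and $s_Z$ have the same image in $\mathcal F_x/\mathfrak m_x^n\mathcal F_x$. -/

import Mathlib

open CategoryTheory Limits AlgebraicGeometry Opposite

universe u

noncomputable section

namespace BeilinsonAdeles

/-! ### Pullback of sections -/

section

variable {C D D' : Type*} [Category* C] [Category* D] [Category* D'] {L : C ⥤ D} {R : D ⥤ C}
  (adj : L ⊣ R) {L' : C ⥤ D'} {R' : D' ⥤ C} (adj' : L' ⊣ R') {G : D' ⥤ D} (e : G ⋙ R ≅ R')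

/-- For adjunctions `L ⊣ R`, `L' ⊣ R'` and an isomorphism `e : R G ≅ R'`, the natural
transformation `L ⟶ G L'` that corresponds to `𝟭 ⟶ R' L' ≅ R (G L')`. -/
def adjointMap : L ⟶ L' ⋙ G where
  app F := (adj.homEquiv F (G.obj (L'.obj F))).symm (adj'.unit.app F ≫ e.inv.app (L'.obj F))
  naturality F F' φ := by
    refine (adj.homEquiv_naturality_left_symm φ _).symm.trans (Eq.trans (congrArg _ ?_)
      (adj.homEquiv_naturality_right_symm _ (G.map (L'.map φ))))
    simpa using adj'.unit.naturality_assoc φ (e.inv.app (L'.obj F'))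

/-- The natural transformation `R L ⟶ R G L' ≅ R' L'` given by `adjointMap`. -/
def monadMap : L ⋙ R ⟶ L' ⋙ R' where
  app F := R.map ((adjointMap adj adj' e).app F) ≫ e.hom.app (L'.obj F)
  naturality F F' φ := by
    have := (adjointMap adj adj' e).naturality φ
    simp only [Functor.comp_map, Category.assoc]
    rw [← Functor.map_comp_assoc, this, Functor.map_comp_assoc]
    exact congrArg _ (e.hom.naturality (L'.map φ))

lemma unit_monadMap : adj.unit ≫ monadMap adj adj' e = adj'.unit := by
  ext F
  have h : adj.unit.app F ≫ R.map ((adjointMap adj adj' e).app F) =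
      adj'.unit.app F ≫ e.inv.app (L'.obj F) :=
    (adj.homEquiv_unit _ _ _).symm.trans ((adj.homEquiv _ _).apply_symm_apply _)
  simp only [NatTrans.comp_app, monadMap]
  rw [reassoc_of% h]
  simp

end

section

variable {X Y Y' : Scheme.{u}} (g : Y' ⟶ Y) (f : Y ⟶ X) (f' : Y' ⟶ X) (h : g ≫ f = f')

/-- For composable morphisms of schemes `g : Y' ⟶ Y`, `f : Y ⟶ X` with composite `f' : Y' ⟶ X`,
the canonical isomorphism `f_* g_* ≅ f'_*`. -/
def pushforwardIso :
    Scheme.Modules.pushforward g ⋙ Scheme.Modules.pushforward f ≅ Scheme.Modules.pushforward f' :=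
  Scheme.Modules.pushforwardComp g f ≪≫ Scheme.Modules.pushforwardCongr h

/-- For morphisms of schemes `g : Y' ⟶ Y`, `f : Y ⟶ X` with composite `f' : Y' ⟶ X`, the canonical
morphism `f^* F ⟶ g_* f'^* F` of sheaves of modules on `Y`, natural in `F`. It is the morphism
that corresponds, under the adjunction `f^* ⊣ f_*`, to the unit
`F ⟶ f'_* f'^* F = f_* (g_* f'^* F)`. -/
def baseChange :
    Scheme.Modules.pullback f ⟶ Scheme.Modules.pullback f' ⋙ Scheme.Modules.pushforward g :=
  adjointMap (Scheme.Modules.pullbackPushforwardAdjunction f)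
    (Scheme.Modules.pullbackPushforwardAdjunction f') (pushforwardIso g f f' h)

/-- Pullback of global sections `H⁰(Y, f^* F) → H⁰(Y', f'^* F)` along `g : Y' ⟶ Y`,
where `f' = g ≫ f`. -/
def pullbackSections (F : X.Modules) :
    Γ((Scheme.Modules.pullback f).obj F, ⊤) →+ Γ((Scheme.Modules.pullback f').obj F, ⊤) :=
  (((baseChange g f f' h).app F).app ⊤).hom

end

/-! ### Coherent sheaves -/

variable (X : Scheme.{u})

/-- The sheaves of modules on `X` of finite presentation. On a Noetherian scheme these are the
coherent sheaves. -/
abbrev isCoherent : ObjectProperty X.Modules :=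
  fun F => SheafOfModules.IsFinitePresentation (R := X.ringCatSheaf) F

/-- The category of coherent sheaves on a Noetherian scheme `X`. -/
abbrev Coh : Type (u + 1) := (isCoherent X).FullSubcategory

/-- The inclusion of the coherent sheaves into all sheaves of modules.

For a functor `P` on coherent sheaves, the left Kan extension `(Coh.ι X).lan.obj P` sends `F` to the
colimit of the groups `P G` over all coherent sheaves `G` with a morphism `G ⟶ F`. For `F` coherent
it is `P F`, and for a quasi-coherent sheaf `F` on a Noetherian scheme (where the coherent
subsheaves are cofinal among all `G ⟶ F`) it is the filtered colimit of `P G` over the coherent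
subsheaves `G ⊆ F`. -/
abbrev Coh.ι : Coh X ⥤ X.Modules :=
  (isCoherent X).ι

/-- The functor `F ↦ H⁰(X, F)`. -/
def globalSections : X.Modules ⥤ AddCommGrpCat.{u + 1} :=
  Scheme.Modules.toPresheaf X ⋙ (evaluation _ _).obj (op ⊤) ⋙ AddCommGrpCat.uliftFunctor.{u + 1, u}

variable {X}

/-! ### Infinitesimal neighbourhoods of points -/

/-- The infinitesimal neighbourhood `Spec (𝒪_{X,x} / 𝔪_x ^ n)` of a point `x`. -/
abbrev nbhd (x : X) (n : ℕ) : Scheme.{u} :=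
  Spec (.of (X.presheaf.stalk x ⧸ IsLocalRing.maximalIdeal (X.presheaf.stalk x) ^ n))

/-- The canonical morphism `Spec (𝒪_{X,x} / 𝔪_x ^ n) ⟶ X`. -/
def nbhdι (x : X) (n : ℕ) : nbhd x n ⟶ X :=
  Spec.map (CommRingCat.ofHom (Ideal.Quotient.mk _)) ≫ X.fromSpecStalk x

/-- The canonical morphism `Spec (𝒪_{X,x} / 𝔪_x ^ n) ⟶ Spec (𝒪_{X,x} / 𝔪_x ^ (n + 1))`. -/
def nbhdSucc (x : X) (n : ℕ) : nbhd x n ⟶ nbhd x (n + 1) :=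
  Spec.map (CommRingCat.ofHom (Ideal.Quotient.factor (Ideal.pow_le_pow_right n.le_succ)))

lemma nbhdSucc_nbhdι (x : X) (n : ℕ) : nbhdSucc x n ≫ nbhdι x (n + 1) = nbhdι x n := by
  rw [nbhdSucc, nbhdι, nbhdι, ← Category.assoc, ← Spec.map_comp]
  rfl

/-- The functor `F ↦ j_* j^* F`, where `j : Spec (𝒪_{X,x} / 𝔪_x ^ n) ⟶ X`. -/
abbrev trunc (x : X) (n : ℕ) : X.Modules ⥤ X.Modules :=
  Scheme.Modules.pullback (nbhdι x n) ⋙ Scheme.Modules.pushforward (nbhdι x n)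

/-- The canonical morphism from `j'_* j'^* F` to `j_* j^* F`, where
`j' : Spec (𝒪_{X,x} / 𝔪_x ^ (n + 1)) ⟶ X` and `j : Spec (𝒪_{X,x} / 𝔪_x ^ n) ⟶ X`. -/
def truncSucc (x : X) (n : ℕ) : trunc x (n + 1) ⟶ trunc x n :=
  monadMap (Scheme.Modules.pullbackPushforwardAdjunction (nbhdι x (n + 1)))
    (Scheme.Modules.pullbackPushforwardAdjunction (nbhdι x n))
    (pushforwardIso _ _ _ (nbhdSucc_nbhdι x n))

/-- The canonical morphism `F ⟶ j_* j^* F`, where `j : Spec (𝒪_{X,x} / 𝔪_x ^ n) ⟶ X`. -/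
def truncUnit (x : X) (n : ℕ) : 𝟭 X.Modules ⟶ trunc x n :=
  (Scheme.Modules.pullbackPushforwardAdjunction (nbhdι x n)).unit

lemma truncUnit_truncSucc (x : X) (n : ℕ) :
    truncUnit x (n + 1) ≫ truncSucc x n = truncUnit x n :=
  unit_monadMap _ _ _

/-- The inverse system `⋯ ⟶ j₂_* j₂^* ⟶ j₁_* j₁^* ⟶ j₀_* j₀^*`, where
`j_n : Spec (𝒪_{X,x} / 𝔪_x ^ n) ⟶ X`. -/
def truncSystem (x : X) : ℕᵒᵖ ⥤ X.Modules ⥤ X.Modules :=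
  Functor.ofOpSequence (X := trunc x) (truncSucc x)

/-- The canonical morphism from `F` to the inverse system of the `j_n_* j_n^* F`. -/
def truncSystemUnit (x : X) : (Functor.const ℕᵒᵖ).obj (𝟭 X.Modules) ⟶ truncSystem x :=
  NatTrans.ofOpSequence (truncUnit x) (by
    intro n
    unfold truncSystem
    rw [Functor.ofOpSequence_map_homOfLE_succ]
    exact (Category.id_comp _).trans (truncUnit_truncSucc x n).symm)

/-! ### Adeles of a set of flags -/

/-- The inverse system of functors `F ↦ T (j_n_* j_n^* F)` on coherent sheaves, where
`j_n : Spec (𝒪_{X,x} / 𝔪_x ^ n) ⟶ X`. -/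
abbrev truncWith (x : X) (T : X.Modules ⥤ AddCommGrpCat.{u + 1}) :
    ℕᵒᵖ ⥤ Coh X ⥤ AddCommGrpCat.{u + 1} :=
  truncSystem x ⋙ (Functor.whiskeringRight _ _ _).obj T ⋙
    (Functor.whiskeringLeft _ _ _).obj (Coh.ι X)

/-- The functor `F ↦ lim_n T (j_n_* j_n^* F)` on coherent sheaves, where
`j_n : Spec (𝒪_{X,x} / 𝔪_x ^ n) ⟶ X`. -/
def completion (x : X) (T : X.Modules ⥤ AddCommGrpCat.{u + 1}) : Coh X ⥤ AddCommGrpCat.{u + 1} :=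
  limit (truncWith x T)

/-- Functoriality of `completion x T` in `T`. -/
def completionMap (x : X) {T T' : X.Modules ⥤ AddCommGrpCat.{u + 1}} (τ : T ⟶ T') :
    completion x T ⟶ completion x T' :=
  lim.map (Functor.whiskerLeft (truncSystem x)
    (Functor.whiskerRight ((Functor.whiskeringRight _ _ _).map τ) _))

/-- The canonical map `T F → lim_n T (j_n_* j_n^* F)`. -/
def toCompletion (x : X) (T : X.Modules ⥤ AddCommGrpCat.{u + 1}) : Coh.ι X ⋙ T ⟶ completion x T :=
  limit.lift (truncWith x T)
    { pt := Coh.ι X ⋙ T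
      π :=
        { app l := Functor.whiskerLeft (Coh.ι X) (Functor.whiskerRight ((truncSystemUnit x).app l) T)
          naturality l l' φ := by
            have h := (truncSystemUnit x).naturality φ
            ext F : 2
            have h' := congrArg (fun v => T.map (v.app ((Coh.ι X).obj F))) h
            refine (Category.id_comp _).trans (Eq.trans ?_ (h'.trans (T.map_comp _ _)))
            exact congrArg T.map (Category.id_comp _).symm } }

/-- For `x ∈ X` and a set `K` of flags, the set of those flags that give an element of `K` when
`x` is put in front of them. -/
def link (x : X) (K : Set (List X)) : Set (List X) := {l | x :: l ∈ K}

variable (X) in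
/-- The adelic functor of Beilinson and Huber `F ↦ 𝐀(K, F)` on coherent sheaves, for a set `K` of
flags with `p` points; `𝐀(K, F) = ∏_x lim_n 𝐀(link x K, F_x / 𝔪_x ^ n F_x)`, where
`F_x / 𝔪_x ^ n F_x` stands for the quasi-coherent sheaf `j_* j^* F` with
`j : Spec (𝒪_{X,x} / 𝔪_x ^ n) ⟶ X`, and where the functor `𝐀(link x K, -)` is extended to
quasi-coherent sheaves by filtered colimits.

The recursion starts with the flag `[]` without points: `𝐀({[]}, F) = H⁰(X, F)`, `𝐀(∅, F) = 0`.
So, for flags with one point, `𝐀(K, F) = ∏_{[x] ∈ K} lim_n F_x / 𝔪_x ^ n F_x`. -/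
def cohAdeles : ℕ → Set (List X) → (Coh X ⥤ AddCommGrpCat.{u + 1})
  | 0, K => ∏ᶜ fun _ : PLift ([] ∈ K) => Coh.ι X ⋙ globalSections X
  | p + 1, K => ∏ᶜ fun x : X => completion x ((Coh.ι X).lan.obj (cohAdeles p (link x K)))

/-- The adelic functor `F ↦ 𝐀(K, F)` for a set `K` of flags with `p` points. -/
def adeles (p : ℕ) (K : Set (List X)) : X.Modules ⥤ AddCommGrpCat.{u + 1} :=
  (Coh.ι X).lan.obj (cohAdeles X p K)

/-- A rule for choosing `q` of the `p` points of a flag, going through the flag from its first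
point on: `keep` or `skip` the point. -/
inductive FaceMap : ℕ → ℕ → Type
  | nil : FaceMap 0 0
  | keep {q p : ℕ} : FaceMap q p → FaceMap (q + 1) (p + 1)
  | skip {q p : ℕ} : FaceMap q p → FaceMap q (p + 1)

/-- The flag of the points that are kept. -/
def FaceMap.face {α : Type u} : {q p : ℕ} → FaceMap q p → List α → List α
  | _, _, .keep m, x :: l => x :: m.face l
  | _, _, .skip m, _ :: l => m.face l
  | _, _, _, l => l

/-- The boundary map `𝐀(L, F) → 𝐀(K, F)` on coherent sheaves, where the faces of the flags in `K`
belong to `L`. If the first point `x` is kept, it is `∏_x lim_n` of boundary maps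
`𝐀(link x L, F_x / 𝔪_x ^ n F_x) → 𝐀(link x K, F_x / 𝔪_x ^ n F_x)`. If the first point is skipped,
its components are `𝐀(L, F) → 𝐀(link x K, F) → lim_n 𝐀(link x K, F_x / 𝔪_x ^ n F_x)`. -/
def cohBoundary : {q p : ℕ} → (m : FaceMap q p) → (L K : Set (List X)) →
    (∀ l ∈ K, m.face l ∈ L) → (cohAdeles X q L ⟶ cohAdeles X p K)
  | _, _, .nil, L, _, h => Pi.lift fun i => Pi.π (fun _ : PLift ([] ∈ L) => _) ⟨h _ i.down⟩
  | _, _, .keep m, L, K, h => Limits.Pi.map fun x => completionMap x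
      ((Coh.ι X).lan.map (cohBoundary m (link x L) (link x K) fun l hl => h (x :: l) hl))
  | _, _, .skip m, L, K, h => Pi.lift fun x =>
      cohBoundary m L (link x K) (fun l hl => h (x :: l) hl) ≫
        (Coh.ι X).lanUnit.app _ ≫ toCompletion x _

/-- The boundary map `𝐀(L, F) → 𝐀(K, F)`, where the faces of the flags in `K` belong to `L`. -/
def boundary {q p : ℕ} (m : FaceMap q p) (L K : Set (List X)) (h : ∀ l ∈ K, m.face l ∈ L) :
    adeles q L ⟶ adeles p K :=
  (Coh.ι X).lan.map (cohBoundary m L K h)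

/-! ### Local components of adeles of sets of points -/

/-- The canonical map `𝐀(K, F) → H⁰(X, F)` for `K = {[]}`; it is an isomorphism. -/
def adelesZeroMap (K : Set (List X)) (h : [] ∈ K) : adeles 0 K ⟶ globalSections X :=
  Functor.descOfIsLeftKanExtension ((Coh.ι X).lan.obj (cohAdeles X 0 K))
    ((Coh.ι X).lanUnit.app (cohAdeles X 0 K))
    (globalSections X) (Pi.π (fun _ : PLift ([] ∈ K) => Coh.ι X ⋙ globalSections X) ⟨h⟩)

/-- For a set `K` of flags with one point, `[x] ∈ K` and `j : Spec (𝒪_{X,x} / 𝔪_x ^ n) ⟶ X`, the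
projection `𝐀(K, F) → H⁰(X, j_* j^* F)`. For `F` coherent, it sends a family `a` with
components `a_x ∈ lim_n F_x / 𝔪_x ^ n F_x` to the image of `a_x` in `F_x / 𝔪_x ^ n F_x`. -/
def adelesOneMap (K : Set (List X)) (x : X) (n : ℕ) (h : [x] ∈ K) :
    adeles 1 K ⟶ trunc x n ⋙ globalSections X :=
  Functor.descOfIsLeftKanExtension ((Coh.ι X).lan.obj (cohAdeles X 1 K))
    ((Coh.ι X).lanUnit.app (cohAdeles X 1 K))
    (trunc x n ⋙ globalSections X)
    (Pi.π (fun y : X => completion y ((Coh.ι X).lan.obj (cohAdeles X 0 (link y K)))) x ≫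
      limit.π (truncWith x (adeles 0 (link x K))) (op n) ≫
      Functor.whiskerLeft (Coh.ι X) (Functor.whiskerLeft (trunc x n) (adelesZeroMap (link x K) h)))

/-- The component `a ↦ (a_x mod 𝔪_x ^ n) ∈ F_x / 𝔪_x ^ n F_x = H⁰(Spec (𝒪_{X,x} / 𝔪_x ^ n), j^* F)`
of adeles `a ∈ 𝐀(K, F)`, where `K` is a set of flags with one point, `[x] ∈ K`, and
`j : Spec (𝒪_{X,x} / 𝔪_x ^ n) ⟶ X`. -/
def component (K : Set (List X)) (x : X) (n : ℕ) (h : [x] ∈ K) (F : X.Modules) :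
    (adeles 1 K).obj F →+ Γ((Scheme.Modules.pullback (nbhdι x n)).obj F, ⊤) :=
  AddEquiv.ulift.toAddMonoidHom.comp ((adelesOneMap K x n h).app F).hom

/-! ### Adeles of an irreducible scheme for a set of codimensions -/

variable (X) in
/-- For a list `I` of numbers `i₀ < ⋯ < i_p`, the set of the flags `(η₀, …, η_p)` of points with
`η_{j+1}` in the closure of `η_j`, `η_{j+1} ≠ η_j`, and the closure of `η_j` of codimension `i_j`
in `X`. -/
def flags (I : List ℕ) : Set (List X) :=
  {l | l.IsChain (fun x y => x ⤳ y ∧ x ≠ y) ∧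
    l.map (fun x => Order.coheight x) = I.map (fun i => (i : ℕ∞))}

/-- The adelic group `𝐀_X(I, F)`, for a subset `I` of `{0, …, dim X}` given by the increasing list
of its elements. -/
abbrev adeleGroup (I : List ℕ) (F : X.Modules) : AddCommGrpCat.{u + 1} :=
  (adeles I.length (flags X I)).obj F

lemma face_mem_flags_one (l : List X) (hl : l ∈ flags X [0, 1, 2]) :
    (FaceMap.skip (.keep (.skip .nil))).face l ∈ flags X [1] := by
  have h : l.map (fun x => Order.coheight x) = [((0 : ℕ) : ℕ∞), ((1 : ℕ) : ℕ∞), ((2 : ℕ) : ℕ∞)] :=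
    hl.2
  simp only [List.map_eq_cons_iff, List.map_eq_nil_iff] at h
  obtain ⟨x, _, rfl, -, y, _, rfl, hy, z, _, rfl, -, rfl⟩ := h
  exact ⟨List.isChain_singleton y, by simpa [FaceMap.face] using hy⟩

lemma face_mem_flags_two (l : List X) (hl : l ∈ flags X [0, 1, 2]) :
    (FaceMap.skip (.skip (.keep .nil))).face l ∈ flags X [2] := by
  have h : l.map (fun x => Order.coheight x) = [((0 : ℕ) : ℕ∞), ((1 : ℕ) : ℕ∞), ((2 : ℕ) : ℕ∞)] :=
    hl.2
  simp only [List.map_eq_cons_iff, List.map_eq_nil_iff] at h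
  obtain ⟨x, _, rfl, -, y, _, rfl, -, z, _, rfl, hz, rfl⟩ := h
  exact ⟨List.isChain_singleton z, by simpa [FaceMap.face] using hz⟩

/-- The canonical map `𝐀_X({1}, F) → 𝐀_X({0, 1, 2}, F)`. -/
def mapOne (F : X.Modules) : adeleGroup [1] F →+ adeleGroup [0, 1, 2] F :=
  ((boundary (.skip (.keep (.skip .nil))) (flags X [1]) (flags X [0, 1, 2])
    face_mem_flags_one).app F).hom

/-- The canonical map `𝐀_X({2}, F) → 𝐀_X({0, 1, 2}, F)`. -/
def mapTwo (F : X.Modules) : adeleGroup [2] F →+ adeleGroup [0, 1, 2] F :=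
  ((boundary (.skip (.skip (.keep .nil))) (flags X [2]) (flags X [0, 1, 2])
    face_mem_flags_two).app F).hom

/-- The intersection `𝐀_X({1}, F) ∩ 𝐀_X({2}, F)` in `𝐀_X({0, 1, 2}, F)`. -/
def adeleInter (F : X.Modules) : AddSubgroup (adeleGroup [0, 1, 2] F) :=
  (mapOne F).range ⊓ (mapTwo F).range

/-! ### Sections over closed subschemes -/

/-- `H⁰(Z, F|_Z)`, where `i : Z ⟶ X` is the closed subscheme with ideal sheaf `I`, and
`F|_Z = i^* F`. -/
abbrev closedSections (F : X.Modules) (I : X.IdealSheafData) : AddCommGrpCat.{u} :=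
  Γ((Scheme.Modules.pullback I.subschemeι).obj F, ⊤)

/-- The restriction map `H⁰(Z, F|_Z) → H⁰(Z', F|_Z')` for closed subschemes `Z' ⊆ Z`. -/
def closedRestrict (F : X.Modules) {I J : X.IdealSheafData} (h : I ≤ J) :
    closedSections F I →+ closedSections F J :=
  pullbackSections (Scheme.IdealSheafData.inclusion h) I.subschemeι J.subschemeι
    (Scheme.IdealSheafData.inclusion_subschemeι h) F

/-- The projective limit of the groups `H⁰(Z, F|_Z)` over all closed subschemes `Z ≠ X` of `X`. -/
def limitClosedSections (F : X.Modules) :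
    AddSubgroup (∀ I : {I : X.IdealSheafData // I ≠ ⊥}, closedSections F I.1) where
  carrier := {s | ∀ (I J : {I : X.IdealSheafData // I ≠ ⊥}) (h : I.1 ≤ J.1),
    closedRestrict F h (s I) = s J}
  zero_mem' _ _ _ := map_zero _
  add_mem' hs ht I J h := (map_add _ _ _).trans (congrArg₂ _ (hs I J h) (ht I J h))
  neg_mem' hs I J h := (map_neg _ _).trans (congrArg _ (hs I J h))

/-- An adele `a ∈ 𝐀_X({i}, F)` is induced by a family of sections `s_Z ∈ H⁰(Z, F|_Z)`: for each
point `x` of codimension `i` and each `n`, if `Spec (𝒪_{X,x} / 𝔪_x ^ n) ⟶ X` factors through `Z`,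
then `a_x` and `s_Z` have the same image in `F_x / 𝔪_x ^ n F_x`. -/
def IsInducedBy {F : X.Modules} {i : ℕ} (a : adeleGroup [i] F)
    (s : ∀ I : {I : X.IdealSheafData // I ≠ ⊥}, closedSections F I.1) : Prop :=
  ∀ (x : X) (hx : [x] ∈ flags X [i]) (n : ℕ) (I : {I : X.IdealSheafData // I ≠ ⊥})
    (g : nbhd x n ⟶ I.1.subscheme) (hg : g ≫ I.1.subschemeι = nbhdι x n),
    component (flags X [i]) x n hx F a =
      pullbackSections g I.1.subschemeι (nbhdι x n) hg F (s I)

/-- `F` is locally free of finite rank. -/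
def IsLocallyFreeOfFiniteRank (F : X.Modules) : Prop :=
  ∀ x : X, ∃ (U : X.Opens) (r : ℕ), x ∈ U ∧
    Nonempty (F.restrict U.ι ≅ SheafOfModules.free (R := U.toScheme.ringCatSheaf) (ULift (Fin r)))

end BeilinsonAdeles

end

open BeilinsonAdeles

/-! On an affine chart `Spec A`, `F` becomes a free module `N` over a Noetherian domain, and a
proper closed subscheme `Z` is given by a nonzero ideal. Two facts about `N` carry the proof. By
Krull's intersection theorem a quotient of `N` is detected modulo all powers of all maximal ideals
(`mem_of_forall_mem_sup`), so the family `s_Z` is determined by its values at closed points. Since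
the local rings are regular, `N / hN` with `h ≠ 0` has no associated primes except the minimal
primes over `h` (`mem_minimalPrimes_of_mem_associatedPrimes`), which are generic points of curves;
so the family is also determined by its values at curves.

A family gives adeles because `Spec (𝒪_x / 𝔪_x ^ n)`, for `x` of positive codimension, lies in a
proper closed subscheme, namely its scheme-theoretic image.

The main point is to produce a family from `a` and `b` with the same image in the triple adelic
group. That group is built from colimits over coherent sheaves: those mapping to the stalk of `F` at
the generic point and, for such a sheaf `G`, those mapping to `G_y / 𝔪_y ^ n` at a curve `y`. An
equality in a filtered colimit holds at some stage. Hence there is a coherent `G` under `F`,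
injective on charts, and for all `y` and `n` a coherent `H` under `G` with a global section that
gives `a_y` in `G_y / 𝔪_y ^ n` and whose values at every closed point of the curve are those of `b`.
This is the structure `Witness`. Conversely, for adeles induced by a family, the sheaf `i_* i^* F`
with its section `s_Z` is a witness.

Given `h ≠ 0` in `A`, let `p_i` be the minimal primes over `h`. Artin–Rees gives exponents `n_i`
such that elements of `N` whose image in `G` is locally in `p_i ^ n_i G` are locally in `hN`. The
sections `w_i ∈ H_i` of the corresponding witnesses form an element of `∏ H_i / K_i`, where `K_i`
consists of what looks like an element of `hN` in the truncation at `p_i`. This element is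
approximated at all maximal ideals by images of lifts of `b` to `N`, so by Krull it comes from some
`σ ∈ N`. The kernel of `N → ∏ H_i / K_i` lies in `hN` by unmixedness, so Artin–Rees shows that `σ`
induces `b` modulo `h` (`exists_global_approximation`, `exists_section_of_mapOne_eq_mapTwo`). Modulo
the ideal of `Z` such a `σ` is unique, again by Krull, and the local sections glue
(`exists_limitClosedSections`). -/

noncomputable section

namespace BeilinsonAdeles

open TopologicalSpace
open Scheme.Modules hiding pullback map_smul

/-! ### Sections of pullbacks over affine charts -/

section

section

variable {X Y Y' : Scheme.{u}} (g : Y' ⟶ Y) (f : Y ⟶ X) (f' : Y' ⟶ X) (h : g ≫ f = f')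

lemma preimage_preimage_of_comp_eq {g : Y' ⟶ Y} {f : Y ⟶ X} {f' : Y' ⟶ X} (h : g ≫ f = f')
    (U : X.Opens) : g ⁻¹ᵁ f ⁻¹ᵁ U = f' ⁻¹ᵁ U := by
  subst h; rfl

lemma pushforwardIso_hom_app_app (M : Y'.Modules) (U : X.Opens) :
    ((pushforwardIso g f f' h).hom.app M).app U =
      M.presheaf.map (eqToHom (preimage_preimage_of_comp_eq h U).symm).op := by
  simp only [pushforwardIso, Iso.trans_hom, NatTrans.comp_app, Hom.comp_app]
  exact Eq.trans (congrArg₂ (· ≫ ·) (pushforwardComp_hom_app_app g f U)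
    (pushforwardCongr_hom_app_app h U)) (Category.id_comp _)

lemma pushforwardIso_inv_app_app (M : Y'.Modules) (U : X.Opens) :
    ((pushforwardIso g f f' h).inv.app M).app U =
      M.presheaf.map (eqToHom (preimage_preimage_of_comp_eq h U)).op := by
  simp only [pushforwardIso, Iso.trans_inv, NatTrans.comp_app, Hom.comp_app]
  exact Eq.trans (congrArg₂ (· ≫ ·) (pushforwardCongr_inv_app_app h U)
    (pushforwardComp_inv_app_app g f U)) (Category.comp_id _)

end

section BaseChangeSections

variable {A B : CommRingCat.{u}} {X : Scheme.{u}}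

/-- Both actions are actions of sections of structure sheaves, so the comparison reduces to the
naturality of `Scheme.ΓSpecIso`. -/
lemma pushforward_smul (φ : A ⟶ B) (Y : (Spec B).Modules) (U : (Spec A).Opens) (a : A)
    (y : Γ((pushforward (Spec.map φ)).obj Y, U)) :
    a • y = HSMul.hSMul (α := B) (β := Γ(Y, Spec.map φ ⁻¹ᵁ U)) (γ := Γ(Y, Spec.map φ ⁻¹ᵁ U)) (φ a) y := by
  refine (smul_Spec_def a y).trans
    (Eq.trans ?_ (smul_Spec_def (M := Y) (U := Spec.map φ ⁻¹ᵁ U) (φ a) y).symm)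
  refine congrArg (fun r => HSMul.hSMul (α := Γ(Spec B, Spec.map φ ⁻¹ᵁ U))
    (β := Γ(Y, Spec.map φ ⁻¹ᵁ U)) (γ := Γ(Y, Spec.map φ ⁻¹ᵁ U)) r y) ?_
  have h : (Scheme.ΓSpecIso A).inv ≫ (Spec A).presheaf.map U.leTop.op ≫ (Spec.map φ).app U =
      φ ≫ (Scheme.ΓSpecIso B).inv ≫
        (Spec B).presheaf.map (Spec.map φ ⁻¹ᵁ U).leTop.op := by
    rw [(Spec.map φ).naturality]
    refine Eq.trans ?_ (Scheme.ΓSpecIso_inv_naturality_assoc φ _).symm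
    rfl
  exact congr($h a)

/-- Taking global sections is bijective on morphisms out of a sheaf associated to a module. -/
lemma bijective_moduleSpecΓFunctor_map (Y Z : (Spec A).Modules) [hY : IsIso Y.fromTildeΓ] :
    Function.Bijective (fun H : Y ⟶ Z => (moduleSpecΓFunctor (R := A)).map H) := by
  have h := ((tilde.adjunction (R := A)).homEquiv
      (moduleSpecΓFunctor.obj Y) Z).bijective.comp
    (Iso.homCongr (asIso Y.fromTildeΓ).symm (Iso.refl Z)).bijective
  refine (funext fun H => ?_ : (fun H : Y ⟶ Z => (moduleSpecΓFunctor (R := A)).map H) = _) ▸ h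
  refine Eq.symm (((tilde.adjunction (R := A)).homEquiv_unit _ _ _).trans ?_)
  refine Eq.trans (congrArg (fun v => _ ≫ moduleSpecΓFunctor.map (Y.fromTildeΓ ≫ v)) (Category.comp_id H)) ?_
  refine Eq.trans (congrArg (fun v => _ ≫ v) (moduleSpecΓFunctor.map_comp Y.fromTildeΓ H)) ?_
  refine Eq.trans (Category.assoc _ _ _).symm ?_
  refine Eq.trans (congrArg (fun v => v ≫ _) ((tilde.adjunction (R := A)).right_triangle_components Y)) ?_
  exact Category.id_comp _

variable (f : Spec A ⟶ X) [IsOpenImmersion f] (φ : A ⟶ B) (M : X.Modules)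

/-- For an open immersion `f : Spec A ⟶ X` and `φ : A ⟶ B`, the canonical morphism from the
restriction of `M` along `f` to the direct image of the pullback of `M` to `Spec B`. -/
def chartUnit (j : Spec B ⟶ X) (h : Spec.map φ ≫ f = j) :
    M.restrict f ⟶ (pushforward (Spec.map φ)).obj ((Scheme.Modules.pullback j).obj M) :=
  ((restrictAdjunction f).homEquiv _ _).symm
    ((pullbackPushforwardAdjunction j).unit.app M ≫ (pushforwardIso _ _ _ h).inv.app _)

/-- The map is a composite of three bijections: the adjunction for `j`, the identification of the
direct image along `j` with an iterated one, and the adjunction for the open immersion `f`. With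
`bijective_moduleSpecΓFunctor_map` it turns morphisms of sheaves into semilinear maps of modules. -/
lemma bijective_chartUnit_comp (j : Spec B ⟶ X) (h : Spec.map φ ≫ f = j)
    (Y : (Spec B).Modules) :
    Function.Bijective (fun H : (Scheme.Modules.pullback j).obj M ⟶ Y =>
      chartUnit f φ M j h ≫ (pushforward (Spec.map φ)).map H) := by
  have h₁ := ((pullbackPushforwardAdjunction j).homEquiv M Y).bijective
  have h₂ : Function.Bijective (fun v : M ⟶ (pushforward j).obj Y =>
      v ≫ (pushforwardIso (Spec.map φ) f j h).inv.app Y) :=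
    ⟨fun v w e => (cancel_mono _).1 e,
      fun w => ⟨w ≫ (pushforwardIso (Spec.map φ) f j h).hom.app Y,
        (Category.assoc _ _ _).trans ((congrArg (fun v => w ≫ v)
          (Iso.hom_inv_id_app _ _)).trans (Category.comp_id w))⟩⟩
  have h₃ := ((restrictAdjunction f).homEquiv M ((pushforward (Spec.map φ)).obj Y)).symm.bijective
  refine (funext fun H => ?_ : (fun H => _) = _) ▸ h₃.comp (h₂.comp h₁)
  rw [chartUnit, ← Adjunction.homEquiv_naturality_right_symm]
  refine congrArg _ ?_
  have := (pushforwardIso (Spec.map φ) f j h).inv.naturality H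
  refine (Category.assoc _ _ _).trans (Eq.trans (congrArg (fun v => _ ≫ v) this.symm) ?_)
  refine (Category.assoc _ _ _).symm.trans ?_
  exact congrArg (fun v => v ≫ _) (Adjunction.homEquiv_unit _ _ _ _).symm

lemma chartUnit_app (j : Spec B ⟶ X) (h : Spec.map φ ≫ f = j)
    (U : (Spec A).Opens) (hU : Spec.map φ ⁻¹ᵁ U ≤ j ⁻¹ᵁ f ''ᵁ U) :
    (chartUnit f φ M j h).app U = ((pullbackPushforwardAdjunction j).unit.app M).app (f ''ᵁ U) ≫
      ((Scheme.Modules.pullback j).obj M).presheaf.map (homOfLE hU).op := by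
  rw [chartUnit, Adjunction.homEquiv_counit, Functor.map_comp, Category.assoc, Hom.comp_app]
  refine congrArg (fun v => ((pullbackPushforwardAdjunction j).unit.app M).app (f ''ᵁ U) ≫ v) ?_
  rw [Hom.comp_app]
  refine Eq.trans (congrArg₂ (· ≫ ·) (pushforwardIso_inv_app_app _ _ _ h _ (f ''ᵁ U))
    (restrictAdjunction_counit_app_app _ _ _)) ?_
  exact (((Scheme.Modules.pullback j).obj M).presheaf.map_comp _ _).symm

end BaseChangeSections

end

/-! ### Pullback to an affine scheme as base change of modules -/

section

section
variable {X Y : Scheme.{u}}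

/-- The whole space is terminal among the open sets whose preimage contains a given one, whence
connectedness. Finality is what makes the pullback of the structure sheaf the structure sheaf. -/
lemma final_opensMap (f : X ⟶ Y) : (Opens.map f.base).Final where
  out U := by
    have : HasTerminal (StructuredArrow U (Opens.map f.base)) :=
      (IsTerminal.ofUniqueHom (Y := StructuredArrow.mk (Y := (⊤ : Opens Y)) (homOfLE le_top))
        (fun V => StructuredArrow.homMk (homOfLE le_top) (Subsingleton.elim _ _))
        (fun V m => StructuredArrow.hom_ext _ _ (Subsingleton.elim _ _))).hasTerminal
    exact isConnected_of_hasTerminal _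

/-- The pullback of the structure sheaf is the structure sheaf. -/
def pullbackUnitIso (f : X ⟶ Y) :
    SheafOfModules.unit X.ringCatSheaf ≅
      (Scheme.Modules.pullback f).obj (SheafOfModules.unit Y.ringCatSheaf) :=
  haveI : (SheafOfModules.pushforward.{u} f.toRingCatSheafHom).IsRightAdjoint :=
    inferInstanceAs (pushforward f).IsRightAdjoint
  haveI := final_opensMap f
  haveI : IsIso (SheafOfModules.pullbackObjUnitToUnit.{u} f.toRingCatSheafHom) := by
    apply SheafOfModules.instIsIsoPullbackObjUnitToUnitOfFinal
  (asIso (SheafOfModules.pullbackObjUnitToUnit f.toRingCatSheafHom)).symm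

/-- The pullback of a presentation. -/
def presentationPullback (f : X ⟶ Y) {M : Y.Modules} (P : M.Presentation) :
    ((Scheme.Modules.pullback f).obj M).Presentation :=
  have : PreservesColimitsOfSize.{u, u} (C := SheafOfModules Y.ringCatSheaf)
      (D := SheafOfModules X.ringCatSheaf) (Scheme.Modules.pullback f) :=
    (pullbackPushforwardAdjunction f).leftAdjoint_preservesColimits
  @SheafOfModules.Presentation.map _ _ _ _ _ _ _ _ _ _ _ _ _ P (Scheme.Modules.pullback f) this
    (pullbackUnitIso f)
end

variable {A B : CommRingCat.{u}} {X : Scheme.{u}}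

/-- Every sheaf associated to a module has a presentation. -/
def presentationOfIsIsoFromTildeΓ (M : (Spec A).Modules) [hM : IsIso M.fromTildeΓ] : M.Presentation :=
  @SheafOfModules.Presentation.ofIsIso _ _ _ _ _ _ _ _ M.fromTildeΓ hM
    (presentationTilde (R := A) ((modulesSpecToSheaf.obj M).presheaf.obj (.op ⊤)) .univ (by simp) _
      (Submodule.span_eq _))

variable (f : Spec A ⟶ X) [IsOpenImmersion f] (φ : A ⟶ B) (M : X.Modules)

/-- On an affine scheme, being associated to a module amounts to having a presentation, and pullback
preserves presentations since it preserves colimits and the structure sheaf. -/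
lemma isIso_fromTildeΓ_pullback (j : Spec B ⟶ X) (h : Spec.map φ ≫ f = j)
    [hM : IsIso (M.restrict f).fromTildeΓ] :
    IsIso ((Scheme.Modules.pullback j).obj M).fromTildeΓ := by
  subst h
  refine isIso_fromTildeΓ_of_presentation _ ?_
  have e : (Scheme.Modules.pullback (Spec.map φ)).obj (M.restrict f) ≅
      (Scheme.Modules.pullback (Spec.map φ ≫ f)).obj M :=
    (Scheme.Modules.pullback (Spec.map φ)).mapIso ((restrictFunctorIsoPullback f).app M) ≪≫
      (pullbackComp (Spec.map φ) f).app M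
  exact @SheafOfModules.Presentation.ofIsIso _ _ _ _ _ _ _ _ e.hom (Iso.isIso_hom e)
    (presentationPullback (Spec.map φ) (presentationOfIsIsoFromTildeΓ (M.restrict f)))

/-- The canonical map from the sections of `M` over an affine open subscheme `Spec A` to the
sections of the pullback of `M` to `Spec B`. -/
def chartMap (j : Spec B ⟶ X) (h : Spec.map φ ≫ f = j) :
    Γ(M.restrict f, ⊤) →ₛₗ[φ.hom] Γ((Scheme.Modules.pullback j).obj M, ⊤) where
  toFun x := (chartUnit f φ M j h).app ⊤ x
  map_add' := map_add _
  map_smul' a x := by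
    refine Eq.trans ?_ (pushforward_smul φ _ ⊤ a _)
    exact ((moduleSpecΓFunctor (R := A)).map (chartUnit f φ M j h)).hom.map_smul a x

/-- A semilinear map `c : N → P` over `φ : A → B` is a base change if it is universal among the
semilinear maps from `N` to `B`-modules. -/
def IsExtension {A B N P : Type u} [CommRing A] [CommRing B] (φ : A →+* B) [AddCommGroup N]
    [Module A N] [AddCommGroup P] [Module B P] (c : N →ₛₗ[φ] P) : Prop :=
  ∀ (Q : Type u) [AddCommGroup Q] [Module B Q] (g : N →ₛₗ[φ] Q),
    ∃! g' : P →ₗ[B] Q, ∀ x, g' (c x) = g x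

lemma exists_app_top_eq (Y Z : (Spec A).Modules) [hY : IsIso Y.fromTildeΓ]
    (g : Γ(Y, ⊤) →ₗ[A] Γ(Z, ⊤)) : ∃ H : Y ⟶ Z, ∀ x : Γ(Y, ⊤), H.app ⊤ x = g x := by
  obtain ⟨H, hH⟩ := (bijective_moduleSpecΓFunctor_map Y Z).2
    (ModuleCat.ofHom (X := (moduleSpecΓFunctor (R := A)).obj Y)
      (Y := (moduleSpecΓFunctor (R := A)).obj Z) g)
  exact ⟨H, fun x => congr($hH x)⟩

lemma hom_ext_of_app_top {Y Z : (Spec A).Modules} [hY : IsIso Y.fromTildeΓ]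
    {H₁ H₂ : Y ⟶ Z} (h : ∀ x : Γ(Y, ⊤), H₁.app ⊤ x = H₂.app ⊤ x) : H₁ = H₂ :=
  (bijective_moduleSpecΓFunctor_map Y Z).1 (ModuleCat.hom_ext (LinearMap.ext h))

/-- The map on global sections given by a morphism of sheaves of modules on `Spec A`. -/
def appTopₗ {Y Z : (Spec A).Modules} (H : Y ⟶ Z) : Γ(Y, ⊤) →ₗ[A] Γ(Z, ⊤) where
  toFun x := H.app ⊤ x
  map_add' := map_add _
  map_smul' a x := ((moduleSpecΓFunctor (R := A)).map H).hom.map_smul a x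

/-- The sections of the pullback of `M` to `Spec B` are obtained by base change from the sections
of `M` over the affine open subscheme `Spec A`. -/
theorem isExtension_chartMap (j : Spec B ⟶ X) (h : Spec.map φ ≫ f = j)
    [hM : IsIso (M.restrict f).fromTildeΓ] : IsExtension φ.hom (chartMap f φ M j h) := by
  intro Q _ _ g
  have := isIso_fromTildeΓ_pullback f φ M j h
  -- The test module is made into a sheaf so that the adjunctions apply; `e` leads back to modules.
  let Y : (Spec B).Modules := tilde (ModuleCat.of B Q)
  let e : Q ≃ₗ[B] Γ(Y, ⊤) := (tilde.isoTop (ModuleCat.of B Q)).toLinearEquiv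
  have h₂ := bijective_chartUnit_comp f φ M j h Y
  have key : ∀ H : (Scheme.Modules.pullback j).obj M ⟶ Y, ∀ x,
      (chartUnit f φ M j h ≫ (pushforward (Spec.map φ)).map H).app ⊤ x =
        H.app ⊤ (chartMap f φ M j h x) := fun H x => rfl
  refine existsUnique_of_exists_of_unique ?_ ?_
  · obtain ⟨v, hv⟩ := exists_app_top_eq (M.restrict f) ((pushforward (Spec.map φ)).obj Y)
      { toFun x := e (g x)
        map_add' x y := (congrArg e (map_add g x y)).trans (map_add e _ _)
        map_smul' a x := (congrArg e (map_smulₛₗ g a x)).trans <|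
          (LinearEquiv.map_smul e _ _).trans (pushforward_smul φ Y ⊤ a (e (g x))).symm }
    obtain ⟨H, rfl⟩ := h₂.2 v
    refine ⟨e.symm.toLinearMap ∘ₗ appTopₗ H, fun x => ?_⟩
    apply e.injective
    exact (e.apply_symm_apply _).trans ((key H x).symm.trans (hv x))
  · intro g₁ g₂ e₁ e₂
    obtain ⟨H₁, h₁⟩ := exists_app_top_eq ((Scheme.Modules.pullback j).obj M) Y (e.toLinearMap ∘ₗ g₁)
    obtain ⟨H₂, h₂'⟩ := exists_app_top_eq ((Scheme.Modules.pullback j).obj M) Y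
      (e.toLinearMap ∘ₗ g₂)
    have : H₁ = H₂ := by
      refine h₂.1 (hom_ext_of_app_top fun x => ?_)
      refine (key H₁ x).trans (Eq.trans ?_ (key H₂ x).symm)
      refine (h₁ _).trans (Eq.trans ?_ (h₂' _).symm)
      exact congrArg e ((e₁ x).trans (e₂ x).symm)
    subst this
    exact LinearMap.ext fun y => e.injective ((h₁ y).symm.trans (h₂' y))

end

/-! ### Localized quotients and base change of modules -/

section

/-- `B` is obtained from `A / I` by inverting the elements of `S`. -/
structure IsQuotLoc {A B : Type*} [CommRing A] [CommRing B] (φ : A →+* B) (S : Submonoid A)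
    (I : Ideal A) : Prop where
  isUnit : ∀ s ∈ S, IsUnit (φ s)
  surj : ∀ b, ∃ s ∈ S, ∃ a, φ s * b = φ a
  ker : ∀ a, φ a = 0 ↔ ∃ s ∈ S, s * a ∈ I

namespace IsExtension

variable {A B N P : Type u} [CommRing A] [CommRing B] {φ : A →+* B} [AddCommGroup N]
  [Module A N] [AddCommGroup P] [Module B P] {c : N →ₛₗ[φ] P} {S : Submonoid A} {I : Ideal A}

/-- The projection to the quotient by the span and the zero map both extend the zero semilinear map,
so they agree. -/
lemma span_range (hc : IsExtension φ c) : Submodule.span B (Set.range c) = ⊤ := by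
  obtain ⟨g, -, hg⟩ := hc (P ⧸ Submodule.span B (Set.range c)) 0
  have h := (hg (Submodule.mkQ _) fun x => (Submodule.Quotient.mk_eq_zero _).2
    (Submodule.subset_span ⟨x, rfl⟩)).trans (hg 0 fun _ => rfl).symm
  rw [← Submodule.ker_mkQ (Submodule.span B (Set.range c)), h, LinearMap.ker_zero]

/-- The fractions with numerator in the range of `c` form a `B`-submodule, by common denominators,
and the range generates `P`. -/
lemma exists_smul_eq (hc : IsExtension φ c) (h : IsQuotLoc φ S I) (p : P) :
    ∃ s ∈ S, ∃ n, φ s • p = c n := by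
  have hp : p ∈ Submodule.span B (Set.range c) := hc.span_range ▸ Submodule.mem_top
  induction hp using Submodule.span_induction with
  | mem x hx => obtain ⟨n, rfl⟩ := hx; exact ⟨1, S.one_mem, n, by simp⟩
  | zero => exact ⟨1, S.one_mem, 0, by simp⟩
  | add x y _ _ hx hy =>
    obtain ⟨s, hs, n, hn⟩ := hx
    obtain ⟨t, ht, m, hm⟩ := hy
    refine ⟨s * t, S.mul_mem hs ht, t • n + s • m, ?_⟩
    rw [map_add, map_smulₛₗ, map_smulₛₗ, ← hn, ← hm, smul_add, map_mul]
    simp only [smul_smul, mul_comm]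
  | smul b x _ hx =>
    obtain ⟨s, hs, n, hn⟩ := hx
    obtain ⟨t, ht, a, ha⟩ := h.surj b
    refine ⟨t * s, S.mul_mem ht hs, a • n, ?_⟩
    rw [map_smulₛₗ, ← hn, ← ha, smul_smul, smul_smul, map_mul]
    congr 1
    ring

-- `B` is a localization of `A / I`, so the corresponding localization of `N / IN` is a `B`-module.
-- Testing universality on it shows that no further elements die in `P`.
attribute [local instance] LocalizedModule.moduleOfIsLocalization in
lemma eq_zero_iff (hc : IsExtension φ c) (h : IsQuotLoc φ S I) (n : N) :
    c n = 0 ↔ ∃ s ∈ S, s • n ∈ I • (⊤ : Submodule A N) := by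
  have hI : ∀ a ∈ I, φ a = 0 := fun a ha => (h.ker a).2 ⟨1, S.one_mem, by simpa using ha⟩
  constructor
  · intro hn
    let ψ : A ⧸ I →+* B := Ideal.Quotient.lift I φ hI
    algebraize [ψ]
    let S' : Submonoid (A ⧸ I) := S.map (Ideal.Quotient.mk I)
    have : IsLocalization S' B :=
      { map_units := by
          rintro ⟨_, s, hs, rfl⟩
          exact h.isUnit s hs
        surj := by
          intro b
          obtain ⟨s, hs, a, ha⟩ := h.surj b
          exact ⟨(Ideal.Quotient.mk I a, ⟨_, s, hs, rfl⟩), (mul_comm _ _).trans ha⟩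
        exists_of_eq := by
          intro x y hxy
          obtain ⟨x, rfl⟩ := Ideal.Quotient.mk_surjective x
          obtain ⟨y, rfl⟩ := Ideal.Quotient.mk_surjective y
          have : φ (x - y) = 0 := by
            rw [map_sub, sub_eq_zero]
            exact hxy
          obtain ⟨s, hs, hsa⟩ := (h.ker _).1 this
          refine ⟨⟨_, s, hs, rfl⟩, ?_⟩
          change Ideal.Quotient.mk I s * _ = Ideal.Quotient.mk I s * _
          rw [← map_mul, ← map_mul, Ideal.Quotient.eq, ← mul_sub]
          exact hsa }
    let M := N ⧸ I • (⊤ : Submodule A N)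
    let q : N →ₛₗ[φ] LocalizedModule S' M :=
      { toFun n := LocalizedModule.mkLinearMap S' M (Submodule.Quotient.mk n)
        map_add' x y := by rw [Submodule.Quotient.mk_add, map_add]
        map_smul' a x := by
          have : (Submodule.Quotient.mk (a • x) : M) =
            Ideal.Quotient.mk I a • Submodule.Quotient.mk x := rfl
          rw [this, map_smul]
          exact (algebraMap_smul B (Ideal.Quotient.mk I a)
            (LocalizedModule.mkLinearMap S' M (Submodule.Quotient.mk x))).symm }
    obtain ⟨g, hg, -⟩ := hc _ q
    have h0 : LocalizedModule.mkLinearMap S' M (Submodule.Quotient.mk n) = 0 := by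
      have := hg n
      rw [hn, map_zero] at this
      exact this.symm
    obtain ⟨⟨_, s, hs, rfl⟩, h1⟩ := (IsLocalizedModule.eq_zero_iff S' _).1 h0
    refine ⟨s, hs, ?_⟩
    rw [← Submodule.Quotient.mk_eq_zero]
    exact h1
  · rintro ⟨s, hs, hn⟩
    have : ∀ x ∈ I • (⊤ : Submodule A N), c x = 0 := by
      intro x hx
      refine Submodule.smul_induction_on hx (fun r hr n _ => ?_) fun x y hx hy => ?_
      · rw [map_smulₛₗ, hI r hr, zero_smul]
      · rw [map_add, hx, hy, add_zero]
    have h1 := this _ hn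
    rw [map_smulₛₗ] at h1
    exact (h.isUnit s hs).smul_eq_zero.1 h1

end IsExtension

/-- The ring map from `A` to `R / m ^ n`, where `R` is the localization of `A` at a prime ideal. -/
lemma isQuotLoc_atPrime {A R : Type*} [CommRing A] [CommRing R] [Algebra A R] (p : Ideal A)
    [p.IsPrime] [IsLocalization.AtPrime R p] [IsLocalRing R] (n : ℕ) :
    IsQuotLoc ((Ideal.Quotient.mk (IsLocalRing.maximalIdeal R ^ n)).comp (algebraMap A R))
      p.primeCompl (p ^ n) where
  isUnit s hs := (IsLocalization.map_units R (⟨s, hs⟩ : p.primeCompl)).map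
    (Ideal.Quotient.mk (IsLocalRing.maximalIdeal R ^ n))
  surj b := by
    obtain ⟨b, rfl⟩ := Ideal.Quotient.mk_surjective b
    obtain ⟨⟨a, s⟩, h⟩ := IsLocalization.surj p.primeCompl b
    refine ⟨s, s.2, a, ?_⟩
    rw [RingHom.comp_apply, RingHom.comp_apply, ← map_mul, mul_comm, h]
  ker a := by
    rw [RingHom.comp_apply, Ideal.Quotient.eq_zero_iff_mem,
      ← IsLocalization.AtPrime.map_eq_maximalIdeal p R, ← Ideal.map_pow,
      IsLocalization.algebraMap_mem_map_algebraMap_iff p.primeCompl]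

lemma IsQuotLoc.bot {A B : Type*} [CommRing A] [CommRing B] (φ : A →+* B)
    (hφ : Function.Surjective φ) : IsQuotLoc φ ⊥ (RingHom.ker φ) where
  isUnit s hs := by
    obtain rfl := Submonoid.mem_bot.1 hs
    simp
  surj b := by
    obtain ⟨a, rfl⟩ := hφ b
    exact ⟨1, Submonoid.mem_bot.2 rfl, a, by simp⟩
  ker a := by simp [Submonoid.mem_bot, RingHom.mem_ker]

namespace IsExtension

variable {A B N P : Type u} [CommRing A] [CommRing B] {φ : A →+* B} [AddCommGroup N]
  [Module A N] [AddCommGroup P] [Module B P] {c : N →ₛₗ[φ] P}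

lemma surjective (hc : IsExtension φ c) (hφ : Function.Surjective φ) : Function.Surjective c := by
  intro p
  obtain ⟨s, hs, n, hn⟩ := hc.exists_smul_eq (.bot φ hφ) p
  obtain rfl := Submonoid.mem_bot.1 hs
  exact ⟨n, by rw [← hn, map_one, one_smul]⟩

lemma eq_zero_iff_of_surjective (hc : IsExtension φ c) (hφ : Function.Surjective φ) (n : N) :
    c n = 0 ↔ n ∈ RingHom.ker φ • (⊤ : Submodule A N) := by
  rw [hc.eq_zero_iff (.bot φ hφ)]
  simp [Submonoid.mem_bot]

end IsExtension

/-- An element outside a maximal ideal `p` is invertible modulo `p ^ n`. -/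
lemma exists_mul_sub_one_mem {A : Type*} [CommRing A] {p : Ideal A} (hp : p.IsMaximal) (n : ℕ)
    {s : A} (hs : s ∉ p) : ∃ t, t * s - 1 ∈ p ^ n := by
  obtain ⟨y, i, hi, h⟩ := hp.exists_inv hs
  have h1 : (Ideal.span {s}) ⊔ p = ⊤ := by
    rw [Ideal.eq_top_iff_one, ← h]
    exact add_mem (Ideal.mem_sup_left (Ideal.mul_mem_left _ _ (Ideal.mem_span_singleton_self s)))
      (Ideal.mem_sup_right hi)
  have h2 : Ideal.span {s} ⊔ p ^ n = ⊤ := Ideal.sup_pow_eq_top h1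
  obtain ⟨a, ha, b, hb, hab⟩ := Submodule.mem_sup.1 (h2 ▸ Submodule.mem_top : (1 : A) ∈ _)
  obtain ⟨t, rfl⟩ := Ideal.mem_span_singleton'.1 ha
  refine ⟨t, ?_⟩
  rw [← hab]
  simpa using hb

namespace IsQuotLoc

variable {A B : Type*} [CommRing A] [CommRing B] {φ : A →+* B} {p : Ideal A} [hp : p.IsMaximal]
  {n : ℕ}

/-- Elements outside a maximal ideal are already invertible modulo its powers, so at closed points
no localization is needed. -/
lemma ker_eq_pow (h : IsQuotLoc φ p.primeCompl (p ^ n)) : RingHom.ker φ = p ^ n := by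
  ext a
  rw [RingHom.mem_ker, h.ker]
  refine ⟨fun ⟨s, hs, ha⟩ => ?_, fun ha => ⟨1, Submonoid.one_mem _, by simpa using ha⟩⟩
  obtain ⟨t, ht⟩ := exists_mul_sub_one_mem hp n hs
  have := sub_mem (Ideal.mul_mem_left _ t ha) (Ideal.mul_mem_right a _ ht)
  convert this using 1
  ring

lemma surjective_of_isMaximal (h : IsQuotLoc φ p.primeCompl (p ^ n)) :
    Function.Surjective φ := by
  intro b
  obtain ⟨s, hs, a, ha⟩ := h.surj b
  obtain ⟨t, ht⟩ := exists_mul_sub_one_mem hp n hs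
  refine ⟨t * a, ?_⟩
  have h1 : φ (t * s - 1) = 0 := by rwa [← RingHom.mem_ker, h.ker_eq_pow]
  rw [map_mul, ← ha, ← mul_assoc, ← map_mul, ← sub_eq_zero]
  rw [map_sub, map_one] at h1
  rw [← sub_one_mul, h1, zero_mul]

end IsQuotLoc

lemma mem_smul_top_of_forall_mem {A ι : Type*} [CommRing A] [Finite ι] {L : ι → Type*} [∀ i, AddCommGroup (L i)]
    [∀ i, Module A (L i)] (I : Ideal A) (l : ∀ i, L i)
    (h : ∀ i, l i ∈ I • (⊤ : Submodule A (L i))) : l ∈ I • (⊤ : Submodule A (∀ i, L i)) := by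
  classical
  have := Fintype.ofFinite ι
  rw [← Finset.univ_sum_single l]
  refine sum_mem fun i _ => ?_
  have h1 := Submodule.mem_map_of_mem (f := LinearMap.single A L i) (h i)
  rw [Submodule.map_smul''] at h1
  exact Submodule.smul_mono le_rfl le_top h1

/-- The elements of `H` whose image under `v` is locally in the submodule `M`. -/
def localPreimage {A H P : Type*} [CommRing A] [AddCommGroup H] [Module A H] [AddCommGroup P] [Module A P]
    (p : Ideal A) [hp : p.IsPrime] (v : H →ₗ[A] P) (M : Submodule A P) : Submodule A H where
  carrier := {h | ∃ s ∉ p, s • v h ∈ M}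
  zero_mem' := ⟨1, hp.one_notMem, by simp⟩
  add_mem' := by
    rintro x y ⟨s, hs, hx⟩ ⟨t, ht, hy⟩
    refine ⟨s * t, hp.mul_notMem hs ht, ?_⟩
    rw [map_add, smul_add]
    refine add_mem ?_ ?_
    · rw [mul_comm, mul_smul]
      exact M.smul_mem _ hx
    · rw [mul_smul]
      exact M.smul_mem _ hy
  smul_mem' := by
    rintro a x ⟨s, hs, hx⟩
    refine ⟨s, hs, ?_⟩
    rw [map_smul, smul_comm]
    exact M.smul_mem _ hx

/-! ### Approximation at all maximal ideals, and associated primes -/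

section AdelicApproximation

variable {A : Type*} [CommRing A] [IsNoetherianRing A]

open Submodule

/-- A family of elements of `N`, given modulo all powers of all maximal ideals, that approximates
the images of an element `a` of `L`, is induced by an element of `N` with image `a`, up to the
kernel of `N → L`. -/
lemma exists_approximation {N L : Type*} [AddCommGroup N] [Module A N] [AddCommGroup L] [Module A L]
    [Module.Finite A N] [Module.Finite A L] (i : N →ₗ[A] L) (a : L) (β : Ideal A → ℕ → N)
    (hβ : ∀ x : Ideal A, x.IsMaximal → ∀ m m', m ≤ m' → β x m' - β x m ∈ x ^ m • (⊤ : Submodule A N))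
    (ha : ∀ x : Ideal A, x.IsMaximal → ∀ m, a - i (β x m) ∈ x ^ m • (⊤ : Submodule A L)) :
    ∃ σ, i σ = a ∧ ∀ x : Ideal A, x.IsMaximal → ∀ m,
      σ - β x m ∈ x ^ m • (⊤ : Submodule A N) ⊔ LinearMap.ker i := by
  have h1 : a ∈ LinearMap.range i := by
    -- If a maximal ideal `x` contained `J`, the class of `a` modulo the range would lie in all
    -- powers of `x`; Krull's theorem then yields `r ∈ x` with `1 - r ∈ J`, a contradiction.
    let J : Ideal A := (LinearMap.range i).colon {a}
    have hJ : J = ⊤ := by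
      by_contra hJ
      obtain ⟨x, hx, hJx⟩ := Ideal.exists_le_maximal J hJ
      have : (LinearMap.range i).mkQ a ∈ ⨅ m, x ^ m • (⊤ : Submodule A (L ⧸ LinearMap.range i)) := by
        rw [Submodule.mem_iInf]
        intro m
        have h := Submodule.mem_map_of_mem (f := (LinearMap.range i).mkQ) (ha x hx m)
        rw [Submodule.map_smul'', Submodule.map_top, Submodule.range_mkQ, map_sub] at h
        have h0 : (LinearMap.range i).mkQ (i (β x m)) = 0 := by simp
        rwa [h0, sub_zero] at h
      obtain ⟨r, hr⟩ := (Ideal.mem_iInf_smul_pow_eq_bot_iff x _).1 this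
      have h2 : 1 - (r : A) ∈ J := by
        rw [Submodule.mem_colon_singleton, sub_smul, one_smul, ← Submodule.Quotient.mk_eq_zero,
          Submodule.Quotient.mk_sub, Submodule.Quotient.mk_smul, sub_eq_zero]
        exact hr.symm
      apply hx.ne_top
      rw [Ideal.eq_top_iff_one]
      have := add_mem (hJx h2) r.2
      simpa using this
    have := (Ideal.eq_top_iff_one _).1 hJ
    rwa [Submodule.mem_colon_singleton, one_smul] at this
  obtain ⟨σ, rfl⟩ := h1
  refine ⟨σ, rfl, fun x hx m => ?_⟩
  -- By Artin–Rees, what becomes divisible by `x ^ (m + k)` in `L` is divisible by `x ^ m` in `N` up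
  -- to the kernel. So the approximation is used at level `m + k`.
  obtain ⟨k, hk⟩ := Ideal.exists_pow_inf_eq_pow_smul x (LinearMap.range i)
  have h2 : i (σ - β x (m + k)) ∈ x ^ (m + k) • (⊤ : Submodule A L) ⊓ LinearMap.range i := by
    refine ⟨?_, ⟨_, rfl⟩⟩
    rw [map_sub]
    exact ha x hx _
  rw [hk _ (Nat.le_add_left _ _), Nat.add_sub_cancel] at h2
  have h3 : i (σ - β x (m + k)) ∈ (x ^ m • (⊤ : Submodule A N)).map i := by
    rw [Submodule.map_smul'', Submodule.map_top]
    exact Submodule.smul_mono le_rfl inf_le_right h2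
  obtain ⟨y, hy, hy'⟩ := h3
  have h4 : σ - β x m = y + (β x (m + k) - β x m) + (σ - β x (m + k) - y) := by abel
  rw [h4]
  refine add_mem (mem_sup_left (add_mem hy (hβ x hx _ _ (Nat.le_add_right _ _))))
    (mem_sup_right ?_)
  rw [LinearMap.mem_ker, map_sub, hy', sub_self]

/-- If `p` is a minimal prime ideal over `(f)` and `g : N → N'` is injective, then elements of `N`
whose image in `N'` is locally divisible by a high power of `p` are locally divisible by `f`. -/
lemma exists_forall_smul_mem_of_mem_minimalPrimes {N N' : Type*} [AddCommGroup N] [Module A N]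
    [AddCommGroup N'] [Module A N'] [Module.Finite A N'] (g : N →ₗ[A] N')
    (hg : Function.Injective g) (f : A) (p : Ideal A) (hp : p ∈ (Ideal.span {f}).minimalPrimes) :
    ∃ n₀, ∀ n ≥ n₀, ∀ z, (∃ s ∉ p, s • g z ∈ p ^ n • (⊤ : Submodule A N')) →
      ∃ s ∉ p, s • z ∈ Ideal.span {f} • (⊤ : Submodule A N) := by
  have := hp.isPrime
  -- Here `k` is the Artin–Rees constant of the image of `g`; below, `p ^ j` lies in `(f)` after
  -- localization at `p`, because `p` is minimal over `(f)`. The bound is `j + k`.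
  obtain ⟨k, hk⟩ := Ideal.exists_pow_inf_eq_pow_smul p (LinearMap.range g)
  have h1 := IsLocalization.AtPrime.radical_map_of_mem_minimalPrimes (Localization.AtPrime p) p _ hp
  obtain ⟨j, hj⟩ := Ideal.exists_pow_le_of_le_radical_of_fg h1.ge (IsNoetherian.noetherian _)
  have h2 : ∀ a ∈ p ^ j, ∃ s ∉ p, s * a ∈ Ideal.span {f} := by
    intro a ha
    refine (IsLocalization.algebraMap_mem_map_algebraMap_iff p.primeCompl
      (Localization.AtPrime p) _ _).1 (hj ?_)
    rw [← Ideal.map_pow]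
    exact Ideal.mem_map_of_mem _ ha
  have h3 : ∀ z ∈ p ^ j • (⊤ : Submodule A N), ∃ s ∉ p,
      s • z ∈ Ideal.span {f} • (⊤ : Submodule A N) := by
    intro z hz
    refine Submodule.smul_induction_on hz (fun a ha y _ => ?_) ?_
    · obtain ⟨s, hs, h⟩ := h2 a ha
      exact ⟨s, hs, by rw [smul_smul]; exact Submodule.smul_mem_smul h mem_top⟩
    · rintro x y ⟨s, hs, hx⟩ ⟨t, ht, hy⟩
      refine ⟨s * t, this.mul_notMem hs ht, ?_⟩
      rw [smul_add]
      refine add_mem ?_ ?_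
      · rw [mul_comm, mul_smul]
        exact Submodule.smul_mem _ _ hx
      · rw [mul_smul]
        exact Submodule.smul_mem _ _ hy
  refine ⟨j + k, fun n hn z => ?_⟩
  rintro ⟨s, hs, hz⟩
  have h4 : g (s • z) ∈ p ^ n • (⊤ : Submodule A N') ⊓ LinearMap.range g :=
    ⟨by rwa [map_smul], ⟨_, rfl⟩⟩
  rw [hk n (le_trans (Nat.le_add_left _ _) hn)] at h4
  have h5 : g (s • z) ∈ (p ^ j • (⊤ : Submodule A N)).map g := by
    rw [Submodule.map_smul'', Submodule.map_top]
    exact Submodule.smul_mono (Ideal.pow_le_pow_right (by omega)) inf_le_right h4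
  obtain ⟨y, hy, hy'⟩ := h5
  obtain rfl := hg hy'
  obtain ⟨t, ht, h⟩ := h3 _ hy
  exact ⟨t * s, this.mul_notMem ht hs, by rwa [mul_smul]⟩

/-- In the application `N` are the sections of `F` over a chart, `p i` the curves in the divisor of
`f`, `H i` the sections of the sheaf of a witness, `w i` the section it carries, and `P i` a
truncation at the curve. `exists_approximation` is applied to the map from `N` to the product of the
`H i ⧸ K i`, where `K i` is what cannot be told from `fN` at `p i`. Its kernel is in `fN` by `hd`
and `hAss`. -/
lemma exists_global_approximation {ι : Type*} [Finite ι] {N : Type*} [AddCommGroup N] [Module A N]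
    [Module.Finite A N] (f : A) (p : ι → Ideal A) [hp : ∀ i, (p i).IsPrime]
    (hAss : ∀ z : N, (∀ i, ∃ s ∉ p i, s • z ∈ Ideal.span {f} • (⊤ : Submodule A N)) →
      z ∈ Ideal.span {f} • (⊤ : Submodule A N))
    (n : ι → ℕ) {H P : ι → Type*} [∀ i, AddCommGroup (H i)] [∀ i, Module A (H i)]
    [∀ i, Module.Finite A (H i)] [∀ i, AddCommGroup (P i)] [∀ i, Module A (P i)]
    (hP : ∀ i, ∀ a ∈ p i ^ n i, ∀ y : P i, a • y = 0)
    (u : ∀ i, N →ₗ[A] H i) (v : ∀ i, H i →ₗ[A] P i)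
    (hd : ∀ i z, v i (u i z) = 0 → ∃ s ∉ p i, s • z ∈ Ideal.span {f} • (⊤ : Submodule A N))
    (w : ∀ i, H i) (β : Ideal A → ℕ → N)
    (hβ : ∀ x : Ideal A, x.IsMaximal → ∀ m m', m ≤ m' → β x m' - β x m ∈ x ^ m • (⊤ : Submodule A N))
    (hw : ∀ i, ∀ x : Ideal A, x.IsMaximal → p i ≤ x → ∀ m,
      w i - u i (β x m) ∈ x ^ m • (⊤ : Submodule A (H i))) :
    ∃ σ, (∀ x : Ideal A, x.IsMaximal → ∀ m,
        σ - β x m ∈ x ^ m • (⊤ : Submodule A N) ⊔ Ideal.span {f} • (⊤ : Submodule A N)) ∧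
      ∀ i, ∃ s ∉ p i, ∃ z ∈ Ideal.span {f} • (⊤ : Submodule A N),
        s • (v i (w i) - v i (u i σ)) = v i (u i z) := by
  let K (i : ι) : Submodule A (H i) := localPreimage (p i) (v i)
    ((Ideal.span {f} • (⊤ : Submodule A N)).map (v i ∘ₗ u i))
  let j : N →ₗ[A] ∀ i, H i ⧸ K i := LinearMap.pi fun i => (K i).mkQ ∘ₗ u i
  have hker : LinearMap.ker j ≤ Ideal.span {f} • (⊤ : Submodule A N) := by
    intro z hz
    refine hAss z fun i => ?_
    have h1 : (K i).mkQ (u i z) = 0 := congrFun (LinearMap.mem_ker.1 hz) i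
    obtain ⟨s, hs, z', hz', h2⟩ := (Submodule.Quotient.mk_eq_zero _).1 h1
    obtain ⟨t, ht, h3⟩ := hd i (s • z - z') (by
      rw [map_sub, map_sub, map_smul, map_smul, sub_eq_zero]
      exact h2.symm)
    refine ⟨t * s, (hp i).mul_notMem ht hs, ?_⟩
    rw [smul_sub, smul_smul] at h3
    have := add_mem h3 (Submodule.smul_mem _ t hz')
    rwa [sub_add_cancel] at this
  obtain ⟨σ, hσ, h⟩ := exists_approximation j (fun i => (K i).mkQ (w i)) β hβ (by
    intro x hx m
    refine mem_smul_top_of_forall_mem _ _ fun i => ?_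
    change (K i).mkQ (w i) - (K i).mkQ (u i (β x m)) ∈ _
    by_cases hpx : p i ≤ x
    · rw [← map_sub]
      have h1 := Submodule.mem_map_of_mem (f := (K i).mkQ) (hw i x hx hpx m)
      rwa [Submodule.map_smul'', Submodule.map_top, Submodule.range_mkQ] at h1
    · have h1 : ¬ p i ^ n i ≤ x := fun h => hpx (hx.isPrime.le_of_pow_le h)
      -- Off the curve there is nothing to approximate: `r` kills `H i ⧸ K i` and is invertible
      -- modulo `x ^ m`, so every element of this quotient is divisible by `x ^ m`.
      obtain ⟨r, hr, hrx⟩ := SetLike.not_le_iff_exists.1 h1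
      obtain ⟨t, ht⟩ := exists_mul_sub_one_mem hx m hrx
      rw [← map_sub]
      have h2 : r • (w i - u i (β x m)) ∈ K i := by
        refine ⟨1, (hp i).one_notMem, ?_⟩
        rw [map_smul, hP i r hr, smul_zero]
        exact zero_mem _
      have h3 : (K i).mkQ (w i - u i (β x m)) =
          -((t * r - 1) • (K i).mkQ (w i - u i (β x m))) := by
        have h4 : r • (K i).mkQ (w i - u i (β x m)) = 0 := by
          rw [← map_smul]
          exact (Submodule.Quotient.mk_eq_zero _).2 h2
        rw [sub_smul, one_smul, mul_smul, h4, smul_zero, zero_sub, neg_neg]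
      rw [h3]
      exact neg_mem (Submodule.smul_mem_smul ht mem_top))
  refine ⟨σ, fun x hx m => sup_le_sup_left hker _ (h x hx m), fun i => ?_⟩
  have h1 : (K i).mkQ (w i - u i σ) = 0 := by
    rw [map_sub, sub_eq_zero]
    exact (congrFun hσ i).symm
  obtain ⟨s, hs, z, hz, h2⟩ := (Submodule.Quotient.mk_eq_zero _).1 h1
  exact ⟨s, hs, z, hz, by rw [← map_sub]; exact h2.symm⟩

/-- An element of `N` that is in `fN` at all the associated prime ideals of `N ⧸ fN` is in `fN`. -/
lemma mem_smul_of_forall_isAssociatedPrime {N : Type*} [AddCommGroup N] [Module A N]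
    (M : Submodule A N) (z : N)
    (h : ∀ p : Ideal A, p ∈ associatedPrimes A (N ⧸ M) → ∃ s ∉ p, s • z ∈ M) : z ∈ M := by
  by_contra hz
  obtain ⟨p, hp, hle⟩ := exists_le_isAssociatedPrime_of_isNoetherianRing A (M.mkQ z)
    (by simpa using hz)
  obtain ⟨s, hs, hsz⟩ := h p hp
  refine hs (hle ?_)
  rw [Submodule.mem_colon_singleton, Submodule.mem_bot, ← map_smul]
  exact (Submodule.Quotient.mk_eq_zero _).2 hsz

/-- If the localization `R` of the domain `A` at the prime ideal `p` has a prime element that does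
not generate the maximal ideal, then `p` is not associated to `N ⧸ fN`, for free modules `N`. -/
lemma notMem_associatedPrimes {N : Type*} [AddCommGroup N] [Module A N] [Module.Free A N]
    [Module.Finite A N] {f : A} {p : Ideal A} [p.IsPrime] {R : Type*} [CommRing R]
    [IsDomain R] [IsLocalRing R] [Algebra A R] [IsLocalization.AtPrime R p]
    (hf : algebraMap A R f ≠ 0) {a b : R} (ha : Prime a) (ham : a ∈ IsLocalRing.maximalIdeal R)
    (hbm : b ∈ IsLocalRing.maximalIdeal R) (hab : ¬ a ∣ b) :
    p ∉ associatedPrimes A (N ⧸ Ideal.span {f} • (⊤ : Submodule A N)) := by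
  intro hp
  obtain ⟨-, z, hz⟩ := isAssociatedPrime_iff.1 hp
  obtain ⟨z, rfl⟩ := Submodule.mkQ_surjective _ z
  have hmem : ∀ s, s ∈ p ↔ s • z ∈ Ideal.span {f} • (⊤ : Submodule A N) := by
    intro s
    rw [hz, Submodule.mem_colon_singleton, Submodule.mem_bot, ← map_smul]
    exact Submodule.Quotient.mk_eq_zero _
  let B := Module.Free.chooseBasis A N
  have hmem' : ∀ s, s ∈ p ↔ ∀ i, s * B.repr z i ∈ Ideal.span {f} := by
    intro s
    rw [hmem]
    constructor
    · intro h i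
      rw [Submodule.ideal_span_singleton_smul, Submodule.mem_smul_pointwise_iff_exists] at h
      obtain ⟨y, -, hy⟩ := h
      have : s * B.repr z i = f * B.repr y i := by
        rw [← smul_eq_mul, ← smul_eq_mul, ← Finsupp.smul_apply, ← Finsupp.smul_apply, ← map_smul,
          ← map_smul, hy]
      rw [this]
      exact Ideal.mul_mem_right _ _ (Ideal.mem_span_singleton_self f)
    · intro h
      rw [← B.sum_repr (s • z)]
      refine sum_mem fun i _ => Submodule.smul_mem_smul ?_ mem_top
      rw [map_smul, Finsupp.smul_apply, smul_eq_mul]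
      exact h i
  have key : ∀ i, ∃ s ∉ p, s * B.repr z i ∈ Ideal.span {f} := by
    intro i
    have h1 : ∀ r ∈ IsLocalRing.maximalIdeal R, algebraMap A R f ∣ r * algebraMap A R (B.repr z i) := by
      intro r hr
      rw [← Ideal.mem_span_singleton]
      rw [← IsLocalization.AtPrime.map_eq_maximalIdeal p R] at hr
      refine Submodule.span_induction ?_ (by simp) (fun x y _ _ hx hy => ?_)
        (fun c x _ hx => ?_) hr
      · rintro _ ⟨s, hs, rfl⟩
        obtain ⟨c, hc⟩ := Ideal.mem_span_singleton.1 ((hmem' s).1 hs i)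
        rw [← map_mul, hc, map_mul]
        exact Ideal.mul_mem_right _ _ (Ideal.mem_span_singleton_self _)
      · rw [add_mul]
        exact add_mem hx hy
      · rw [smul_eq_mul, mul_assoc]
        exact Ideal.mul_mem_left _ _ hx
    -- Multiplying a coordinate of `z` by `a` and by `b` gives `fα` and `fγ`, so `aγ = bα`. The
    -- prime `a` does not divide `b`, hence divides `α`; cancelling `a` shows that the coordinate is
    -- divisible by `f` in `R`.
    obtain ⟨α, hα⟩ := h1 a ham
    obtain ⟨γ, hγ⟩ := h1 b hbm
    have h2 : a * γ = b * α := by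
      refine mul_left_cancel₀ hf ?_
      calc algebraMap A R f * (a * γ) = a * (algebraMap A R f * γ) := by ring
        _ = b * (a * algebraMap A R (B.repr z i)) := by rw [← hγ]; ring
        _ = _ := by rw [hα]; ring
    obtain ⟨α', rfl⟩ := (ha.dvd_or_dvd ⟨γ, h2.symm⟩).resolve_left hab
    have h3 : algebraMap A R (B.repr z i) = algebraMap A R f * α' := by
      refine mul_left_cancel₀ ha.ne_zero ?_
      rw [hα]
      ring
    refine (IsLocalization.algebraMap_mem_map_algebraMap_iff p.primeCompl R _ _).1 ?_
    rw [h3]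
    exact Ideal.mul_mem_right _ _ (Ideal.mem_map_of_mem _ (Ideal.mem_span_singleton_self _))
  choose s hs h using key
  -- The product of the denominators of all coordinates annihilates the class of `z`, though none of
  -- its factors is in the prime `p`.
  have h1 : ∏ i, s i ∈ p := by
    rw [hmem']
    intro i
    rw [← Finset.prod_erase_mul _ _ (Finset.mem_univ i), mul_assoc]
    exact Ideal.mul_mem_left _ _ (h i)
  obtain ⟨i, -, hi⟩ := (Ideal.IsPrime.prod_mem_iff (s := Finset.univ)).1 h1
  exact hs i hi

end AdelicApproximation

end

/-! ### Regular local rings and heights of maximal ideals -/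

section

section RegularLocal

open IsLocalRing

/-- A nonzero element of the cotangent space of a Noetherian local ring is part of a basis. -/
lemma spanFinrank_quotient_lt {R : Type u} [CommRing R] [IsLocalRing R] [IsNoetherianRing R]
    (a : R) (ha : a ∈ maximalIdeal R) (ha' : a ∉ maximalIdeal R ^ 2)
    [IsLocalRing (R ⧸ Ideal.span {a})] :
    (maximalIdeal (R ⧸ Ideal.span {a})).spanFinrank + 1 ≤ (maximalIdeal R).spanFinrank := by
  classical
  let τ := (maximalIdeal R).toCotangent
  have hτ : Function.Surjective τ := Ideal.toCotangent_surjective _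
  have h0 : τ ⟨a, ha⟩ ≠ 0 := fun h => ha' ((Ideal.toCotangent_eq_zero _ _).1 h)
  let V := CotangentSpace R
  have hli : LinearIndepOn (ResidueField R) id ({τ ⟨a, ha⟩} : Set V) :=
    LinearIndepOn.singleton h0
  let E : Set V := hli.extend (Set.subset_univ _)
  have hE : {τ ⟨a, ha⟩} ⊆ E := hli.subset_extend _
  have hspan : Submodule.span (ResidueField R) E = ⊤ := by
    have := (Module.Basis.extend hli).span_eq
    rwa [Module.Basis.range_extend] at this
  have : Finite E := Module.Finite.finite_basis (Module.Basis.extend hli)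
  have hcard : Module.finrank (ResidueField R) V = E.ncard :=
    Module.finrank_eq_nat_card_basis (Module.Basis.extend hli)
  let E' : Set V := E \ {τ ⟨a, ha⟩}
  have hfin : E'.Finite := Set.Finite.subset (Set.toFinite E) Set.sdiff_subset
  let l := Function.surjInv hτ
  -- By Nakayama, lifts of a basis of the cotangent space containing the class of `a` generate the
  -- maximal ideal; modulo `a`, one of these generators disappears.
  let s : Set (maximalIdeal R) := {⟨a, ha⟩} ∪ l '' E'
  have hs : τ '' s = E := by
    rw [Set.image_union, Set.image_singleton, Set.image_image]
    simp only [l, Function.surjInv_eq hτ, Set.image_id']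
    exact Set.union_sdiff_cancel hE
  have hs' : Submodule.span R s = ⊤ := by
    rw [← CotangentSpace.span_image_eq_top_iff]
    exact (congrArg (Submodule.span (ResidueField R)) hs).trans hspan
  let q : R →+* R ⧸ Ideal.span {a} := Ideal.Quotient.mk _
  have hm : maximalIdeal (R ⧸ Ideal.span {a}) = Ideal.span ((fun x => q (l x)) '' E') := by
    apply le_antisymm
    · intro y hy
      obtain ⟨y, rfl⟩ := Ideal.Quotient.mk_surjective y
      have hy' : y ∈ maximalIdeal R := by
        rw [mem_maximalIdeal, mem_nonunits_iff] at hy ⊢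
        exact fun h => hy (h.map _)
      have h1 : (⟨y, hy'⟩ : maximalIdeal R) ∈ Submodule.span R s := hs' ▸ Submodule.mem_top
      refine Submodule.span_induction
        (p := fun (x : maximalIdeal R) _ => q (x : R) ∈ Ideal.span ((fun x => q (l x)) '' E'))
        ?_ ?_ ?_ ?_ h1
      · rintro _ (rfl | ⟨e, he, rfl⟩)
        · have : q a = 0 := Ideal.Quotient.eq_zero_iff_mem.2 (Ideal.mem_span_singleton_self a)
          exact this ▸ zero_mem _
        · exact Ideal.subset_span ⟨e, he, rfl⟩
      · simp
      · intro x y _ _ hx hy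
        rw [Submodule.coe_add, map_add]
        exact add_mem hx hy
      · intro c x _ hx
        rw [Submodule.coe_smul, smul_eq_mul, map_mul]
        exact Ideal.mul_mem_left _ _ hx
    · rw [Ideal.span_le]
      rintro _ ⟨e, he, rfl⟩
      have : IsLocalHom q := .of_surjective q Ideal.Quotient.mk_surjective
      exact map_nonunit q _ (l e).2
  rw [spanFinrank_maximalIdeal_eq_finrank_cotangentSpace (R := R), hcard, hm]
  have h1 : E'.ncard + 1 = E.ncard := Set.ncard_sdiff_singleton_add_one (hE rfl) (Set.toFinite E)
  rw [← h1]
  refine Nat.add_le_add_right ?_ 1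
  exact (Submodule.spanFinrank_span_le_ncard_of_finite (hfin.image _)).trans
    (Set.ncard_image_le hfin)

lemma exists_ringKrullDim_eq (R : Type u) [CommRing R] [IsLocalRing R] [IsNoetherianRing R] :
    ∃ n : ℕ, ringKrullDim R = n := by
  obtain ⟨n, hn⟩ := ENat.ne_top_iff_exists.1 (Ideal.height_ne_top (maximalIdeal.isMaximal R).ne_top)
  refine ⟨n, ?_⟩
  rw [← maximalIdeal_height_eq_ringKrullDim, ← hn]
  rfl

/-- Dividing by `a` lowers the embedding dimension by at least one and the Krull dimension by at
most one. As the two numbers agree for `R`, they agree for the quotient. -/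
lemma IsRegularLocalRing.quotient {R : Type u} [CommRing R] [IsRegularLocalRing R]
    (a : R) (ha : a ∈ maximalIdeal R) (ha' : a ∉ maximalIdeal R ^ 2) :
    IsRegularLocalRing (R ⧸ Ideal.span {a}) ∧
      ringKrullDim (R ⧸ Ideal.span {a}) + 1 = ringKrullDim R := by
  have : Nontrivial (R ⧸ Ideal.span {a}) := by
    rw [Ideal.Quotient.nontrivial_iff, ne_eq, Ideal.span_singleton_eq_top]
    exact ha
  have : IsLocalRing (R ⧸ Ideal.span {a}) := .of_surjective' _ Ideal.Quotient.mk_surjective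
  have h1 := spanFinrank_quotient_lt a ha ha'
  have h2 := ringKrullDim_le_ringKrullDim_quotient_add_encard {a} (R := R) (by
    rwa [Set.singleton_subset_iff, SetLike.mem_coe, ringJacobson_eq_maximalIdeal])
  have h3 := IsRegularLocalRing.spanFinrank_maximalIdeal (R := R)
  have h4 := ringKrullDim_le_spanFinrank_maximalIdeal (R := R ⧸ Ideal.span {a})
  rw [Set.encard_singleton] at h2
  have h1' : ((maximalIdeal (R ⧸ Ideal.span {a})).spanFinrank : WithBot ℕ∞) + 1 ≤
      (maximalIdeal R).spanFinrank := by exact_mod_cast h1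
  have h5 : ((maximalIdeal (R ⧸ Ideal.span {a})).spanFinrank : WithBot ℕ∞) ≤
      ringKrullDim (R ⧸ Ideal.span {a}) := by
    rw [h3] at h1'
    have := h1'.trans h2
    obtain ⟨m, hm⟩ := exists_ringKrullDim_eq (R ⧸ Ideal.span {a})
    rw [hm] at this ⊢
    have : (maximalIdeal (R ⧸ Ideal.span {a})).spanFinrank + 1 ≤ m + 1 := by exact_mod_cast this
    exact_mod_cast Nat.le_of_succ_le_succ this
  have h6 : ringKrullDim (R ⧸ Ideal.span {a}) + 1 = ringKrullDim R :=
    le_antisymm (((add_le_add_left h4 1).trans h1').trans h3.le) h2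
  exact ⟨IsRegularLocalRing.of_spanFinrank_maximalIdeal_le _ h5, h6⟩

/-- Prime avoidance, in the form that admits the non-prime ideal `𝔪 ^ 2`: otherwise `𝔪` lies in `𝔪 ^
2`, and is zero by Nakayama, or in a minimal prime. Both contradict positive dimension. -/
lemma exists_mem_notMem_sq {R : Type u} [CommRing R] [IsLocalRing R] [IsNoetherianRing R]
    (h : ringKrullDim R ≠ 0) :
    ∃ a ∈ maximalIdeal R, a ∉ maximalIdeal R ^ 2 ∧ ∀ p ∈ minimalPrimes R, a ∉ p := by
  classical
  have hdim : maximalIdeal R ∉ minimalPrimes R := by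
    rw [← Ideal.height_eq_zero_iff]
    intro h0
    rw [← maximalIdeal_height_eq_ringKrullDim, h0] at h
    exact h rfl
  have hfin : (minimalPrimes R).Finite := Ideal.finite_minimalPrimes_of_isNoetherianRing R ⊥
  by_contra! hc
  let s : Finset (Ideal R) := insert (maximalIdeal R ^ 2) hfin.toFinset
  have h1 : (maximalIdeal R : Set R) ⊆ ⋃ i ∈ (s : Set (Ideal R)), (i : Set R) := by
    intro a ha
    by_cases ha' : a ∈ maximalIdeal R ^ 2
    · exact Set.mem_biUnion (x := maximalIdeal R ^ 2) (by simp [s]) ha'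
    · obtain ⟨p, hp, hap⟩ := hc a ha ha'
      exact Set.mem_biUnion (x := p) (by simp [s, hp]) hap
  obtain ⟨p, hp, hle⟩ := (Ideal.subset_union_prime (f := id) (maximalIdeal R ^ 2)
    (maximalIdeal R ^ 2) (fun i hi hi' _ => by
      simp only [s, Finset.mem_insert, Set.Finite.mem_toFinset] at hi
      exact (hi.resolve_left hi').isPrime)).1 h1
  simp only [s, Finset.mem_insert, Set.Finite.mem_toFinset, id] at hp hle
  obtain rfl | hp := hp
  · have h2 : maximalIdeal R = ⊥ := Submodule.eq_bot_of_le_smul_of_le_jacobson_bot (maximalIdeal R)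
      _ (IsNoetherian.noetherian _) (by rwa [smul_eq_mul, ← sq])
      (by rw [jacobson_eq_maximalIdeal _ bot_ne_top])
    exact hdim (by
      rw [h2]
      have := h2 ▸ (maximalIdeal.isMaximal R).isPrime
      exact ⟨⟨this, le_rfl⟩, fun _ _ _ => bot_le⟩)
  · have := hp.isPrime
    rw [(maximalIdeal.isMaximal R).eq_of_le this.ne_top hle] at hdim
    exact hdim hp

/-- Induction on the dimension. For `a` as in `exists_mem_notMem_sq`, `R / (a)` is a domain, so
`(a)` is prime and contains a minimal prime `Q`. Since `a ∉ Q`, every element of `Q` is `a` times an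
element of `Q`, and Nakayama gives `Q = 0`. -/
instance IsRegularLocalRing.isDomain {R : Type u} [CommRing R] [IsRegularLocalRing R] :
    IsDomain R := by
  obtain ⟨n, hn⟩ : ∃ n : ℕ, ringKrullDim R = n :=
    ⟨_, (IsRegularLocalRing.spanFinrank_maximalIdeal (R := R)).symm⟩
  induction n generalizing R with
  | zero =>
    have h := IsRegularLocalRing.spanFinrank_maximalIdeal (R := R)
    rw [hn] at h
    have h1 : (maximalIdeal R).spanFinrank = 0 := by exact_mod_cast h
    rw [Submodule.spanFinrank_eq_zero_iff_eq_bot (IsNoetherian.noetherian _)] at h1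
    exact (isField_iff_maximalIdeal_eq.2 h1).isDomain
  | succ n ih =>
    obtain ⟨a, ha, ha', hmin⟩ := exists_mem_notMem_sq (R := R) (by
      rw [hn]
      exact_mod_cast Nat.succ_ne_zero n)
    obtain ⟨h1, h2⟩ := IsRegularLocalRing.quotient a ha ha'
    have h3 : IsDomain (R ⧸ Ideal.span {a}) := ih (by
      obtain ⟨m, hm⟩ := exists_ringKrullDim_eq (R ⧸ Ideal.span {a})
      rw [hn, hm] at h2
      have : m + 1 = n + 1 := by exact_mod_cast h2
      rw [hm, Nat.succ_injective this])
    have hP : (Ideal.span {a}).IsPrime := (Ideal.Quotient.isDomain_iff_prime _).1 h3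
    obtain ⟨Q, hQ, hQP⟩ := Ideal.exists_minimalPrimes_le (I := (⊥ : Ideal R)) (bot_le (a := Ideal.span {a}))
    have hQp := hQ.isPrime
    have h4 : Q = ⊥ := by
      refine Submodule.eq_bot_of_le_smul_of_le_jacobson_bot (Ideal.span {a}) _
        (IsNoetherian.noetherian _) (fun x hx => ?_) ?_
      · obtain ⟨y, rfl⟩ := Ideal.mem_span_singleton.1 (hQP hx)
        exact Submodule.smul_mem_smul (Ideal.mem_span_singleton_self a)
          ((hQp.mem_or_mem hx).resolve_left (hmin Q hQ))
      · rw [jacobson_eq_maximalIdeal _ bot_ne_top, Ideal.span_singleton_le_iff_mem]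
        exact ha
    rw [h4] at hQp
    exact IsDomain.of_bot_isPrime R

/-- A regular local ring of dimension two has a prime element that does not generate the maximal
ideal. -/
lemma exists_prime_not_dvd {R : Type u} [CommRing R] [IsRegularLocalRing R]
    (h : 2 ≤ ringKrullDim R) : ∃ a b : R, Prime a ∧ a ∈ maximalIdeal R ∧ b ∈ maximalIdeal R ∧
      ¬ a ∣ b := by
  obtain ⟨a, ha, ha', -⟩ := exists_mem_notMem_sq (R := R) (by
    intro h0
    rw [h0] at h
    exact absurd h (by decide))
  obtain ⟨h1, h2⟩ := IsRegularLocalRing.quotient a ha ha'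
  have hP : (Ideal.span {a}).IsPrime := (Ideal.Quotient.isDomain_iff_prime _).1 inferInstance
  have ha0 : a ≠ 0 := fun h => ha' (h ▸ zero_mem _)
  refine Exists.imp' id (fun _ => id) ⟨a, ?_⟩
  by_contra! hc
  have h3 : maximalIdeal R = Ideal.span {a} := by
    refine le_antisymm (fun b hb => Ideal.mem_span_singleton.2 ?_)
      ((Ideal.span_singleton_le_iff_mem _).2 ha)
    exact hc b ((Ideal.span_singleton_prime ha0).1 hP) ha hb
  have h4 : (maximalIdeal R).spanFinrank ≤ 1 := by
    rw [h3]
    simpa using Submodule.spanFinrank_span_le_ncard_of_finite (R := R) (Set.finite_singleton a)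
  rw [← IsRegularLocalRing.spanFinrank_maximalIdeal] at h
  have h5 : 2 ≤ (maximalIdeal R).spanFinrank := by exact_mod_cast h
  omega

end RegularLocal

section Dimension

/-- The maximal ideals of a polynomial ring in `n` variables over a field have height `n`. -/
lemma height_mvPolynomial (k : Type u) [Field k] (n : ℕ) (p : Ideal (MvPolynomial (Fin n) k))
    (hp : p.IsMaximal) : p.height = n := by
  induction n with
  | zero =>
    have h1 : IsField (MvPolynomial (Fin 0) k) :=
      (MvPolynomial.isEmptyAlgEquiv k (Fin 0)).toMulEquiv.isField (Field.toIsField k)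
    let := h1.toField
    rw [Ideal.eq_bot_of_prime p]
    simp
  | succ n ih =>
    let e := (MvPolynomial.finSuccEquiv k n).toRingEquiv
    let P : Ideal (Polynomial (MvPolynomial (Fin n) k)) := p.map e
    have hP : P.IsMaximal := Ideal.map_isMaximal_of_equiv e
    have h1 : (P.under (MvPolynomial (Fin n) k)).IsMaximal :=
      Polynomial.isMaximal_comap_C_of_isJacobsonRing P
    have : P.LiesOver (P.under (MvPolynomial (Fin n) k)) := ⟨rfl⟩
    have h2 := Polynomial.height_eq_height_add_one (P.under (MvPolynomial (Fin n) k)) P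
    rw [ih _ h1] at h2
    rw [← RingEquiv.height_map e p]
    exact_mod_cast h2

/-- All maximal ideals of a finitely generated algebra over a field that is a domain have the same
height. -/
lemma exists_forall_height_eq (k : Type u) [Field k] (A : Type u) [CommRing A] [IsDomain A]
    [Algebra k A] [Algebra.FiniteType k A] :
    ∃ n : ℕ, ∀ p : Ideal A, p.IsMaximal → p.height = n := by
  obtain ⟨n, g, hg, hint⟩ := exists_integral_inj_algHom_of_fg k A
  refine ⟨n, fun p hp => ?_⟩
  algebraize [g.toRingHom]
  have : Algebra.IsIntegral (MvPolynomial (Fin n) k) A := ⟨hint⟩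
  have : FaithfulSMul (MvPolynomial (Fin n) k) A :=
    (faithfulSMul_iff_algebraMap_injective _ _).2 hg
  have : IsNoetherianRing A := Algebra.FiniteType.isNoetherianRing k A
  have h0 : (p.under (MvPolynomial (Fin n) k)).IsMaximal :=
    Ideal.isMaximal_comap_of_isIntegral_of_isMaximal p
  rw [← height_mvPolynomial k n (p.under (MvPolynomial (Fin n) k)) h0]
  refine le_antisymm ?_ ?_
  -- Incomparability in integral extensions: contraction is strictly monotone.
  · let x : PrimeSpectrum A := ⟨p, hp.isPrime⟩
    have h1 : StrictMono (PrimeSpectrum.comap (algebraMap (MvPolynomial (Fin n) k) A)) :=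
      fun I J h => Ideal.IsIntegral.comap_lt_comap h
    have h2 := Order.height_le_height_apply_of_strictMono _ h1 x
    rwa [← PrimeSpectrum.height_eq_orderHeight, ← PrimeSpectrum.height_eq_orderHeight] at h2
  -- Going-down holds because the polynomial ring is a normal domain.
  · rw [Ideal.height_eq_height_add_of_liesOver_of_hasGoingDown
      (p.under (MvPolynomial (Fin n) k)) p]
    exact le_self_add

end Dimension

end

/-! ### Regular surfaces: the closed points are the points of codimension two -/

section

/-- The properties of regular surfaces of finite type over a field that are used here. -/
structure IsRegularSurface (X : Scheme.{u}) : Prop where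
  isIntegral : AlgebraicGeometry.IsIntegral X
  isNoetherian : AlgebraicGeometry.IsNoetherian X
  jacobsonSpace : JacobsonSpace X
  isRegularLocalRing (x : X) : IsRegularLocalRing (X.presheaf.stalk x)
  isClosed_iff (x : X) : IsClosed {x} ↔ Order.coheight x = 2

lemma finiteType_of_chart {k : Type u} [Field k] {X : Scheme.{u}} (π : X ⟶ Spec (.of k))
    [LocallyOfFiniteType π] {A : CommRingCat.{u}} (f : Spec A ⟶ X) [IsOpenImmersion f] :
    ∃ _ : Algebra k A, Algebra.FiniteType k A := by
  obtain ⟨φ, hφ⟩ := Spec.map_surjective (f ≫ π)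
  have h : LocallyOfFiniteType (Spec.map φ) := hφ ▸ inferInstance
  rw [HasRingHomProperty.Spec_iff (P := @LocallyOfFiniteType)] at h
  exact ⟨φ.hom.toAlgebra, h⟩

lemma isMaximal_of_isClosed {X : Scheme.{u}} {A : CommRingCat.{u}} (f : Spec A ⟶ X)
    [IsOpenImmersion f] (y : Spec A) (hy : IsClosed {f y}) : y.asIdeal.IsMaximal := by
  refine (PrimeSpectrum.isClosed_singleton_iff_isMaximal y).1 ?_
  have h : f ⁻¹' {f y} = {y} := by
    ext z
    exact f.isOpenEmbedding.injective.eq_iff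
  exact h ▸ hy.preimage f.continuous

lemma isClosed_of_isMaximal {X : Scheme.{u}} [JacobsonSpace X] {A : CommRingCat.{u}}
    (f : Spec A ⟶ X) [IsOpenImmersion f] (y : Spec A) (hy : y.asIdeal.IsMaximal) :
    IsClosed {f y} := by
  have h := f.isOpenEmbedding.preimage_closedPoints
  have h1 : y ∈ closedPoints (Spec A) :=
    (PrimeSpectrum.isClosed_singleton_iff_isMaximal y).2 hy
  rw [← h] at h1
  exact h1

lemma exists_forall_coheight_eq {k : Type u} [Field k] {X : Scheme.{u}} (π : X ⟶ Spec (.of k))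
    [LocallyOfFiniteType π] [AlgebraicGeometry.IsIntegral X] [JacobsonSpace X]
    {A : CommRingCat.{u}} (f : Spec A ⟶ X) [IsOpenImmersion f] [Nonempty (Spec A)] :
    ∃ n : ℕ, ∀ y : Spec A, IsClosed {f y} → Order.coheight (f y) = n := by
  obtain ⟨_, _⟩ := finiteType_of_chart π f
  have : AlgebraicGeometry.IsIntegral (Spec A) := isIntegral_of_isOpenImmersion f
  have : IsDomain A := (affine_isIntegral_iff A).1 this
  obtain ⟨n, hn⟩ := exists_forall_height_eq k A
  refine ⟨n, fun y hy => ?_⟩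
  rw [coheight_eq_of_isOpenImmersion f, ← idealHeight_eq_coheight A]
  exact hn _ (isMaximal_of_isClosed f y hy)

/-- Closed points of one chart have equal codimension, and two charts share a closed point since `X`
is irreducible and Jacobson; so there is one codimension `d` for all closed points. Codimension
grows under specialization and every point specializes to a closed one, so `d` is the supremum of
all codimensions, which is the dimension. -/
theorem isRegularSurface {k : Type u} [Field k] {X : Scheme.{u}} (π : X ⟶ Spec (.of k))
    [LocallyOfFiniteType π] [QuasiCompact π] [IrreducibleSpace X]
    (hreg : ∀ x : X, IsRegularLocalRing (X.presheaf.stalk x)) (hdim : topologicalKrullDim X = 2) :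
    IsRegularSurface X := by
  have : AlgebraicGeometry.IsReduced X := isReduced_of_isReduced_stalk X
  have : AlgebraicGeometry.IsIntegral X := isIntegral_of_irreducibleSpace_of_isReduced X
  have hN : IsLocallyNoetherian X := LocallyOfFiniteType.isLocallyNoetherian π
  have hJ : JacobsonSpace X := LocallyOfFiniteType.jacobsonSpace π
  have hC : CompactSpace X := QuasiCompact.compactSpace_of_compactSpace π
  have hdim' : Order.krullDim X = 2 :=
    (Order.krullDim_eq_of_orderIso irreducibleSetEquivPoints).symm.trans hdim
  rw [Order.krullDim_eq_iSup_coheight_of_nonempty] at hdim'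
  have hsup : (⨆ x : X, Order.coheight x) = 2 := WithBot.coe_injective hdim'
  have hle : ∀ x : X, Order.coheight x ≤ 2 := fun x => hsup ▸ le_iSup _ x
  obtain ⟨d, hd⟩ : ∃ d : ℕ, ∀ x : X, IsClosed {x} → Order.coheight x = d := by
    obtain ⟨A, f, hf, hf', -⟩ := Scheme.exists_affine_mem_range_and_range_subset
      (show (Nonempty.some inferInstance : X) ∈ (⊤ : X.Opens) from trivial)
    obtain ⟨y₀, -⟩ := hf'
    have : Nonempty (Spec A) := ⟨y₀⟩
    obtain ⟨n, hn⟩ := exists_forall_coheight_eq π f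
    refine ⟨n, fun x hx => ?_⟩
    obtain ⟨B, g, hg, ⟨y, rfl⟩, -⟩ := Scheme.exists_affine_mem_range_and_range_subset
      (show x ∈ (⊤ : X.Opens) from trivial)
    have : Nonempty (Spec B) := ⟨y⟩
    obtain ⟨m, hm⟩ := exists_forall_coheight_eq π g
    have hne : (Set.range f ∩ Set.range g).Nonempty :=
      nonempty_preirreducible_inter f.isOpenEmbedding.isOpen_range g.isOpenEmbedding.isOpen_range
        ⟨_, y₀, rfl⟩ ⟨_, y, rfl⟩
    obtain ⟨z, ⟨⟨a, rfl⟩, ⟨b, hb⟩⟩, hz⟩ := nonempty_inter_closedPoints hne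
      (f.isOpenEmbedding.isOpen_range.inter g.isOpenEmbedding.isOpen_range).isLocallyClosed
    rw [hm y hx, ← hn a hz, ← hb, hm b (hb ▸ hz)]
  have hsp : ∀ x : X, ∃ z, x ⤳ z ∧ IsClosed {z} := fun x => by
    obtain ⟨z, hz, hz'⟩ := IsClosed.exists_closed_singleton (isClosed_closure (s := {x}))
      ⟨x, subset_closure rfl⟩
    exact ⟨z, specializes_iff_mem_closure.2 hz, hz'⟩
  have hanti : ∀ x z : X, x ⤳ z → Order.coheight x ≤ Order.coheight z :=
    fun x z h => Order.coheight_anti (Scheme.le_iff_specializes.2 h)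
  have hd2 : (d : ℕ∞) = 2 := by
    apply le_antisymm
    · obtain ⟨z, -, hz⟩ := hsp (Nonempty.some inferInstance)
      exact hd z hz ▸ hle z
    · rw [← hsup]
      refine iSup_le fun x => ?_
      obtain ⟨z, hz, hz'⟩ := hsp x
      exact hd z hz' ▸ hanti x z hz
  refine ⟨inferInstance, ⟨⟩, hJ, hreg, fun x => ⟨fun h => (hd x h).trans hd2, fun h => ?_⟩⟩
  obtain ⟨z, hz, hz'⟩ := hsp x
  -- A non-closed point of codimension 2 would have a proper specialization, of codimension at least
  -- 3.
  by_cases hxz : x = z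
  · exact hxz ▸ hz'
  · exfalso
    have h1 : z < x := lt_of_le_not_ge (Scheme.le_iff_specializes.2 hz)
      fun h => hxz (Specializes.antisymm hz (Scheme.le_iff_specializes.1 h)).eq
    have h2 := Order.coheight_add_one_le h1
    rw [h] at h2
    have h3 := h2.trans (hle z)
    exact absurd h3 (by decide)

end

/-! ### Restriction and pullback of sections -/

section

section

variable {X Y Y' : Scheme.{u}}

lemma presheaf_map_map (M : X.Modules) {U V W : X.Opens} (i : W ≤ V) (j : V ≤ U) (x : Γ(M, U)) :
    M.presheaf.map (homOfLE i).op (M.presheaf.map (homOfLE j).op x) =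
      M.presheaf.map (homOfLE (i.trans j)).op x :=
  congr($(M.presheaf.map_comp (homOfLE j).op (homOfLE i).op) x).symm

lemma app_presheaf_map {M N : X.Modules} (H : M ⟶ N) {U V : X.Opens} (i : V ≤ U) (x : Γ(M, U)) :
    H.app V (M.presheaf.map (homOfLE i).op x) = N.presheaf.map (homOfLE i).op (H.app U x) :=
  congr($(H.mapPresheaf.naturality (homOfLE i).op) x)

/-- The canonical map `Γ(M, U) → Γ(f^* M, f⁻¹ U)`. -/
def pullUnit (f : Y ⟶ X) (M : X.Modules) (U : X.Opens) :
    Γ(M, U) →+ Γ((Scheme.Modules.pullback f).obj M, f ⁻¹ᵁ U) :=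
  (((pullbackPushforwardAdjunction f).unit.app M).app U).hom

/-- The canonical map `Γ(M, U) → Γ(f^* M, ⊤)` if `f` factors through the open set `U`. -/
def evalSection (f : Y ⟶ X) (M : X.Modules) (U : X.Opens) (hU : ⊤ ≤ f ⁻¹ᵁ U) :
    Γ(M, U) →+ Γ((Scheme.Modules.pullback f).obj M, ⊤) :=
  (((Scheme.Modules.pullback f).obj M).presheaf.map (homOfLE hU).op).hom.comp (pullUnit f M U)

lemma pullUnit_map (f : Y ⟶ X) (M : X.Modules) {U V : X.Opens} (h : V ≤ U) (x : Γ(M, U)) :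
    pullUnit f M V (M.presheaf.map (homOfLE h).op x) =
      ((Scheme.Modules.pullback f).obj M).presheaf.map
        (homOfLE (show f ⁻¹ᵁ V ≤ f ⁻¹ᵁ U from fun _ hx => h hx)).op (pullUnit f M U x) :=
  app_presheaf_map ((pullbackPushforwardAdjunction f).unit.app M) h x

lemma evalSection_map (f : Y ⟶ X) (M : X.Modules) {U V : X.Opens} (h : V ≤ U) (hU : ⊤ ≤ f ⁻¹ᵁ U)
    (hV : ⊤ ≤ f ⁻¹ᵁ V) (x : Γ(M, U)) :
    evalSection f M V hV (M.presheaf.map (homOfLE h).op x) = evalSection f M U hU x :=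
  (congrArg _ (pullUnit_map f M h x)).trans (presheaf_map_map _ _ _ _)

lemma pullUnit_naturality (f : Y ⟶ X) {M N : X.Modules} (H : M ⟶ N) (U : X.Opens) (x : Γ(M, U)) :
    ((Scheme.Modules.pullback f).map H).app (f ⁻¹ᵁ U) (pullUnit f M U x) =
      pullUnit f N U (H.app U x) :=
  congr(($((pullbackPushforwardAdjunction f).unit.naturality H)).app U x).symm

lemma evalSection_naturality (f : Y ⟶ X) {M N : X.Modules} (H : M ⟶ N) (U : X.Opens)
    (hU : ⊤ ≤ f ⁻¹ᵁ U) (x : Γ(M, U)) :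
    ((Scheme.Modules.pullback f).map H).app ⊤ (evalSection f M U hU x) =
      evalSection f N U hU (H.app U x) :=
  (app_presheaf_map _ _ _).trans (congrArg _ (pullUnit_naturality f H U x))

variable (g : Y' ⟶ Y) (f : Y ⟶ X) (f' : Y' ⟶ X) (h : g ≫ f = f')

/-- The canonical map `Γ(f^* M, V) → Γ(f'^* M, g⁻¹ V)`, where `f' = g ≫ f`. -/
def baseChangeSections (M : X.Modules) (V : Y.Opens) :
    Γ((Scheme.Modules.pullback f).obj M, V) →+ Γ((Scheme.Modules.pullback f').obj M, g ⁻¹ᵁ V) :=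
  (((baseChange g f f' h).app M).app V).hom

lemma baseChangeSections_map (M : X.Modules) {U V : Y.Opens} (i : V ≤ U)
    (x : Γ((Scheme.Modules.pullback f).obj M, U)) :
    baseChangeSections g f f' h M V
        (((Scheme.Modules.pullback f).obj M).presheaf.map (homOfLE i).op x) =
      ((Scheme.Modules.pullback f').obj M).presheaf.map
        (homOfLE (show g ⁻¹ᵁ V ≤ g ⁻¹ᵁ U from fun _ hx => i hx)).op
        (baseChangeSections g f f' h M U x) :=
  app_presheaf_map ((baseChange g f f' h).app M) i x

lemma unit_baseChange (M : X.Modules) :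
    (pullbackPushforwardAdjunction f).unit.app M ≫
        (pushforward f).map ((baseChange g f f' h).app M) =
      (pullbackPushforwardAdjunction f').unit.app M ≫ (pushforwardIso g f f' h).inv.app _ :=
  ((pullbackPushforwardAdjunction f).homEquiv_unit _ _ _).symm.trans
    (((pullbackPushforwardAdjunction f).homEquiv _ _).apply_symm_apply _)

lemma baseChangeSections_pullUnit (M : X.Modules) (U : X.Opens) (x : Γ(M, U)) :
    baseChangeSections g f f' h M (f ⁻¹ᵁ U) (pullUnit f M U x) =
      ((Scheme.Modules.pullback f').obj M).presheaf.map
        (homOfLE (preimage_preimage_of_comp_eq h U).le).op (pullUnit f' M U x) := by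
  have h1 := congr(($(unit_baseChange g f f' h M)).app U x)
  refine h1.trans ?_
  exact congr($(pushforwardIso_inv_app_app g f f' h _ U) _)

/-- Pullback of sections of a pullback. -/
lemma pullbackSections_evalSection (M : X.Modules) (U : X.Opens) (hU : ⊤ ≤ f ⁻¹ᵁ U)
    (hU' : ⊤ ≤ f' ⁻¹ᵁ U) (x : Γ(M, U)) :
    pullbackSections g f f' h M (evalSection f M U hU x) = evalSection f' M U hU' x := by
  refine (baseChangeSections_map g f f' h M hU (pullUnit f M U x)).trans ?_
  refine (congrArg _ (baseChangeSections_pullUnit g f f' h M U x)).trans ?_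
  exact presheaf_map_map _ _ _ _

/-- Sections over a closed subscheme lift to `X` only locally. This computes the pullback of `s`
from any local lift `x` defined near the image of `f'`. -/
lemma pullbackSections_eq_evalSection (M : X.Modules) (U : X.Opens) (hU' : ⊤ ≤ f' ⁻¹ᵁ U)
    (s : Γ((Scheme.Modules.pullback f).obj M, ⊤)) (x : Γ(M, U))
    (hs : ((Scheme.Modules.pullback f).obj M).presheaf.map (homOfLE le_top).op s =
      pullUnit f M U x) :
    pullbackSections g f f' h M s = evalSection f' M U hU' x := by
  have hle : ⊤ ≤ g ⁻¹ᵁ f ⁻¹ᵁ U := hU'.trans (preimage_preimage_of_comp_eq h U).ge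
  have h1 := (baseChangeSections_map g f f' h M le_top s).symm.trans
    ((congrArg (baseChangeSections g f f' h M (f ⁻¹ᵁ U)) hs).trans
      (baseChangeSections_pullUnit g f f' h M U x))
  have h2 := congrArg (((Scheme.Modules.pullback f').obj M).presheaf.map (homOfLE hle).op) h1
  refine Eq.trans ?_ (h2.trans (presheaf_map_map _ _ _ _))
  refine Eq.trans ?_ (presheaf_map_map _ _ _ _).symm
  exact congr($(((Scheme.Modules.pullback f').obj M).presheaf.map_id _) _).symm

lemma map_pullbackSections_eq (M : X.Modules) (U : X.Opens)
    (s : Γ((Scheme.Modules.pullback f).obj M, ⊤)) (x : Γ(M, U))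
    (hs : ((Scheme.Modules.pullback f).obj M).presheaf.map (homOfLE le_top).op s =
      pullUnit f M U x) :
    ((Scheme.Modules.pullback f').obj M).presheaf.map (homOfLE le_top).op
      (pullbackSections g f f' h M s) = pullUnit f' M U x := by
  have h1 := (baseChangeSections_map g f f' h M le_top s).symm.trans
    ((congrArg (baseChangeSections g f f' h M (f ⁻¹ᵁ U)) hs).trans
      (baseChangeSections_pullUnit g f f' h M U x))
  have h2 := congrArg (((Scheme.Modules.pullback f').obj M).presheaf.map
    (homOfLE (preimage_preimage_of_comp_eq h U).ge).op) h1
  refine (presheaf_map_map _ _ _ _).symm.trans (h2.trans ((presheaf_map_map _ _ _ _).trans ?_))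
  exact congr($(((Scheme.Modules.pullback f').obj M).presheaf.map_id _) _)

end

section OpenImmersion

variable {C D D' : Type*} [Category* C] [Category* D] [Category* D'] {L : C ⥤ D} {R : D ⥤ C}
  (adj : L ⊣ R) {L' : C ⥤ D'} {R' : D' ⥤ C} (adj' : L' ⊣ R') {G : D' ⥤ D} (e : G ⋙ R ≅ R')

/-- If `G` has a left adjoint `K`, then the morphism `K L ⟶ L'` that corresponds to
`adjointMap : L ⟶ G L'` is an isomorphism. -/
lemma isIso_homEquiv_symm_adjointMap {K : D ⥤ D'} (adjG : K ⊣ G) (F : C) :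
    IsIso ((adjG.homEquiv _ _).symm ((adjointMap adj adj' e).app F)) := by
  -- Two left adjoints of `R'` are uniquely isomorphic; what remains is to recognize the isomorphism
  -- by its compatibility with the units.
  let adj₁ : L ⋙ K ⊣ R' := (adj.comp adjG).ofNatIsoRight e
  have h : (adjG.homEquiv _ _).symm ((adjointMap adj adj' e).app F) =
      (adj₁.leftAdjointUniq adj').hom.app F := by
    rw [Equiv.symm_apply_eq]
    apply (adj.homEquiv _ _).injective
    refine ((adj.homEquiv _ _).apply_symm_apply _).trans ?_
    rw [← cancel_mono (e.hom.app _)]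
    have h2 := adj₁.unit_leftAdjointUniq_hom_app adj' F
    simp only [Category.assoc, Iso.inv_hom_id_app, Category.comp_id]
    refine Eq.trans (Category.comp_id _) (h2.symm.trans ?_)
    simp only [Adjunction.ofNatIsoRight_unit, adj₁, Adjunction.homEquiv_unit]
    simp
    exact congrArg (fun v => adj.unit.app F ≫ R.map (adjG.unit.app (L.obj F)) ≫ v)
      (e.hom.naturality _).symm
  rw [h]
  infer_instance

end OpenImmersion

section

variable {X Y Y' : Scheme.{u}} (g : Y' ⟶ Y) (f : Y ⟶ X) (f' : Y' ⟶ X) (h : g ≫ f = f')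

lemma bijective_presheaf_map_of_eq (M : X.Modules) {U V : X.Opens} (h : V ≤ U) (h' : U ≤ V) :
    Function.Bijective (M.presheaf.map (homOfLE h).op) := by
  obtain rfl := le_antisymm h h'
  have : (M.presheaf.map (homOfLE h).op) = 𝟙 _ := M.presheaf.map_id _
  rw [this]
  exact Function.bijective_id

/-- Along open immersions, pullback of sections is restriction. -/
lemma bijective_baseChangeSections [IsOpenImmersion g] (M : X.Modules) (V : Y.Opens)
    (hV : V ≤ g.opensRange) : Function.Bijective (baseChangeSections g f f' h M V) := by
  have := isIso_homEquiv_symm_adjointMap (pullbackPushforwardAdjunction f)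
    (pullbackPushforwardAdjunction f') (pushforwardIso g f f' h) (restrictAdjunction g) M
  let ψ := (((restrictAdjunction g).homEquiv _ _).symm ((baseChange g f f' h).app M))
  have hψ : IsIso ψ := this
  have h1 : (baseChange g f f' h).app M =
      (restrictAdjunction g).unit.app _ ≫ (pushforward g).map ψ :=
    (((restrictAdjunction g).homEquiv _ _).apply_symm_apply _).symm.trans
      (Adjunction.homEquiv_unit _ _ _ _)
  have hle : g ''ᵁ g ⁻¹ᵁ V ≤ V := g.image_preimage_le _
  have hge : V ≤ g ''ᵁ g ⁻¹ᵁ V := by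
    rw [Scheme.Hom.image_preimage_eq_opensRange_inf]
    exact le_inf hV le_rfl
  have h2 := bijective_presheaf_map_of_eq ((Scheme.Modules.pullback f).obj M) hle hge
  have h3 : Function.Bijective (ψ.app (g ⁻¹ᵁ V)) := by
    have : IsIso (ψ.app (g ⁻¹ᵁ V)) := inferInstance
    exact (ConcreteCategory.isIso_iff_bijective _).1 this
  refine (funext fun x => ?_ : (baseChangeSections g f f' h M V : _ → _) = _) ▸ h3.comp h2
  refine (congr(($h1).app V x)).trans ?_
  refine congrArg (ψ.app (g ⁻¹ᵁ V)) ?_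
  exact congr($(restrictAdjunction_unit_app_app g _ V) x)

end

section Chart

variable {A B : CommRingCat.{u}} {X : Scheme.{u}} (f : Spec A ⟶ X) [IsOpenImmersion f] (φ : A ⟶ B)
  (M : X.Modules) (j : Spec B ⟶ X) (h : Spec.map φ ≫ f = j)

lemma le_preimage_image_top (h : Spec.map φ ≫ f = j) : ⊤ ≤ j ⁻¹ᵁ f ''ᵁ ⊤ := by
  subst h
  intro x _
  exact ⟨Spec.map φ x, trivial, rfl⟩

lemma chartMap_eq_evalSection (x : Γ(M.restrict f, ⊤)) :
    chartMap f φ M j h x =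
      evalSection j M (f ''ᵁ ⊤) (le_preimage_image_top f φ j h) x :=
  congr($(chartUnit_app f φ M j h ⊤ (le_preimage_image_top f φ j h)) x)

end Chart

end

/-! ### Closed subschemes and ideal sheaves on charts -/

section

section ClosedSubscheme

variable {X Z : Scheme.{u}} (i : Z ⟶ X) {A : CommRingCat.{u}} (f : Spec A ⟶ X) [IsOpenImmersion f]

/-- The intersection of a closed subscheme with an affine open subscheme. -/
lemma exists_closed_chart [IsClosedImmersion i] :
    ∃ (B : CommRingCat.{u}) (q : A ⟶ B) (g : Spec B ⟶ Z) (_ : IsOpenImmersion g),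
      Function.Surjective q.hom ∧ g ≫ i = Spec.map q ≫ f ∧ i ⁻¹ᵁ f ''ᵁ ⊤ ≤ g.opensRange := by
  obtain ⟨I, e, he⟩ := (IsClosedImmersion.Spec_iff (f := pullback.snd i f)).1 inferInstance
  refine ⟨.of (A ⧸ I), CommRingCat.ofHom (Ideal.Quotient.mk I), e.inv ≫ pullback.fst i f,
    inferInstance, ?_, ?_, ?_⟩
  · exact Ideal.Quotient.mk_surjective
  · rw [Category.assoc, pullback.condition, he, ← Category.assoc, ← Category.assoc, e.inv_hom_id,
      Category.id_comp]
  · rw [Scheme.Hom.opensRange_comp_of_isIso]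
    rintro x ⟨y, -, hy⟩
    have : x ∈ Set.range (pullback.fst i f) := by
      rw [Scheme.Pullback.range_fst]
      exact ⟨y, hy⟩
    exact this

/-- The chart `g` of `Z` covers the whole preimage of the chart of `X`, so pullback of sections
along `g` loses nothing (`bijective_baseChangeSections`). This reduces sections over closed
subschemes to affine base change. -/
lemma pullUnit_chart (M : X.Modules) [IsIso (M.restrict f).fromTildeΓ] {B : CommRingCat.{u}}
    (q : A ⟶ B) (g : Spec B ⟶ Z) [IsOpenImmersion g] (h : g ≫ i = Spec.map q ≫ f)
    (hg : i ⁻¹ᵁ f ''ᵁ ⊤ ≤ g.opensRange) :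
    ∃ E : Γ((Scheme.Modules.pullback i).obj M, i ⁻¹ᵁ f ''ᵁ ⊤) →+
        Γ((Scheme.Modules.pullback (Spec.map q ≫ f)).obj M, ⊤), Function.Bijective E ∧
      ∀ x : Γ(M.restrict f, ⊤), E (pullUnit i M (f ''ᵁ ⊤) x) = chartMap f q M _ rfl x := by
  have hle : ⊤ ≤ (Spec.map q ≫ f) ⁻¹ᵁ f ''ᵁ ⊤ := le_preimage_image_top f q _ rfl
  have hle' : ⊤ ≤ g ⁻¹ᵁ i ⁻¹ᵁ f ''ᵁ ⊤ := hle.trans (preimage_preimage_of_comp_eq h _).ge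
  refine ⟨((((Scheme.Modules.pullback (Spec.map q ≫ f)).obj M).presheaf.map
    (homOfLE hle').op).hom).comp (baseChangeSections g i _ h M (i ⁻¹ᵁ f ''ᵁ ⊤)), ?_, fun x => ?_⟩
  · exact (bijective_presheaf_map_of_eq _ _ le_top).comp (bijective_baseChangeSections g i _ h M _ hg)
  · rw [chartMap_eq_evalSection]
    exact (congrArg _ (baseChangeSections_pullUnit g i _ h M (f ''ᵁ ⊤) x)).trans
      (presheaf_map_map _ _ _ _)

/-- Over an affine open subscheme `Spec A`, the sections of the pullback of `M` to a closed
subscheme are the quotient of the sections of `M` by an ideal of `A`. -/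
lemma exists_ideal_pullUnit [IsClosedImmersion i] :
    ∃ I : Ideal A, (I = ⊥ → ∃ e : Spec A ⟶ Z, e ≫ i = f) ∧
      ∀ (M : X.Modules) [IsIso (M.restrict f).fromTildeΓ],
        Function.Surjective (pullUnit i M (f ''ᵁ ⊤)) ∧
        ∀ x : Γ(M.restrict f, ⊤), pullUnit i M (f ''ᵁ ⊤) x = 0 ↔
          x ∈ I • (⊤ : Submodule A Γ(M.restrict f, ⊤)) := by
  obtain ⟨B, q, g, hg, hq, h, hle⟩ := exists_closed_chart i f
  refine ⟨RingHom.ker q.hom, fun hI => ?_, fun M _ => ?_⟩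
  · have hb : Function.Bijective q.hom := ⟨(RingHom.injective_iff_ker_eq_bot _).2 hI, hq⟩
    have : IsIso q := (ConcreteCategory.isIso_iff_bijective q).2 hb
    exact ⟨inv (Spec.map q) ≫ g, by rw [Category.assoc, h, IsIso.inv_hom_id_assoc]⟩
  · obtain ⟨E, hE, hE'⟩ := pullUnit_chart i f M q g h hle
    have hc := isExtension_chartMap f q M _ rfl
    constructor
    · intro y
      obtain ⟨x, hx⟩ := hc.surjective hq (E y)
      exact ⟨x, hE.1 ((hE' x).trans hx)⟩
    · intro x
      rw [← hc.eq_zero_iff_of_surjective hq, ← hE']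
      exact (map_eq_zero_iff E hE.1).symm

end ClosedSubscheme

section Ideals

variable {X : Scheme.{u}} [AlgebraicGeometry.IsIntegral X]

/-- A nonempty chart meets every nonempty open set, and on an integral scheme a single germ
determines a section. -/
lemma ker_eq_bot_of_chart {A : CommRingCat.{u}} (f : Spec A ⟶ X) [IsOpenImmersion f]
    [Nonempty (Spec A)] : f.ker = ⊥ := by
  rw [eq_bot_iff]
  intro U a ha
  have h : f.app U a = 0 := f.ideal_ker_le U ha
  by_cases hU : (U.1 : Set X).Nonempty
  · obtain ⟨_, hxU, y, rfl⟩ := nonempty_preirreducible_inter U.1.isOpen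
      f.isOpenEmbedding.isOpen_range hU ⟨_, (Nonempty.some inferInstance : Spec A), rfl⟩
    have h1 := f.germ_stalkMap_apply U y hxU a
    rw [h, map_zero] at h1
    have h2 : X.presheaf.germ U (f y) hxU a = 0 :=
      (map_eq_zero_iff (f.stalkMap y).hom
        ((ConcreteCategory.isIso_iff_bijective (f.stalkMap y)).1 inferInstance).1).1 h1
    exact (map_eq_zero_iff _ (germ_injective_of_isIntegral X (f y) hxU)).1 h2
  · have : U.1 = ⊥ := Opens.ext (Set.not_nonempty_iff_eq_empty.1 hU)
    have : Subsingleton Γ(X, U) := this ▸ inferInstance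
    exact Subsingleton.elim _ _

/-- On a common affine open set the product of two nonzero sections is nonzero. Geometrically, a
union of two proper closed subschemes is proper; so a subscheme can be enlarged to contain a given
infinitesimal neighbourhood, a device used repeatedly below. -/
lemma inf_ne_bot {I J : X.IdealSheafData} (hI : I ≠ ⊥) (hJ : J ≠ ⊥) : I ⊓ J ≠ ⊥ := by
  have key : ∀ {I : X.IdealSheafData}, I ≠ ⊥ → ∃ U : X.affineOpens, (U.1 : Set X).Nonempty ∧
      ∃ a ∈ I.ideal U, a ≠ 0 := by
    intro I hI
    by_contra! hc
    refine hI (Scheme.IdealSheafData.ext (funext fun U => eq_bot_iff.2 fun a ha => ?_))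
    by_cases hU : (U.1 : Set X).Nonempty
    · exact hc U hU a ha
    · have : U.1 = ⊥ := Opens.ext (Set.not_nonempty_iff_eq_empty.1 hU)
      have : Subsingleton Γ(X, U) := this ▸ inferInstance
      exact Subsingleton.elim _ _
  obtain ⟨U, hU, a, ha, ha'⟩ := key hI
  obtain ⟨V, hV, b, hb, hb'⟩ := key hJ
  obtain ⟨x, hxU, hxV⟩ := nonempty_preirreducible_inter U.1.isOpen V.1.isOpen hU hV
  obtain ⟨_, ⟨W, hW, rfl⟩, hxW, hWUV⟩ := X.isBasis_affineOpens.exists_subset_of_mem_open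
    (show x ∈ ((U.1 ⊓ V.1 : X.Opens) : Set X) from ⟨hxU, hxV⟩) (U.1 ⊓ V.1).isOpen
  let W' : X.affineOpens := ⟨W, hW⟩
  have : Nonempty W := ⟨⟨x, hxW⟩⟩
  have hWU : W' ≤ U := fun y hy => (hWUV hy).1
  have hWV : W' ≤ V := fun y hy => (hWUV hy).2
  have h1 := I.ideal_le_comap_ideal hWU ha
  have h2 := J.ideal_le_comap_ideal hWV hb
  have h3 : X.presheaf.map (homOfLE hWU).op a ≠ 0 := fun h =>
    ha' ((map_eq_zero_iff _ (map_injective_of_isIntegral X (homOfLE hWU))).1 h)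
  have h4 : X.presheaf.map (homOfLE hWV).op b ≠ 0 := fun h =>
    hb' ((map_eq_zero_iff _ (map_injective_of_isIntegral X (homOfLE hWV))).1 h)
  intro h
  have h5 : X.presheaf.map (homOfLE hWU).op a * X.presheaf.map (homOfLE hWV).op b ∈
      (I ⊓ J).ideal W' := by
    rw [Scheme.IdealSheafData.ideal_inf]
    exact ⟨Ideal.mul_mem_right _ _ h1, Ideal.mul_mem_left _ _ h2⟩
  rw [h] at h5
  exact mul_ne_zero h3 h4 h5

/-- Nonzero ideal sheaves on integral schemes are nonzero on affine open subschemes. -/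
lemma exists_ideal_ne_bot_pullUnit {I : X.IdealSheafData} (hI : I ≠ ⊥) {A : CommRingCat.{u}}
    (f : Spec A ⟶ X) [IsOpenImmersion f] [Nonempty (Spec A)] :
    ∃ I' : Ideal A, I' ≠ ⊥ ∧
      ∀ (M : X.Modules) [IsIso (M.restrict f).fromTildeΓ],
        Function.Surjective (pullUnit I.subschemeι M (f ''ᵁ ⊤)) ∧
        ∀ x : Γ(M.restrict f, ⊤), pullUnit I.subschemeι M (f ''ᵁ ⊤) x = 0 ↔
          x ∈ I' • (⊤ : Submodule A Γ(M.restrict f, ⊤)) := by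
  obtain ⟨I', h, h'⟩ := exists_ideal_pullUnit I.subschemeι f
  refine ⟨I', fun hbot => ?_, h'⟩
  -- With zero ideal the chart would factor through the closed subscheme, but its scheme-theoretic
  -- image is `X`.
  obtain ⟨e, he⟩ := h hbot
  have h1 := e.le_ker_comp I.subschemeι
  rw [he, ker_eq_bot_of_chart, I.ker_subschemeι] at h1
  exact hI (le_bot_iff.1 h1)

end Ideals

end

/-! ### Infinitesimal neighbourhoods in charts -/

section

section Chart

variable {X : Scheme.{u}} {A : CommRingCat.{u}} (f : Spec A ⟶ X) [IsOpenImmersion f] (y : Spec A)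

instance isPrime_asIdeal (A : CommRingCat.{u}) (y : Spec A) : (PrimeSpectrum.asIdeal y).IsPrime :=
  PrimeSpectrum.isPrime y

/-- The canonical map from `A` to the stalk of `X` at a point of the chart `Spec A`. -/
def chartStalk : A ⟶ X.presheaf.stalk (f y) :=
  (Scheme.ΓSpecIso A).inv ≫ (Spec A).presheaf.germ ⊤ y trivial ≫ inv (f.stalkMap y)

lemma specMap_chartStalk : Spec.map (chartStalk f y) ≫ f = X.fromSpecStalk (f y) := by
  have h := Scheme.SpecMap_stalkMap_fromSpecStalk f (x := y)
  rw [Spec.fromSpecStalk_eq] at h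
  rw [chartStalk, ← Category.assoc, Spec.map_comp, Category.assoc, ← h, ← Category.assoc,
    ← Spec.map_comp, IsIso.hom_inv_id, Spec.map_id, Category.id_comp]

lemma isLocalization_chartStalk :
    @IsLocalization.AtPrime A _ (X.presheaf.stalk (f y)) _ (chartStalk f y).hom.toAlgebra
      y.asIdeal inferInstance := by
  let := (chartStalk f y).hom.toAlgebra
  let : Algebra A ((Spec A).presheaf.stalk y) := StructureSheaf.stalkAlgebra A y
  have h : IsLocalization.AtPrime ((Spec A).presheaf.stalk y) y.asIdeal :=
    StructureSheaf.IsLocalization.to_stalk A y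
  let e := (asIso (f.stalkMap y)).symm.commRingCatIsoToRingEquiv
  exact IsLocalization.isLocalization_of_algEquiv (y.asIdeal.primeCompl)
    (AlgEquiv.ofRingEquiv (f := e) (fun a => rfl) :
      (Spec A).presheaf.stalk y ≃ₐ[A] X.presheaf.stalk (f y))

/-- The ring `𝒪_x / 𝔪_x ^ n`. -/
def nbhdRing (x : X) (n : ℕ) : CommRingCat.{u} :=
  .of (X.presheaf.stalk x ⧸ IsLocalRing.maximalIdeal (X.presheaf.stalk x) ^ n)

/-- The projection `𝒪_x → 𝒪_x / 𝔪_x ^ n`. -/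
def toNbhdRing (x : X) (n : ℕ) : X.presheaf.stalk x ⟶ nbhdRing x n :=
  CommRingCat.ofHom
    (Ideal.Quotient.mk (IsLocalRing.maximalIdeal (X.presheaf.stalk x) ^ n))

/-- The canonical morphism `Spec (𝒪_x / 𝔪_x ^ n) ⟶ X`. -/
abbrev specNbhd (x : X) (n : ℕ) : Spec (nbhdRing x n) ⟶ X := nbhdι x n

lemma specMap_toNbhdRing (x : X) (n : ℕ) :
    Spec.map (toNbhdRing x n) ≫ X.fromSpecStalk x = specNbhd x n := rfl

/-- The canonical map from `A` to `𝒪_x / 𝔪_x ^ n` for a point of the chart `Spec A`. -/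
def chartNbhd (n : ℕ) : A ⟶ nbhdRing (f y) n :=
  chartStalk f y ≫ toNbhdRing (f y) n

lemma specMap_chartNbhd (n : ℕ) : Spec.map (chartNbhd f y n) ≫ f = specNbhd (f y) n := by
  rw [chartNbhd, Spec.map_comp, Category.assoc, specMap_chartStalk, specMap_toNbhdRing]

lemma isQuotLoc_chartNbhd (n : ℕ) :
    IsQuotLoc (chartNbhd f y n).hom y.asIdeal.primeCompl (y.asIdeal ^ n) := by
  let := (chartStalk f y).hom.toAlgebra
  have := isLocalization_chartStalk f y
  exact isQuotLoc_atPrime (R := X.presheaf.stalk (f y)) y.asIdeal n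

variable (M : X.Modules)

/-- The map from the sections over the chart `Spec A` to `M_x / 𝔪_x ^ n M_x`. -/
def nbhdMap (n : ℕ) : Γ(M.restrict f, ⊤) →ₛₗ[(chartNbhd f y n).hom]
    Γ((Scheme.Modules.pullback (specNbhd (f y) n)).obj M, ⊤) :=
  chartMap f (chartNbhd f y n) M (specNbhd (f y) n) (specMap_chartNbhd f y n)

lemma top_le_preimage_nbhdι (n : ℕ) : ⊤ ≤ specNbhd (f y) n ⁻¹ᵁ f ''ᵁ ⊤ :=
  le_preimage_image_top f _ _ (specMap_chartNbhd f y n)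

lemma nbhdMap_eq_evalSection (n : ℕ) (z : Γ(M.restrict f, ⊤)) :
    nbhdMap f y M n z =
      evalSection (specNbhd (f y) n) M (f ''ᵁ ⊤) (top_le_preimage_nbhdι f y n) z :=
  chartMap_eq_evalSection f _ M _ _ z

variable [IsIso (M.restrict f).fromTildeΓ]

lemma isExtension_nbhdMap (n : ℕ) : IsExtension (chartNbhd f y n).hom (nbhdMap f y M n) :=
  isExtension_chartMap f _ M _ _

lemma nbhdMap_eq_zero_iff (n : ℕ) (z : Γ(M.restrict f, ⊤)) : nbhdMap f y M n z = 0 ↔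
    ∃ s ∉ y.asIdeal, s • z ∈ y.asIdeal ^ n • (⊤ : Submodule A Γ(M.restrict f, ⊤)) :=
  (isExtension_nbhdMap f y M n).eq_zero_iff (isQuotLoc_chartNbhd f y n) z

lemma exists_smul_eq_nbhdMap (n : ℕ) (p : Γ((Scheme.Modules.pullback (specNbhd (f y) n)).obj M, ⊤)) :
    ∃ s ∉ y.asIdeal, ∃ z, (chartNbhd f y n).hom s • p = nbhdMap f y M n z :=
  (isExtension_nbhdMap f y M n).exists_smul_eq (isQuotLoc_chartNbhd f y n) p

lemma nbhdMap_surjective (hy : y.asIdeal.IsMaximal) (n : ℕ) :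
    Function.Surjective (nbhdMap f y M n) :=
  (isExtension_nbhdMap f y M n).surjective (isQuotLoc_chartNbhd f y n).surjective_of_isMaximal

lemma nbhdMap_eq_zero_iff_of_isMaximal (hy : y.asIdeal.IsMaximal) (n : ℕ) (z : Γ(M.restrict f, ⊤)) :
    nbhdMap f y M n z = 0 ↔ z ∈ y.asIdeal ^ n • (⊤ : Submodule A Γ(M.restrict f, ⊤)) := by
  have h := isQuotLoc_chartNbhd f y n
  rw [← h.ker_eq_pow]
  exact (isExtension_nbhdMap f y M n).eq_zero_iff_of_surjective h.surjective_of_isMaximal z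

end Chart

section Ideals

variable {X : Scheme.{u}}

lemma ker_comp_ne_bot {Y : Scheme.{u}} {A : CommRingCat.{u}} (h : Y ⟶ Spec A) (f : Spec A ⟶ X)
    [IsOpenImmersion f] [QuasiCompact (h ≫ f)] {a : A} (ha : a ≠ 0)
    (hha : h.appTop ((Scheme.ΓSpecIso A).inv a) = 0) : (h ≫ f).ker ≠ ⊥ := by
  intro hbot
  let U : X.affineOpens := ⟨f.opensRange, isAffineOpen_opensRange f⟩
  have : IsIso (f.app U) := f.isIso_app _ le_rfl
  have hU : f ⁻¹ᵁ f.opensRange = ⊤ := by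
    ext x
    exact ⟨fun _ => trivial, fun _ => ⟨x, rfl⟩⟩
  let b : Γ(Spec A, f ⁻¹ᵁ f.opensRange) :=
    (Spec A).presheaf.map (homOfLE le_top).op ((Scheme.ΓSpecIso A).inv a)
  obtain ⟨s, hs⟩ := ((ConcreteCategory.isIso_iff_bijective (f.app U)).1 this).2 b
  have h1 : (h ≫ f).app U s = 0 := by
    refine (congr($(Scheme.Hom.comp_app h f U) s)).trans ((congrArg (h.app _) hs).trans ?_)
    have := congr($(h.naturality (homOfLE (show f ⁻¹ᵁ f.opensRange ≤ ⊤ from le_top)).op)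
      ((Scheme.ΓSpecIso A).inv a))
    refine this.trans ?_
    exact (congrArg (Y.presheaf.map _) hha).trans (map_zero (Y.presheaf.map _).hom)
  have h2 : s ∈ (h ≫ f).ker.ideal U := by
    rw [Scheme.Hom.ker_apply]
    exact h1
  rw [hbot] at h2
  have h3 : s = 0 := h2
  rw [h3, map_zero] at hs
  refine ha ?_
  have h4 := congrArg ((Spec A).presheaf.map (homOfLE hU.ge).op) hs
  rw [map_zero] at h4
  have h5 : (Scheme.ΓSpecIso A).inv a = 0 := by
    refine Eq.trans ?_ h4.symm
    refine Eq.trans ?_ (congr($((Spec A).presheaf.map_comp (homOfLE le_top).op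
      (homOfLE hU.ge).op) ((Scheme.ΓSpecIso A).inv a)))
    exact (congr($((Spec A).presheaf.map_id _) ((Scheme.ΓSpecIso A).inv a))).symm
  have h6 := congrArg (Scheme.ΓSpecIso A).hom h5
  rw [map_zero] at h6
  exact (congr($((Scheme.ΓSpecIso A).inv_hom_id) a)).symm.trans h6

/-- Positive codimension means that the prime of the point is nonzero, and a nonzero element of its
`n`-th power vanishes on the neighbourhood. So the scheme-theoretic image of the neighbourhood is a
proper closed subscheme. -/
lemma ker_nbhdι_ne_bot [AlgebraicGeometry.IsIntegral X] [IsLocallyNoetherian X] (x : X)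
    (hx : Order.coheight x ≠ 0) (n : ℕ) : (nbhdι x n).ker ≠ ⊥ := by
  obtain ⟨A, f, hf, ⟨y, rfl⟩, -⟩ := Scheme.exists_affine_mem_range_and_range_subset
    (show x ∈ (⊤ : X.Opens) from trivial)
  have : Nonempty (Spec A) := ⟨y⟩
  have : AlgebraicGeometry.IsIntegral (Spec A) := isIntegral_of_isOpenImmersion f
  have : IsDomain A := (affine_isIntegral_iff A).1 this
  rw [coheight_eq_of_isOpenImmersion f, ← idealHeight_eq_coheight A] at hx
  have hy : y.asIdeal ≠ ⊥ := by
    intro h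
    rw [h] at hx
    exact hx (by simp)
  obtain ⟨a, ha, ha'⟩ := Submodule.exists_mem_ne_zero_of_ne_bot (pow_ne_zero n hy)
  have : NoetherianSpace (Spec (nbhdRing (f y) n)) :=
    inferInstanceAs (NoetherianSpace (PrimeSpectrum (X.presheaf.stalk (f y) ⧸
      IsLocalRing.maximalIdeal (X.presheaf.stalk (f y)) ^ n)))
  have : QuasiCompact (Spec.map (chartNbhd f y n) ≫ f) :=
    quasiCompact_of_noetherianSpace_source _
  change (specNbhd (f y) n).ker ≠ ⊥
  rw [← specMap_chartNbhd f y n]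
  refine ker_comp_ne_bot _ f ha' ?_
  have h1 : (chartNbhd f y n).hom a = 0 :=
    ((isQuotLoc_chartNbhd f y n).ker a).2 ⟨1, Submonoid.one_mem _, by rwa [one_mul]⟩
  refine (congr($(Scheme.ΓSpecIso_inv_naturality (chartNbhd f y n)) a)).symm.trans ?_
  exact (congrArg (Scheme.ΓSpecIso _).inv h1).trans (map_zero _)

/-- If the ideal sheaf `I` vanishes on the infinitesimal neighbourhood of `x`, the latter is
contained in the closed subscheme given by `I`. -/
lemma exists_lift_nbhdι {x : X} {n : ℕ} {I : X.IdealSheafData} (h : I ≤ (nbhdι x n).ker) :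
    ∃ g : nbhd x n ⟶ I.subscheme, g ≫ I.subschemeι = nbhdι x n :=
  ⟨IsClosedImmersion.lift I.subschemeι (nbhdι x n) (by rwa [I.ker_subschemeι]),
    IsClosedImmersion.lift_fac _ _ _⟩

lemma le_ker_of_comp_eq {x : X} {n : ℕ} {I : X.IdealSheafData} (g : nbhd x n ⟶ I.subscheme)
    (h : g ≫ I.subschemeι = nbhdι x n) : I ≤ (nbhdι x n).ker := by
  rw [← h]
  exact I.ker_subschemeι.ge.trans (g.le_ker_comp I.subschemeι)

end Ideals

end

/-! ### Coherent sheaves as finite modules on charts -/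

section

section Coherence

/-- The sections of `M` over the affine chart `f` are a finite module, and the restriction of `M`
to the chart is the sheaf associated to it. -/
structure IsFiniteOnChart {A : CommRingCat.{u}} {X : Scheme.{u}} (f : Spec A ⟶ X)
    [IsOpenImmersion f] (M : X.Modules) : Prop where
  isIso_fromTildeΓ : IsIso (M.restrict f).fromTildeΓ
  finite : Module.Finite A Γ(M.restrict f, ⊤)

variable {A B : CommRingCat.{u}}

/-- The projection to the cokernel on global sections comes from a morphism of sheaves that composes
with `H` to zero; as `H` is epi, this morphism vanishes. -/
lemma surjective_app_top_of_epi {Y Z : (Spec A).Modules} [IsIso Y.fromTildeΓ]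
    [IsIso Z.fromTildeΓ] (H : Y ⟶ Z) [Epi H] : Function.Surjective (appTopₗ H) := by
  rw [← LinearMap.range_eq_top, ← (LinearMap.range _).ker_mkQ, LinearMap.ker_eq_top]
  let Q := Γ(Z, ⊤) ⧸ LinearMap.range (appTopₗ H)
  let e : Q ≃ₗ[A] Γ(tilde (ModuleCat.of A Q), ⊤) := (tilde.isoTop (ModuleCat.of A Q)).toLinearEquiv
  obtain ⟨v, hv⟩ := exists_app_top_eq Z (tilde (ModuleCat.of A Q))
    (e.toLinearMap ∘ₗ (LinearMap.range (appTopₗ H)).mkQ)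
  have h0 : v = 0 := by
    rw [← cancel_epi H]
    refine hom_ext_of_app_top fun x => (hv _).trans ?_
    rw [comp_zero]
    refine Eq.trans (congrArg e ?_) (map_zero e)
    exact (Submodule.Quotient.mk_eq_zero _).2 ⟨x, rfl⟩
  ext x
  refine e.injective ((hv x).symm.trans ?_)
  rw [h0]
  exact (map_zero e).symm

lemma finite_of_presentation (M : (Spec A).Modules) (P : M.Presentation) [P.IsFinite] :
    Module.Finite A Γ(M, ⊤) := by
  have := isIso_fromTildeΓ_of_presentation M P
  have : P.generators.IsFiniteType :=
    SheafOfModules.Presentation.IsFinite.isFiniteType_generators (p := P)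
  have : Finite P.generators.I := this.finite
  let H : SheafOfModules.free P.generators.I ⟶ M := P.generators.π
  have this₀ : Epi H := P.generators.epi
  let e : (P.generators.I →₀ A) ≃ₗ[A] Γ(tilde (ModuleCat.of A (P.generators.I →₀ A)), ⊤) :=
    (tilde.isoTop (ModuleCat.of A (P.generators.I →₀ A))).toLinearEquiv
  let t : tilde (ModuleCat.of A (P.generators.I →₀ A)) ≅
    (SheafOfModules.free P.generators.I : (Spec A).Modules) := tildeFinsupp _
  let H' : tilde (ModuleCat.of A (P.generators.I →₀ A)) ⟶ M := t.hom ≫ H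
  have : IsIso t.hom := Iso.isIso_hom t
  have : Epi H' := @epi_comp _ _ _ _ _ t.hom (IsIso.epi_of_iso _) H this₀
  have := surjective_app_top_of_epi H'
  exact Module.Finite.of_surjective (appTopₗ H' ∘ₗ e.toLinearMap) (this.comp e.surjective)

/-- Finitely many of the elements `a` generate the unit ideal, and so do their powers. -/
lemma finite_of_forall_exists_pow_smul_mem {A N : Type*} [CommRing A] [AddCommGroup N] [Module A N]
    (h : ∀ y : PrimeSpectrum A, ∃ a ∉ y.asIdeal, ∃ T : Finset N,
      ∀ z, ∃ n : ℕ, a ^ n • z ∈ Submodule.span A (T : Set N)) : Module.Finite A N := by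
  classical
  choose a ha T hT using h
  have htop : Ideal.span (Set.range a) = ⊤ := by
    by_contra hne
    obtain ⟨m, hm, hle⟩ := Ideal.exists_le_maximal _ hne
    exact ha ⟨m, hm.isPrime⟩ (hle (Ideal.subset_span ⟨_, rfl⟩))
  obtain ⟨s, hs, hs'⟩ := Submodule.mem_span_finite_of_mem_span
    ((Ideal.eq_top_iff_one _).1 htop)
  choose y hy using fun b : s => hs b.2
  refine ⟨s.attach.biUnion fun b => T (y b), ?_⟩
  refine Submodule.eq_top_iff'.2 fun z => ?_
  refine Submodule.mem_of_span_eq_top_of_smul_pow_mem _ (s : Set A)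
    ((Ideal.eq_top_iff_one _).2 hs') z ?_
  rintro ⟨b, hb⟩
  obtain ⟨n, hn⟩ := hT (y ⟨b, hb⟩) z
  rw [hy ⟨b, hb⟩] at hn
  refine ⟨n, Submodule.span_mono ?_ hn⟩
  exact_mod_cast Finset.subset_biUnion_of_mem (fun b => T (y b)) (s.mem_attach ⟨b, hb⟩)

/-- Numerators of finitely many generators of `P` suffice: as `I = 0`, an equation in `P` lifts to
`N` after multiplication by one more element of `S`. -/
lemma IsExtension.exists_finset {A B N P : Type u} [CommRing A] [CommRing B] {φ : A →+* B}
    [AddCommGroup N] [Module A N] [AddCommGroup P] [Module B P] {c : N →ₛₗ[φ] P} {S : Submonoid A}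
    (hc : IsExtension φ c) (h : IsQuotLoc φ S ⊥) [Module.Finite B P] :
    ∃ T : Finset N, ∀ z, ∃ s ∈ S, s • z ∈ Submodule.span A (T : Set N) := by
  classical
  obtain ⟨G, hG⟩ := Module.Finite.fg_top (R := B) (M := P)
  choose s hs n hn using hc.exists_smul_eq h
  refine ⟨G.image n, fun z => ?_⟩
  have key : ∀ p ∈ Submodule.span B (G : Set P), ∃ s ∈ S,
      ∃ x ∈ Submodule.span A ((G.image n : Finset N) : Set N), φ s • p = c x := by
    intro p hp
    induction hp using Submodule.span_induction with
    | mem x hx =>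
      exact ⟨s x, hs x, n x, Submodule.subset_span (Finset.mem_coe.2 (Finset.mem_image_of_mem n hx)), hn x⟩
    | zero => exact ⟨1, S.one_mem, 0, Submodule.zero_mem _, by simp⟩
    | add x y _ _ hx hy =>
      obtain ⟨s, hs, n, hn, e⟩ := hx
      obtain ⟨t, ht, m, hm, e'⟩ := hy
      refine ⟨s * t, S.mul_mem hs ht, t • n + s • m,
        Submodule.add_mem _ (Submodule.smul_mem _ _ hn) (Submodule.smul_mem _ _ hm), ?_⟩
      rw [map_add, map_smulₛₗ, map_smulₛₗ, ← e, ← e', smul_add, map_mul, smul_smul, smul_smul,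
        mul_comm (φ t)]
    | smul b x _ hx =>
      obtain ⟨s, hs, n, hn, e⟩ := hx
      obtain ⟨t, ht, a, e'⟩ := h.surj b
      refine ⟨t * s, S.mul_mem ht hs, a • n, Submodule.smul_mem _ _ hn, ?_⟩
      rw [map_smulₛₗ, ← e, ← e', map_mul, smul_smul, smul_smul]
      congr 1
      ring
  obtain ⟨t, ht, x, hx, e⟩ := key (c z) (hG ▸ Submodule.mem_top)
  rw [← map_smulₛₗ, ← sub_eq_zero, ← map_sub, hc.eq_zero_iff h] at e
  obtain ⟨r, hr, e⟩ := e
  rw [Submodule.bot_smul, Submodule.mem_bot, smul_sub, sub_eq_zero, smul_smul] at e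
  exact ⟨r * t, S.mul_mem hr ht, e ▸ Submodule.smul_mem _ _ hx⟩

lemma isQuotLoc_away {A : Type*} [CommRing A] (a : A) (B : Type*) [CommRing B] [Algebra A B]
    [IsLocalization.Away a B] : IsQuotLoc (algebraMap A B) (Submonoid.powers a) ⊥ where
  isUnit s hs := IsLocalization.map_units B (⟨s, hs⟩ : Submonoid.powers a)
  surj b := by
    obtain ⟨⟨x, s⟩, h⟩ := IsLocalization.surj (Submonoid.powers a) b
    exact ⟨s, s.2, x, (mul_comm _ _).trans h⟩
  ker x := by
    rw [IsLocalization.map_eq_zero_iff (Submonoid.powers a)]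
    simp

/-- The pullback of a sheaf with a finite presentation on the open subscheme `W` to an open
subscheme of `W` has a finite presentation. -/
lemma exists_presentation_restrict {X Y : Scheme.{u}} (M : X.Modules) (W : X.Opens)
    (P : (SheafOfModules.over M W).Presentation) [P.IsFinite] (f : Y ⟶ X) [IsOpenImmersion f]
    (hf : f.opensRange ≤ W) : ∃ P : (M.restrict f).Presentation, P.IsFinite := by
  let v : Y ⟶ W := IsOpenImmersion.lift W.ι f (by simpa using! hf)
  have hv : v ≫ W.ι = f := IsOpenImmersion.lift_fac _ _ _
  have : IsOpenImmersion v := by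
    have : IsOpenImmersion (v ≫ W.ι) := hv ▸ inferInstance
    exact IsOpenImmersion.of_comp v W.ι
  have : PreservesColimitsOfSize.{u, u} (restrictFunctor v) := inferInstance
  let F := (overEquiv W).functor ⋙ restrictFunctor v
  let iso : SheafOfModules.overFunctor X.ringCatSheaf _ ⋙ F ≅ restrictFunctor f :=
    (Functor.associator _ _ _).symm ≪≫
        Functor.isoWhiskerRight (Scheme.Modules.overFunctorEquiv _) _ ≪≫
        (restrictFunctorComp _ _).symm ≪≫ (restrictFunctorCongr hv)
  have hF : PreservesColimitsOfSize.{u, u} F := by infer_instance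
  let P' : (F.obj (SheafOfModules.over M W)).Presentation :=
    @SheafOfModules.Presentation.map _ _ _ _ _ _ _ _ _ _ _ _ _ P F hF
      (Scheme.Modules.restrictUnitIso _).symm
  exact ⟨@SheafOfModules.Presentation.ofIsIso _ _ _ _ _ _ _ _ (iso.app M).hom
    (Iso.isIso_hom (iso.app M)) P', ⟨⟨inferInstanceAs (Finite P.generators.I)⟩,
      ⟨inferInstanceAs (Finite P.relations.I)⟩⟩⟩

/-- Each point has a basic open neighbourhood `D(a)` inside a set where `M` is finitely presented,
so the sections there are a finite module over the localization. Clearing denominators gives finite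
generation up to powers of `a`. -/
theorem isFiniteOnChart_of_isCoherent {X : Scheme.{u}} {M : X.Modules} (hM : isCoherent X M)
    (f : Spec A ⟶ X) [IsOpenImmersion f] : IsFiniteOnChart f M := by
  obtain ⟨σ, hσ⟩ := SheafOfModules.IsFinitePresentation.exists_quasicoherentData (self := hM)
  have hq : SheafOfModules.IsQuasicoherent (R := X.ringCatSheaf) M := σ.isQuasicoherent
  have ht : IsIso (M.restrict f).fromTildeΓ := by
    have := @isQuasicoherent_restrictFunctor _ _ f _ M hq
    infer_instance
  refine ⟨ht, finite_of_forall_exists_pow_smul_mem fun y => ?_⟩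
  have hcov : iSup σ.X = ⊤ := (Opens.coversTop_iff _ _).1 σ.coversTop
  obtain ⟨i, hi⟩ := Opens.mem_iSup.1 (hcov ▸ Opens.mem_top (f y) : f y ∈ iSup σ.X)
  obtain ⟨_, ⟨_, ⟨a, rfl⟩, rfl⟩, hya, hle⟩ :=
    PrimeSpectrum.isBasis_basic_opens.exists_subset_of_mem_open
      (show y ∈ (f ⁻¹ᵁ σ.X i : Set (Spec A)) from hi) (f ⁻¹ᵁ σ.X i).isOpen
  obtain ⟨B, φ, hφ, hB⟩ : ∃ (B : CommRingCat.{u}) (φ : A ⟶ B), IsOpenImmersion (Spec.map φ) ∧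
      @IsLocalization.Away A _ a B _ φ.hom.toAlgebra := by
    refine ⟨.of (Localization.Away a), CommRingCat.ofHom (algebraMap A (Localization.Away a)),
      IsOpenImmersion.of_isLocalization a, ?_⟩
    -- The algebra structure built from the ring map is identified with the standard one, so that
    -- the localization property carries over.
    have h : (algebraMap A (Localization.Away a)).toAlgebra = OreLocalization.instAlgebra :=
      Algebra.algebra_ext _ _ fun _ => rfl
    have h' : IsLocalization.Away a (Localization.Away a) := inferInstance
    rw [← h] at h'
    exact h'
  let := φ.hom.toAlgebra
  let j := Spec.map φ ≫ f
  have hj : j.opensRange ≤ σ.X i := by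
    rintro _ ⟨z, rfl⟩
    exact hle ((PrimeSpectrum.localization_away_comap_range B a).subset ⟨z, rfl⟩)
  have hfin : Module.Finite B Γ((Scheme.Modules.pullback j).obj M, ⊤) := by
    have := hσ.isFinite_presentation i
    obtain ⟨P, hP⟩ := exists_presentation_restrict M (σ.X i) (σ.presentation i) j hj
    let e := (restrictFunctorIsoPullback j).app M
    let P' := @SheafOfModules.Presentation.ofIsIso _ _ _ _ _ _ _ _ e.hom (Iso.isIso_hom e) P
    have h₁ := SheafOfModules.Presentation.IsFinite.isFiniteType_generators (p := P)
    have h₂ := SheafOfModules.Presentation.IsFinite.isFiniteType_relations (p := P)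
    have : P'.IsFinite := ⟨⟨h₁.finite⟩,
      ⟨h₂.finite⟩⟩
    exact finite_of_presentation _ P'
  obtain ⟨T, hT⟩ := (isExtension_chartMap f φ M j rfl).exists_finset
    (isQuotLoc_away a B)
  refine ⟨a, hya, T, fun z => ?_⟩
  obtain ⟨_, ⟨n, rfl⟩, hn⟩ := hT z
  exact ⟨n, hn⟩

lemma exists_finite_presentation [IsNoetherianRing A] (M : (Spec A).Modules)
    [hM : IsIso M.fromTildeΓ] [hfin : Module.Finite A Γ(M, ⊤)] :
    ∃ P : M.Presentation, P.IsFinite := by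
  let N := (modulesSpecToSheaf.obj M).presheaf.obj (.op ⊤)
  have hN : Module.Finite A N := hfin
  obtain ⟨s, hs⟩ := hN.fg_top
  obtain ⟨t, ht⟩ := (IsNoetherian.noetherian (LinearMap.ker
    (Finsupp.linearCombination A ((↑) : ↥(s : Set N) → N))))
  let P := presentationTilde (R := A) N (s : Set N) hs (t : Set (↥(s : Set N) →₀ A)) ht
  refine ⟨@SheafOfModules.Presentation.ofIsIso _ _ _ _ _ _ _ _ M.fromTildeΓ hM P,
    ⟨⟨inferInstanceAs (Finite (s : Set N))⟩, ⟨inferInstanceAs (Finite (t : Set (↥(s : Set N) →₀ A)))⟩⟩⟩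

/-- A presentation on an open subscheme, as a presentation on the slice site. -/
lemma exists_presentation_over {X : Scheme.{u}} (M : X.Modules) (W : X.Opens)
    (P : (M.restrict W.ι).Presentation) [P.IsFinite] :
    ∃ P : (SheafOfModules.over M W).Presentation, P.IsFinite := by
  let E := overEquiv W
  have hF : PreservesColimitsOfSize.{u, u} E.inverse := inferInstance
  let η : SheafOfModules.unit _ ≅ E.inverse.obj (SheafOfModules.unit W.toScheme.ringCatSheaf) :=
    E.unitIso.app _
  let iso : E.inverse.obj (M.restrict W.ι) ≅ SheafOfModules.over M W :=
    E.inverse.mapIso ((overFunctorEquiv W).symm.app M) ≪≫ (E.unitIso.app _).symm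
  let P' : (E.inverse.obj (M.restrict W.ι)).Presentation :=
    @SheafOfModules.Presentation.map _ _ _ _ _ _ _ _ _ _ _ _ _ P E.inverse hF η
  have h₁ := SheafOfModules.Presentation.IsFinite.isFiniteType_generators (p := P)
  have h₂ := SheafOfModules.Presentation.IsFinite.isFiniteType_relations (p := P)
  exact ⟨@SheafOfModules.Presentation.ofIsIso _ _ _ _ _ _ _ _ iso.hom
    (Iso.isIso_hom iso) P', ⟨⟨h₁.finite⟩,
      ⟨h₂.finite⟩⟩⟩

/-- Over a Noetherian ring a finite module is finitely presented; the presentation is carried from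
the chart to its open image, and from there to the slice site. -/
theorem isCoherent_of_isFiniteOnChart {X : Scheme.{u}} [IsLocallyNoetherian X] {M : X.Modules}
    (h : ∀ x : X, ∃ (A : CommRingCat.{u}) (f : Spec A ⟶ X) (_ : IsOpenImmersion f),
      x ∈ f.opensRange ∧ IsFiniteOnChart f M) : isCoherent X M := by
  choose A f hf hx hM using h
  have key : ∀ x, ∃ P : (SheafOfModules.over M (f x).opensRange).Presentation, P.IsFinite := by
    intro x
    have : IsNoetherianRing (A x) := by
      have : IsLocallyNoetherian (Spec (A x)) :=
        isLocallyNoetherian_of_isOpenImmersion (f x)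
      exact isLocallyNoetherian_Spec.1 this
    have := (hM x).isIso_fromTildeΓ
    have := (hM x).finite
    obtain ⟨P, hP⟩ := exists_finite_presentation (M.restrict (f x))
    let W := (f x).opensRange
    let e : (W : Scheme.{u}) ≅ Spec (A x) := (f x).isoOpensRange.symm
    have he : e.hom ≫ f x = W.ι := (f x).isoOpensRange_inv_comp
    let iso : (M.restrict (f x)).restrict e.hom ≅ M.restrict W.ι :=
      ((restrictFunctorComp e.hom (f x)).symm ≪≫ restrictFunctorCongr he).app M
    let P' := presentationRestrict e.hom P
    let P'' : (M.restrict W.ι).Presentation := @SheafOfModules.Presentation.ofIsIso _ _ _ _ _ _ _ _ iso.hom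
      (Iso.isIso_hom iso) P'
    have h₁ := SheafOfModules.Presentation.IsFinite.isFiniteType_generators (p := P)
    have h₂ := SheafOfModules.Presentation.IsFinite.isFiniteType_relations (p := P)
    have : P''.IsFinite := ⟨⟨h₁.finite⟩,
      ⟨h₂.finite⟩⟩
    exact exists_presentation_over M W P''
  choose P hP using key
  have hcov : (Opens.grothendieckTopology X).CoversTop (fun x => (f x).opensRange) :=
    (Opens.coversTop_iff _ _).2 (eq_top_iff.2 fun x _ => Opens.mem_iSup.2 ⟨x, hx x⟩)
  let σ : SheafOfModules.QuasicoherentData.{u, u, u, u} (R := X.ringCatSheaf) M :=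
    SheafOfModules.QuasicoherentData.mk.{u, u, u, u} X _ hcov P
  have hσ : σ.IsFinitePresentation :=
    SheafOfModules.QuasicoherentData.IsFinitePresentation.mk.{u, u, u, u} (q := σ) hP
  exact SheafOfModules.IsFinitePresentation.mk.{u, u, u} ⟨σ, hσ⟩

end Coherence

end

/-! ### Operations that preserve coherence -/

section

section Closure
variable {A B : CommRingCat.{u}} {X : Scheme.{u}}

instance isClosedUnderColimitsOfShape_essImage_tilde (J : Type) [SmallCategory J] :
    (tilde.functor A).essImage.IsClosedUnderColimitsOfShape J := by
  infer_instance

/-- The essential image of `tilde.functor` is closed under colimits. -/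
lemma isIso_fromTildeΓ_cokernel {Y Z : (Spec A).Modules} (g : Y ⟶ Z) [hY : IsIso Y.fromTildeΓ]
    [hZ : IsIso Z.fromTildeΓ] : IsIso (cokernel g).fromTildeΓ := by
  rw [isIso_fromTildeΓ_iff] at *
  have := isClosedUnderColimitsOfShape_essImage_tilde (A := A) WalkingParallelPair
  refine ObjectProperty.prop_colimit (P := (tilde.functor A).essImage) (J := WalkingParallelPair)
    (parallelPair g 0) ?_
  rintro (_ | _) <;> assumption

lemma IsFiniteOnChart.cokernel {f : Spec A ⟶ X} [IsOpenImmersion f] {M M' : X.Modules} (g : M ⟶ M')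
    (hM : IsFiniteOnChart f M) (hM' : IsFiniteOnChart f M') :
    IsFiniteOnChart f (cokernel g) := by
  have := hM.1
  have := hM'.1
  have := hM'.2
  have e : (Limits.cokernel g).restrict f ≅ Limits.cokernel ((restrictFunctor f).map g) :=
    PreservesCokernel.iso (restrictFunctor f) g
  have h : IsIso ((Limits.cokernel g).restrict f).fromTildeΓ := by
    have := isIso_fromTildeΓ_cokernel ((restrictFunctor f).map g)
    rw [isIso_fromTildeΓ_iff] at *
    exact ObjectProperty.prop_of_iso _ e.symm this
  refine ⟨h, ?_⟩
  let q : M'.restrict f ⟶ (Limits.cokernel g).restrict f := (restrictFunctor f).map (cokernel.π g)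
  have : Epi q := inferInstance
  exact Module.Finite.of_surjective (appTopₗ q) (surjective_app_top_of_epi q)

lemma IsFiniteOnChart.biprod {f : Spec A ⟶ X} [IsOpenImmersion f] {M M' : X.Modules}
    (hM : IsFiniteOnChart f M) (hM' : IsFiniteOnChart f M') :
    IsFiniteOnChart f (M ⊞ M') := by
  have := hM.1
  have := hM'.1
  have := hM.2
  have := hM'.2
  have e : (M ⊞ M').restrict f ≅ M.restrict f ⨿ M'.restrict f :=
    (restrictFunctor f).mapIso (biprod.isoCoprod M M') ≪≫ (PreservesColimitPair.iso (restrictFunctor f) M M').symm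
  refine ⟨?_, ?_⟩
  · rw [isIso_fromTildeΓ_iff] at *
    refine ObjectProperty.prop_of_iso _ e.symm ?_
    have := isClosedUnderColimitsOfShape_essImage_tilde (A := A) (Discrete WalkingPair)
    refine ObjectProperty.prop_colimit (P := (tilde.functor A).essImage)
      (J := Discrete WalkingPair) (pair (M.restrict f) (M'.restrict f)) ?_
    rintro ⟨(_ | _)⟩ <;> assumption
  · let l : M.restrict f ⟶ (M ⊞ M').restrict f := (restrictFunctor f).map biprod.inl
    let r : M'.restrict f ⟶ (M ⊞ M').restrict f := (restrictFunctor f).map biprod.inr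
    refine Module.Finite.of_surjective ((appTopₗ l).coprod (appTopₗ r)) fun x => ?_
    let y : Γ(M ⊞ M', f ''ᵁ ⊤) := x
    refine ⟨((biprod.fst : M ⊞ M' ⟶ M).app _ y, (biprod.snd : M ⊞ M' ⟶ M').app _ y), ?_⟩
    have := congr(($(biprod.total (X := M) (Y := M')).app (f ''ᵁ ⊤)) y)
    exact this

lemma IsFiniteOnChart.of_iso {f : Spec A ⟶ X} [IsOpenImmersion f] {M : X.Modules}
    {N : (Spec A).Modules} (e : M.restrict f ≅ N) (hN : IsIso N.fromTildeΓ)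
    (hN' : Module.Finite A Γ(N, ⊤)) : IsFiniteOnChart f M where
  isIso_fromTildeΓ := by
    rw [isIso_fromTildeΓ_iff] at *
    exact ObjectProperty.prop_of_iso _ e.symm hN
  finite := Module.Finite.of_surjective (appTopₗ e.inv) fun x =>
    ⟨e.hom.app ⊤ x, congr(($(e.hom_inv_id).app ⊤) x)⟩

lemma finite_tilde (N : ModuleCat.{u} A) [Module.Finite A N] : Module.Finite A Γ(tilde N, ⊤) :=
  Module.Finite.equiv (tilde.isoTop N).toLinearEquiv

instance isIso_fromTildeΓ_tilde (N : ModuleCat.{u} A) : IsIso (tilde N).fromTildeΓ :=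
  isIso_fromTildeΓ_iff.2 ⟨N, ⟨Iso.refl _⟩⟩

lemma isFiniteOnChart_unit (f : Spec A ⟶ X) [IsOpenImmersion f] :
    IsFiniteOnChart f (SheafOfModules.unit X.ringCatSheaf) :=
  IsFiniteOnChart.of_iso (N := tilde (ModuleCat.of A A)) (restrictUnitIso f) inferInstance
    (finite_tilde _)

/-- The direct image on the chart `f` of the pullback of a sheaf to a closed subscheme. -/
def restrictPushforwardPullback {Z : Scheme.{u}} (i : Z ⟶ X) (f : Spec A ⟶ X) [IsOpenImmersion f]
    (M : X.Modules) (q : A ⟶ B) (g : Spec B ⟶ Z) (h : g ≫ i = Spec.map q ≫ f) :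
    ((pushforward i).obj ((Scheme.Modules.pullback i).obj M)).restrict f ⟶
      (pushforward (Spec.map q)).obj ((Scheme.Modules.pullback (Spec.map q ≫ f)).obj M) :=
  ((restrictAdjunction f).homEquiv _ _).symm
    ((pushforward i).map ((baseChange g i _ h).app M) ≫
      (pushforwardIso g i _ h).hom.app _ ≫ (pushforwardIso (Spec.map q) f _ rfl).inv.app _)

lemma isIso_restrictPushforwardPullback {Z : Scheme.{u}} (i : Z ⟶ X) (f : Spec A ⟶ X)
    [IsOpenImmersion f] (M : X.Modules) (q : A ⟶ B) (g : Spec B ⟶ Z) [IsOpenImmersion g]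
    (h : g ≫ i = Spec.map q ≫ f) (hg : i ⁻¹ᵁ f ''ᵁ ⊤ ≤ g.opensRange) :
    IsIso (restrictPushforwardPullback i f M q g h) := by
  rw [Hom.isIso_iff_isIso_app]
  intro U
  rw [ConcreteCategory.isIso_iff_bijective]
  rw [restrictPushforwardPullback, Adjunction.homEquiv_counit]
  let N := (Scheme.Modules.pullback (Spec.map q ≫ f)).obj M
  have h₁ : Function.Bijective (baseChangeSections g i _ h M (i ⁻¹ᵁ f ''ᵁ U)) :=
    bijective_baseChangeSections g i _ h M _ fun x hx => hg (by
      obtain ⟨y, -, hy⟩ := hx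
      exact ⟨y, trivial, hy⟩)
  have h₂ : Function.Bijective (((pushforwardIso g i _ h).hom.app N).app (f ''ᵁ U)) :=
    (ConcreteCategory.isIso_iff_bijective _).1 inferInstance
  have h₃ : Function.Bijective
      (((pushforwardIso (Spec.map q) f _ rfl).inv.app N).app (f ''ᵁ U)) :=
    (ConcreteCategory.isIso_iff_bijective _).1 inferInstance
  have h₄ : Function.Bijective
      (((restrictAdjunction f).counit.app ((pushforward (Spec.map q)).obj N)).app U) :=
    (ConcreteCategory.isIso_iff_bijective _).1 inferInstance
  exact h₄.comp (h₃.comp (h₂.comp h₁))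

/-- On the chart this is the direct image of a sheaf associated to a module on a closed chart of
`Z`, and its sections are a quotient of those of `M`. These sheaves carry the sections `s_Z` when
witnesses are built from a family. -/
lemma IsFiniteOnChart.pushforward_pullback {Z : Scheme.{u}} (i : Z ⟶ X) [IsClosedImmersion i]
    {f : Spec A ⟶ X} [IsOpenImmersion f] {M : X.Modules} (hM : IsFiniteOnChart f M) :
    IsFiniteOnChart f ((pushforward i).obj ((Scheme.Modules.pullback i).obj M)) := by
  have := hM.1
  have := hM.2
  constructor
  · obtain ⟨B, q, g, hg, hq, h, hle⟩ := exists_closed_chart i f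
    have := isIso_restrictPushforwardPullback i f M q g h hle
    have h1 := isIso_fromTildeΓ_pullback f q M _ rfl
    have h2 := isIso_fromTildeΓ_pushforward q ((Scheme.Modules.pullback (Spec.map q ≫ f)).obj M)
    rw [isIso_fromTildeΓ_iff] at h2 ⊢
    exact ObjectProperty.prop_of_iso _ (asIso (restrictPushforwardPullback i f M q g h)).symm h2
  · obtain ⟨I, -, h⟩ := exists_ideal_pullUnit i f
    exact Module.Finite.of_surjective (M := Γ(M.restrict f, ⊤))
      (appTopₗ ((restrictFunctor f).map ((pullbackPushforwardAdjunction i).unit.app M))) (h M).1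

section Coh

variable [IsLocallyNoetherian X]

lemma isCoherent_iff (M : X.Modules) : isCoherent X M ↔
    ∀ (A : CommRingCat.{u}) (f : Spec A ⟶ X) [IsOpenImmersion f], IsFiniteOnChart f M := by
  refine ⟨fun h A f _ => isFiniteOnChart_of_isCoherent h f, fun h => ?_⟩
  refine isCoherent_of_isFiniteOnChart fun x => ?_
  obtain ⟨A, f, hf, hx, -⟩ := Scheme.exists_affine_mem_range_and_range_subset
    (show x ∈ (⊤ : X.Opens) from trivial)
  exact ⟨A, f, hf, hx, h A f⟩

variable (X) in
lemma isCoherent_unit : isCoherent X (SheafOfModules.unit X.ringCatSheaf) :=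
  (isCoherent_iff _).2 fun _ f _ => isFiniteOnChart_unit f

lemma isCoherent_cokernel {M M' : X.Modules} (g : M ⟶ M') (h : isCoherent X M)
    (h' : isCoherent X M') : isCoherent X (cokernel g) :=
  (isCoherent_iff _).2 fun A f _ => ((isCoherent_iff M).1 h A f).cokernel g
    ((isCoherent_iff M').1 h' A f)

lemma isCoherent_biprod {M M' : X.Modules} (h : isCoherent X M)
    (h' : isCoherent X M') : isCoherent X (M ⊞ M') :=
  (isCoherent_iff _).2 fun A f _ => ((isCoherent_iff M).1 h A f).biprod
    ((isCoherent_iff M').1 h' A f)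

lemma isCoherent_pushforward_pullback {Z : Scheme.{u}} (i : Z ⟶ X) [IsClosedImmersion i]
    {M : X.Modules} (h : isCoherent X M) :
    isCoherent X ((pushforward i).obj ((Scheme.Modules.pullback i).obj M)) :=
  (isCoherent_iff _).2 fun A f _ => ((isCoherent_iff M).1 h A f).pushforward_pullback i

/-- On some affine open neighbourhood, a locally free sheaf is associated to a free module. -/
lemma IsLocallyFreeOfFiniteRank.exists_chart {F : X.Modules} (hF : IsLocallyFreeOfFiniteRank F)
    (x : X) : ∃ (A : CommRingCat.{u}) (f : Spec A ⟶ X) (_ : IsOpenImmersion f),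
      x ∈ f.opensRange ∧ IsFiniteOnChart f F ∧ Module.Free A Γ(F.restrict f, ⊤) := by
  obtain ⟨U, r, hx, ⟨e⟩⟩ := hF x
  obtain ⟨A, g, hg, ⟨y, hy⟩, -⟩ := Scheme.exists_affine_mem_range_and_range_subset
    (show (⟨x, hx⟩ : U) ∈ (⊤ : (U : Scheme.{u}).Opens) from trivial)
  let I := ULift.{u} (Fin r)
  have hp : PreservesColimitsOfSize.{u, u} (restrictFunctor g) := inferInstance
  let e₁ : F.restrict (g ≫ U.ι) ≅ (F.restrict U.ι).restrict g :=
    (restrictFunctorComp g U.ι).app F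
  let e₂ : (restrictFunctor g).obj (SheafOfModules.free (R := U.toScheme.ringCatSheaf) I) ≅
      SheafOfModules.free (R := (Spec A).ringCatSheaf) I :=
    (@SheafOfModules.mapFreeIso _ _ _ _ _ _ _ _ _ _ _ _ (restrictFunctor g) I hp.preservesColimitsOfShape
      (restrictUnitIso g).symm).symm
  let t : (SheafOfModules.free (R := (Spec A).ringCatSheaf) I : (Spec A).Modules) ≅
    tilde (ModuleCat.of A (I →₀ A)) := (tildeFinsupp I).symm
  let e' := e₁ ≪≫ (restrictFunctor g).mapIso e ≪≫ e₂ ≪≫ t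
  refine ⟨A, g ≫ U.ι, inferInstance, ⟨y, by rw [Scheme.Hom.comp_apply, hy]; rfl⟩,
    IsFiniteOnChart.of_iso e' inferInstance (finite_tilde _), ?_⟩
  have hfree : Module.Free A Γ(tilde (ModuleCat.of A (I →₀ A)), ⊤) :=
    Module.Free.of_equiv (tilde.isoTop (ModuleCat.of A (I →₀ A))).toLinearEquiv
  exact Module.Free.of_equiv (LinearEquiv.ofLinearMap (appTopₗ e'.inv) (appTopₗ e'.hom)
    (LinearMap.ext fun x => congr(($(e'.hom_inv_id).app ⊤) x))
    (LinearMap.ext fun x => congr(($(e'.inv_hom_id).app ⊤) x)))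

lemma IsLocallyFreeOfFiniteRank.isCoherent {F : X.Modules} (hF : IsLocallyFreeOfFiniteRank F) :
    isCoherent X F :=
  isCoherent_of_isFiniteOnChart fun x => by
    obtain ⟨A, f, hf, hx, h, -⟩ := hF.exists_chart x
    exact ⟨A, f, hf, hx, h⟩

end Coh

end Closure

end

/-! ### Kan extension from coherent sheaves as a filtered colimit -/

section

section Filtered

variable {X : Scheme.{u}}

section

variable [IsLocallyNoetherian X]

/-- Biproducts give upper bounds, and the cokernel of the difference of two parallel morphisms
equalizes them. Both stay coherent and keep a map to `Y`. -/
instance isFiltered_costructuredArrow (Y : X.Modules) : IsFiltered (CostructuredArrow (Coh.ι X) Y) where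
  nonempty := ⟨CostructuredArrow.mk (Y := (⟨_, isCoherent_unit X⟩ : Coh X)) 0⟩
  cocone_objs a b := by
    let c : Coh X := ⟨a.left.obj ⊞ b.left.obj, isCoherent_biprod a.left.2 b.left.2⟩
    refine ⟨CostructuredArrow.mk (S := Coh.ι X) (Y := c) (biprod.desc a.hom b.hom),
      CostructuredArrow.homMk (ObjectProperty.homMk (biprod.inl : a.left.obj ⟶ _)) ?_,
      CostructuredArrow.homMk (ObjectProperty.homMk (biprod.inr : b.left.obj ⟶ _)) ?_, trivial⟩
    · exact biprod.inl_desc _ _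
    · exact biprod.inr_desc _ _
  cocone_maps a b p q := by
    let v : a.left.obj ⟶ b.left.obj := p.left.hom - q.left.hom
    let c : Coh X := ⟨cokernel v, isCoherent_cokernel v a.left.2 b.left.2⟩
    have hv : v ≫ b.hom = 0 := by
      rw [Preadditive.sub_comp, sub_eq_zero]
      exact (CostructuredArrow.w p).trans (CostructuredArrow.w q).symm
    refine ⟨CostructuredArrow.mk (S := Coh.ι X) (Y := c) (cokernel.desc v b.hom hv),
      CostructuredArrow.homMk (ObjectProperty.homMk (cokernel.π v)) ?_, ?_⟩
    · exact cokernel.π_desc v b.hom hv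
    · refine CostructuredArrow.hom_ext _ _ (ObjectProperty.hom_ext _ ?_)
      have h := cokernel.condition v
      rw [Preadditive.sub_comp, sub_eq_zero] at h
      exact h

end

variable (P : Coh X ⥤ AddCommGrpCat.{u + 1})

/-- The element of the left Kan extension of `P` at `Y` represented by an element of `P G` and a
morphism `G ⟶ Y`. -/
def lanMk {G : Coh X} {Y : X.Modules} (g : G.obj ⟶ Y) : P.obj G →+ ((Coh.ι X).lan.obj P).obj Y :=
  (((Coh.ι X).lanUnit.app P).app G ≫ ((Coh.ι X).lan.obj P).map g).hom

variable {P}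

lemma lanMk_map {G G' : Coh X} {Y : X.Modules} (u : G ⟶ G') (g : G'.obj ⟶ Y) (s : P.obj G) :
    lanMk P g (P.map u s) = lanMk P (u.hom ≫ g) s := by
  have h := congr($(((Coh.ι X).lanUnit.app P).naturality u) s)
  have h' := congrArg (((Coh.ι X).lan.obj P).map g) h
  refine h'.trans ?_
  exact congr($(((Coh.ι X).lan.obj P).map_comp u.hom g) _).symm

lemma lan_map_lanMk {P' : Coh X ⥤ AddCommGrpCat.{u + 1}} (τ : P ⟶ P') {G : Coh X} {Y : X.Modules}
    (g : G.obj ⟶ Y) (s : P.obj G) :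
    ((Coh.ι X).lan.map τ).app Y (lanMk P g s) = lanMk P' g (τ.app G s) := by
  have h := congr($(((Coh.ι X).lan.map τ).naturality g) (((Coh.ι X).lanUnit.app P).app G s))
  refine h.trans ?_
  have h' := congr(($((Coh.ι X).lanUnit.naturality τ)).app G s)
  exact congrArg (((Coh.ι X).lan.obj P').map g) h'.symm

lemma desc_lanMk (T : X.Modules ⥤ AddCommGrpCat.{u + 1}) (τ : P ⟶ Coh.ι X ⋙ T) {G : Coh X}
    {Y : X.Modules} (g : G.obj ⟶ Y) (s : P.obj G) :
    (Functor.descOfIsLeftKanExtension ((Coh.ι X).lan.obj P) ((Coh.ι X).lanUnit.app P) T τ).app Y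
      (lanMk P g s) = T.map g (τ.app G s) := by
  have h := congr($((Functor.descOfIsLeftKanExtension ((Coh.ι X).lan.obj P)
    ((Coh.ι X).lanUnit.app P) T τ).naturality g) (((Coh.ι X).lanUnit.app P).app G s))
  refine h.trans ?_
  exact congrArg (T.map g) congr($(Functor.descOfIsLeftKanExtension_fac_app
    ((Coh.ι X).lan.obj P) ((Coh.ι X).lanUnit.app P) T τ G) s)

/-- The inclusion of coherent sheaves is fully faithful, so Kan extension along it does not change
the values on them. -/
lemma bijective_lanMk_id (G : Coh X) : Function.Bijective (lanMk P (𝟙 G.obj)) := by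
  have h : IsIso (((Coh.ι X).lanUnit.app P).app G) := inferInstance
  have h' : lanMk P (𝟙 G.obj) = (((Coh.ι X).lanUnit.app P).app G).hom := by
    ext s
    exact congr($(((Coh.ι X).lan.obj P).map_id G.obj) _)
  rw [h']
  exact (ConcreteCategory.isIso_iff_bijective _).1 h

/-- The Kan extension is a colimit. -/
def isColimitLan (P : Coh X ⥤ AddCommGrpCat.{u + 1}) (Y : X.Modules) :
    IsColimit ((Functor.LeftExtension.mk _ ((Coh.ι X).lanUnit.app P)).coconeAt Y) :=
  (Coh.ι X).isPointwiseLeftKanExtensionOfIsLeftKanExtension _ ((Coh.ι X).lanUnit.app P) Y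

variable [IsLocallyNoetherian X]

instance preservesColimitsOfShape_forget (Y : X.Modules) :
    PreservesColimitsOfShape (CostructuredArrow (Coh.ι X) Y) (forget AddCommGrpCat.{u + 1}) := by
  -- Only the size of the index category is adjusted, to apply the commutation of the forgetful
  -- functor with small filtered colimits.
  let e : AsSmall.{u + 1} (CostructuredArrow (Coh.ι X) Y) ≌ CostructuredArrow (Coh.ι X) Y :=
    AsSmall.equiv.symm
  have : IsFiltered (AsSmall.{u + 1} (CostructuredArrow (Coh.ι X) Y)) :=
    IsFiltered.of_equivalence e.symm
  have : PreservesColimitsOfShape (AsSmall.{u + 1} (CostructuredArrow (Coh.ι X) Y))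
    (forget AddCommGrpCat.{u + 1}) := inferInstance
  exact preservesColimitsOfShape_of_equiv e _

lemma exists_lanMk_eq {Y : X.Modules} (z : ((Coh.ι X).lan.obj P).obj Y) :
    ∃ (G : Coh X) (g : G.obj ⟶ Y) (s : P.obj G), lanMk P g s = z := by
  obtain ⟨j, s, h⟩ := Concrete.isColimit_exists_rep _ (isColimitLan P Y) z
  exact ⟨j.left, j.hom, s, h⟩

lemma lanMk_eq_iff {Y : X.Modules} {G G' : Coh X} {g : G.obj ⟶ Y} {g' : G'.obj ⟶ Y} {s : P.obj G}
    {s' : P.obj G'} : lanMk P g s = lanMk P g' s' ↔ ∃ (H : Coh X) (h : H.obj ⟶ Y) (v : G ⟶ H)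
      (v' : G' ⟶ H), v.hom ≫ h = g ∧ v'.hom ≫ h = g' ∧ P.map v s = P.map v' s' := by
  constructor
  · intro h
    obtain ⟨k, p, q, e⟩ := (Concrete.isColimit_rep_eq_iff_exists _ (isColimitLan P Y)
      (i := CostructuredArrow.mk (S := Coh.ι X) g) (j := CostructuredArrow.mk (S := Coh.ι X) g')
      s s').1 h
    exact ⟨k.left, k.hom, p.left, q.left, CostructuredArrow.w p, CostructuredArrow.w q, e⟩
  · rintro ⟨H, h, v, v', rfl, rfl, e⟩
    rw [← lanMk_map, ← lanMk_map, e]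

end Filtered

end

/-! ### Components of adeles -/

section

section Unit
variable {X : Scheme.{u}}

variable (X) in
/-- The structure sheaf as a sheaf of modules. -/
abbrev unitModule : X.Modules := SheafOfModules.unit X.ringCatSheaf

variable (X) in
/-- The global section `1` of the structure sheaf. -/
def oneSection : Γ(unitModule X, ⊤) := (1 : Γ(X, ⊤))

lemma exists_app_oneSection {Y : X.Modules} (x : Γ(Y, ⊤)) :
    ∃ φ : unitModule X ⟶ Y, φ.app ⊤ (oneSection X) = x := by
  let s : SheafOfModules.sections Y :=
    ⟨fun U => Y.presheaf.map (homOfLE (le_top : U.unop ≤ ⊤)).op x, fun {U V} i => by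
      refine (congr($(Y.presheaf.map_comp (homOfLE (le_top : U.unop ≤ ⊤)).op i) x)).symm.trans ?_
      rfl⟩
  refine ⟨(SheafOfModules.unitHomEquiv Y).symm s, ?_⟩
  have h := congrArg (fun t => t.1 (op ⊤)) ((SheafOfModules.unitHomEquiv Y).apply_symm_apply s)
  refine h.trans ?_
  exact congr($(Y.presheaf.map_id (op ⊤)) x)

lemma unit_hom_ext {Y : X.Modules} {φ ψ : unitModule X ⟶ Y}
    (h : φ.app ⊤ (oneSection X) = ψ.app ⊤ (oneSection X)) : φ = ψ := by
  refine (SheafOfModules.unitHomEquiv Y).injective ?_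
  refine PresheafOfModules.sections_ext _ _ fun U => ?_
  have h1 := app_presheaf_map φ (le_top : U.unop ≤ ⊤) (oneSection X)
  have h2 := app_presheaf_map ψ (le_top : U.unop ≤ ⊤) (oneSection X)
  have h3 : (unitModule X).presheaf.map (homOfLE (le_top : U.unop ≤ ⊤)).op (oneSection X) =
      (1 : Γ(X, U.unop)) := map_one (X.presheaf.map (homOfLE (le_top : U.unop ≤ ⊤)).op).hom
  have h4 := h1.trans ((congrArg _ h).trans h2.symm)
  rw [h3] at h4
  exact h4

end Unit

section Limits

variable {C J : Type*} [Category* C] [Category* J] {D : J ⥤ C ⥤ AddCommGrpCat.{u + 1}} [HasLimit D]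
  {F : C} [PreservesLimit D ((evaluation C AddCommGrpCat.{u + 1}).obj F)]
  [PreservesLimit (D ⋙ (evaluation C AddCommGrpCat.{u + 1}).obj F) (forget AddCommGrpCat.{u + 1})]

lemma limit_obj_ext {a b : (limit D).obj F}
    (h : ∀ j, (limit.π D j).app F a = (limit.π D j).app F b) : a = b :=
  Concrete.isLimit_ext _ (isLimitOfPreserves ((evaluation _ _).obj F) (limit.isLimit D)) a b h

lemma exists_limit_obj (t : ∀ j, (D.obj j).obj F)
    (h : ∀ {i j : J} (φ : i ⟶ j), (D.map φ).app F (t i) = t j) :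
    ∃ a : (limit D).obj F, ∀ j, (limit.π D j).app F a = t j := by
  let hl := isLimitOfPreserves (forget AddCommGrpCat.{u + 1})
    (isLimitOfPreserves ((evaluation C AddCommGrpCat.{u + 1}).obj F) (limit.isLimit D))
  let s : ((D ⋙ (evaluation C AddCommGrpCat.{u + 1}).obj F) ⋙ forget AddCommGrpCat.{u + 1}).sections :=
    ⟨t, fun φ => h φ⟩
  refine ⟨(Types.isLimitEquivSections hl).symm s, fun j => ?_⟩
  exact congrArg (fun s => s.1 j) ((Types.isLimitEquivSections hl).apply_symm_apply s)

lemma map_eq_of_forall_map_succ {C : Type*} [Category* C] (D : ℕᵒᵖ ⥤ C ⥤ AddCommGrpCat.{u + 1})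
    {F : C} (t : ∀ n, (D.obj (op n)).obj F)
    (h : ∀ n, (D.map (homOfLE n.le_succ).op).app F (t (n + 1)) = t n) {i j : ℕᵒᵖ} (φ : i ⟶ j) :
    (D.map φ).app F (t i.unop) = t j.unop := by
  obtain ⟨m, rfl⟩ : ∃ m, i = op m := ⟨i.unop, rfl⟩
  obtain ⟨n, rfl⟩ : ∃ n, j = op n := ⟨j.unop, rfl⟩
  obtain ⟨k, rfl⟩ := Nat.exists_eq_add_of_le (leOfHom φ.unop)
  induction k with
  | zero =>
    obtain rfl : φ = 𝟙 _ := Subsingleton.elim _ _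
    exact congr(($(D.map_id (op n))).app F (t n))
  | succ k ih =>
    obtain rfl : φ = (homOfLE (n + k).le_succ).op ≫ (homOfLE (Nat.le_add_right n k)).op :=
      Subsingleton.elim _ _
    refine (congr(($(D.map_comp _ _)).app F (t (n + k + 1)))).trans ?_
    exact (congrArg _ (h (n + k))).trans (ih (homOfLE (Nat.le_add_right n k)).op)

end Limits

section Adeles

variable {X : Scheme.{u}}

/-- The component at a point `x` and a number `n` of adeles for a set of nonempty flags. -/
def adeleProj {p : ℕ} (K : Set (List X)) (x : X) (n : ℕ) (F : Coh X) :
    (cohAdeles X (p + 1) K).obj F →+ (adeles p (link x K)).obj ((trunc x n).obj F.obj) :=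
  ((Pi.π (fun x : X => completion x ((Coh.ι X).lan.obj (cohAdeles X p (link x K)))) x ≫
    limit.π (truncWith x (adeles p (link x K))) (op n)).app F).hom

variable {p q : ℕ} {K L : Set (List X)} {F G : Coh X}

lemma adeleProj_ext {a b : (cohAdeles X (p + 1) K).obj F}
    (h : ∀ x n, adeleProj K x n F a = adeleProj K x n F b) : a = b := by
  refine limit_obj_ext (C := Coh X)
    (D := Discrete.functor fun x : X => completion x ((Coh.ι X).lan.obj (cohAdeles X p (link x K))))
    fun x => ?_
  exact limit_obj_ext (C := Coh X) (D := truncWith x.as (adeles p (link x.as K)))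
    fun n => h x.as n.unop

lemma truncWith_map_succ (x : X) (T : X.Modules ⥤ AddCommGrpCat.{u + 1}) (n : ℕ) :
    ((truncWith x T).map (homOfLE n.le_succ).op).app F = T.map ((truncSucc x n).app F.obj) := by
  have h : (truncSystem x).map (homOfLE n.le_succ).op = truncSucc x n :=
    Functor.ofOpSequence_map_homOfLE_succ _ n
  exact congrArg (fun v => T.map (v.app F.obj)) h

lemma adeleProj_succ (a : (cohAdeles X (p + 1) K).obj F) (x : X) (n : ℕ) :
    (adeles p (link x K)).map ((truncSucc x n).app F.obj) (adeleProj K x (n + 1) F a) =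
      adeleProj K x n F a := by
  have h := limit.w (truncWith x (adeles p (link x K))) (homOfLE n.le_succ).op
  have h' := congr(($h).app F ((Pi.π (fun x : X => completion x ((Coh.ι X).lan.obj
    (cohAdeles X p (link x K)))) x).app F a))
  refine Eq.trans ?_ h'
  exact congr($((truncWith_map_succ x (adeles p (link x K)) n).symm) _)

lemma exists_adeleProj (t : ∀ x n, (adeles p (link x K)).obj ((trunc x n).obj F.obj))
    (h : ∀ x n, (adeles p (link x K)).map ((truncSucc x n).app F.obj) (t x (n + 1)) = t x n) :
    ∃ a : (cohAdeles X (p + 1) K).obj F, ∀ x n, adeleProj K x n F a = t x n := by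
  have key : ∀ x, ∃ a : (completion x ((Coh.ι X).lan.obj (cohAdeles X p (link x K)))).obj F,
      ∀ n, (limit.π (truncWith x (adeles p (link x K))) n).app F a = t x n.unop := by
    intro x
    refine exists_limit_obj (C := Coh X) (D := truncWith x (adeles p (link x K)))
      (fun n => t x n.unop) fun φ => ?_
    refine map_eq_of_forall_map_succ (truncWith x (adeles p (link x K))) (t x) (fun n => ?_) φ
    exact (congr($(truncWith_map_succ x (adeles p (link x K)) n) _)).trans (h x n)
  choose a ha using key
  obtain ⟨b, hb⟩ := exists_limit_obj (C := Coh X)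
    (D := Discrete.functor fun x : X => completion x ((Coh.ι X).lan.obj (cohAdeles X p (link x K))))
    (F := F) (fun x => a x.as) (by
      rintro ⟨i⟩ ⟨j⟩ φ
      obtain rfl : i = j := Discrete.eq_of_hom φ
      obtain rfl : φ = 𝟙 _ := Subsingleton.elim _ _
      exact congr(($((Discrete.functor fun x : X => completion x ((Coh.ι X).lan.obj
        (cohAdeles X p (link x K)))).map_id ⟨i⟩)).app F (a i)))
  exact ⟨b, fun x n => (congrArg _ (hb ⟨x⟩)).trans (ha x (op n))⟩

lemma adeleProj_map (φ : F ⟶ G) (a : (cohAdeles X (p + 1) K).obj F) (x : X) (n : ℕ) :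
    adeleProj K x n G ((cohAdeles X (p + 1) K).map φ a) =
      (adeles p (link x K)).map ((trunc x n).map φ.hom) (adeleProj K x n F a) :=
  congr($((Pi.π (fun x : X => completion x ((Coh.ι X).lan.obj (cohAdeles X p (link x K)))) x ≫
    limit.π (truncWith x (adeles p (link x K))) (op n)).naturality φ) a)

lemma adeleProj_keep (m : FaceMap q p) (h : ∀ l ∈ K, m.keep.face l ∈ L)
    (a : (cohAdeles X (q + 1) L).obj F) (x : X) (n : ℕ) :
    adeleProj K x n F ((cohBoundary m.keep L K h).app F a) =
      (boundary m (link x L) (link x K) fun l hl => h (x :: l) hl).app ((trunc x n).obj F.obj)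
        (adeleProj L x n F a) := by
  have h1 : cohBoundary m.keep L K h ≫
      Pi.π (fun x : X => completion x ((Coh.ι X).lan.obj (cohAdeles X p (link x K)))) x =
      Pi.π (fun x : X => completion x ((Coh.ι X).lan.obj (cohAdeles X q (link x L)))) x ≫
        completionMap x ((Coh.ι X).lan.map
          (cohBoundary m (link x L) (link x K) fun l hl => h (x :: l) hl)) :=
    Limits.Pi.map_π _ _
  have h2 : completionMap x ((Coh.ι X).lan.map
      (cohBoundary m (link x L) (link x K) fun l hl => h (x :: l) hl)) ≫
      limit.π (truncWith x (adeles p (link x K))) (op n) =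
      limit.π (truncWith x (adeles q (link x L))) (op n) ≫ _ := limMap_π _ _
  refine (congrArg ((limit.π (truncWith x (adeles p (link x K))) (op n)).app F)
    congr(($h1).app F a)).trans ?_
  exact congr(($h2).app F _)

lemma adeleProj_skip (m : FaceMap q p) (h : ∀ l ∈ K, m.skip.face l ∈ L)
    (a : (cohAdeles X q L).obj F) (x : X) (n : ℕ) :
    adeleProj K x n F ((cohBoundary m.skip L K h).app F a) =
      lanMk (cohAdeles X p (link x K)) ((truncUnit x n).app F.obj)
        ((cohBoundary m L (link x K) fun l hl => h (x :: l) hl).app F a) := by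
  have h1 : cohBoundary m.skip L K h ≫
      Pi.π (fun x : X => completion x ((Coh.ι X).lan.obj (cohAdeles X p (link x K)))) x = _ :=
    limit.lift_π _ _
  have h2 := congrArg (fun v => (v ≫ limit.π (truncWith x (adeles p (link x K))) (op n))) h1
  refine (congr(($h2).app F a)).trans ?_
  have h3 : toCompletion x (adeles p (link x K)) ≫
      limit.π (truncWith x (adeles p (link x K))) (op n) = _ := limit.lift_π _ _
  exact congr(($h3).app F _)

end Adeles

end

/-! ### Adeles for flags with at most one point -/

section

section ZeroAdeles

variable {X : Scheme.{u}} {K L : Set (List X)}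

/-- The global section that corresponds to an adele for the flag without points. -/
def zeroProj (h : [] ∈ K) (G : Coh X) : (cohAdeles X 0 K).obj G →+ Γ(G.obj, ⊤) :=
  AddEquiv.ulift.toAddMonoidHom.comp
    ((Pi.π (fun _ : PLift ([] ∈ K) => Coh.ι X ⋙ globalSections X) ⟨h⟩).app G).hom

lemma zeroProj_bijective (h : [] ∈ K) (G : Coh X) : Function.Bijective (zeroProj h G) := by
  constructor
  · intro a b hab
    refine limit_obj_ext (C := Coh X)
      (D := Discrete.functor fun _ : PLift ([] ∈ K) => Coh.ι X ⋙ globalSections X) fun j => ?_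
    exact ULift.down_injective hab
  · intro s
    obtain ⟨a, ha⟩ := exists_limit_obj (C := Coh X) (F := G)
      (D := Discrete.functor fun _ : PLift ([] ∈ K) => Coh.ι X ⋙ globalSections X)
      (fun _ => ULift.up s) (by
        intro i j φ
        obtain rfl : i = j := Discrete.ext (Subsingleton.elim _ _)
        obtain rfl : φ = 𝟙 _ := Subsingleton.elim _ _
        exact congr(($((Discrete.functor fun _ : PLift ([] ∈ K) =>
          Coh.ι X ⋙ globalSections X).map_id i)).app G (ULift.up s)))
    exact ⟨a, congrArg ULift.down (ha ⟨⟨h⟩⟩)⟩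

lemma zeroProj_map (h : [] ∈ K) {G G' : Coh X} (φ : G ⟶ G') (s : (cohAdeles X 0 K).obj G) :
    zeroProj h G' ((cohAdeles X 0 K).map φ s) = φ.hom.app ⊤ (zeroProj h G s) :=
  congrArg ULift.down (congr($((Pi.π (fun _ : PLift ([] ∈ K) =>
    Coh.ι X ⋙ globalSections X) ⟨h⟩).naturality φ) s))

/-- The global section that corresponds to an adele for the flag without points. -/
def zeroVal (h : [] ∈ K) (Y : X.Modules) : (adeles 0 K).obj Y →+ Γ(Y, ⊤) :=
  AddEquiv.ulift.toAddMonoidHom.comp ((adelesZeroMap K h).app Y).hom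

lemma zeroVal_lanMk (h : [] ∈ K) {G : Coh X} {Y : X.Modules} (g : G.obj ⟶ Y)
    (s : (cohAdeles X 0 K).obj G) : zeroVal h Y (lanMk _ g s) = g.app ⊤ (zeroProj h G s) :=
  congrArg ULift.down (desc_lanMk (globalSections X)
    (Pi.π (fun _ : PLift ([] ∈ K) => Coh.ι X ⋙ globalSections X) ⟨h⟩) g s)

lemma zeroVal_map (h : [] ∈ K) {Y Y' : X.Modules} (φ : Y ⟶ Y') (z : (adeles 0 K).obj Y) :
    zeroVal h Y' ((adeles 0 K).map φ z) = φ.app ⊤ (zeroVal h Y z) :=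
  congrArg ULift.down (congr($((adelesZeroMap K h).naturality φ) z))

lemma zeroProj_cohBoundary_nil (h : [] ∈ K) (h' : ∀ l ∈ K, FaceMap.nil.face l ∈ L) (G : Coh X)
    (s : (cohAdeles X 0 L).obj G) :
    zeroProj h G ((cohBoundary .nil L K h').app G s) = zeroProj (h' _ h) G s := by
  have h1 : cohBoundary .nil L K h' ≫ Pi.π (fun _ : PLift ([] ∈ K) =>
    Coh.ι X ⋙ globalSections X) ⟨h⟩ = _ := limit.lift_π _ _
  exact congrArg ULift.down (congr(($h1).app G s))

section

variable [IsLocallyNoetherian X]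

/-- Global sections commute with this colimit because a section of `Y` is a morphism from the
structure sheaf, which is coherent. A section of `G` that dies in `Y` is a morphism `φ` with `φ ≫ g
= 0`; it already dies in the cokernel of `φ`, which is coherent and through which `g` factors. -/
lemma zeroVal_bijective (h : [] ∈ K) (Y : X.Modules) : Function.Bijective (zeroVal h Y) := by
  constructor
  · rw [injective_iff_map_eq_zero]
    intro z hz
    obtain ⟨G, g, s, rfl⟩ := exists_lanMk_eq z
    rw [zeroVal_lanMk] at hz
    obtain ⟨φ, hφ⟩ := exists_app_oneSection (zeroProj h G s)
    have h0 : φ ≫ g = 0 := unit_hom_ext ((congrArg (g.app ⊤) hφ).trans hz)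
    let c : Coh X := ⟨cokernel φ, isCoherent_cokernel φ (isCoherent_unit X) G.2⟩
    let v : G ⟶ c := ObjectProperty.homMk (cokernel.π φ)
    have h1 : v.hom.app ⊤ (zeroProj h G s) = 0 := by
      rw [← hφ]
      exact congr(($(cokernel.condition φ)).app ⊤ (oneSection X))
    have h2 : (cohAdeles X 0 K).map v s = 0 :=
      (zeroProj_bijective h c).1 ((zeroProj_map h v s).trans (h1.trans (map_zero _).symm))
    have h3 := lanMk_map v (cokernel.desc φ g h0) s
    rw [h2, map_zero] at h3
    refine Eq.trans ?_ h3.symm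
    exact congrArg (fun t => lanMk (cohAdeles X 0 K) t s) (cokernel.π_desc φ g h0).symm
  · intro y
    obtain ⟨φ, hφ⟩ := exists_app_oneSection y
    obtain ⟨s, hs⟩ := (zeroProj_bijective h ⟨unitModule X, isCoherent_unit X⟩).2 (oneSection X)
    exact ⟨lanMk _ φ s, (zeroVal_lanMk h φ s).trans ((congrArg _ hs).trans hφ)⟩

lemma zeroVal_boundary_nil (h : [] ∈ K) (h' : ∀ l ∈ K, FaceMap.nil.face l ∈ L) (Y : X.Modules)
    (z : (adeles 0 L).obj Y) :
    zeroVal h Y ((boundary .nil L K h').app Y z) = zeroVal (h' _ h) Y z := by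
  obtain ⟨G, g, s, rfl⟩ := exists_lanMk_eq z
  refine (congrArg (zeroVal h Y) (lan_map_lanMk _ g s)).trans ?_
  refine (zeroVal_lanMk h g _).trans (Eq.trans ?_ (zeroVal_lanMk (h' _ h) g s).symm)
  rw [zeroProj_cohBoundary_nil]

lemma subsingleton_lan {P : Coh X ⥤ AddCommGrpCat.{u + 1}} (hP : ∀ G, Subsingleton (P.obj G))
    (Y : X.Modules) : Subsingleton (((Coh.ι X).lan.obj P).obj Y) := by
  refine subsingleton_of_forall_eq 0 fun z => ?_
  obtain ⟨G, g, s, rfl⟩ := exists_lanMk_eq z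
  exact (congrArg _ ((hP G).elim s 0)).trans (map_zero _)

/-- Induction on `p`, starting from an empty product. It disposes of the components at points that
begin no flag of the given set. -/
lemma subsingleton_cohAdeles {p : ℕ} (h : ∀ l ∈ K, l.length ≠ p) (G : Coh X) :
    Subsingleton ((cohAdeles X p K).obj G) := by
  induction p generalizing K G with
  | zero =>
    refine ⟨fun a b => limit_obj_ext (C := Coh X)
      (D := Discrete.functor fun _ : PLift ([] ∈ K) => Coh.ι X ⋙ globalSections X) fun j => ?_⟩
    exact absurd rfl (h _ j.as.down)
  | succ p ih =>
    refine ⟨fun a b => adeleProj_ext fun x n => ?_⟩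
    have hl : ∀ l ∈ link x K, l.length ≠ p := fun l hl hp => h _ hl (by simp [hp])
    exact (subsingleton_lan (fun G' => ih hl G') _).elim _ _

/-- The components of adeles for a set of flags with one point. -/
def oneVal {x : X} (h : [x] ∈ K) (n : ℕ) (F : Coh X) :
    (cohAdeles X 1 K).obj F →+ Γ((Scheme.Modules.pullback (nbhdι x n)).obj F.obj, ⊤) :=
  (zeroVal (K := link x K) h ((trunc x n).obj F.obj)).comp (adeleProj K x n F)

lemma component_lanMk {x : X} (h : [x] ∈ K) (n : ℕ) (F : Coh X) (a : (cohAdeles X 1 K).obj F) :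
    component K x n h F.obj (lanMk _ (𝟙 F.obj) a) = oneVal h n F a := by
  refine (congrArg ULift.down (desc_lanMk (trunc x n ⋙ globalSections X) _ (𝟙 F.obj) a)).trans ?_
  exact congrArg ULift.down (congr($((trunc x n ⋙ globalSections X).map_id F.obj) _))

lemma oneVal_ext {F : Coh X} {a b : (cohAdeles X 1 K).obj F}
    (h : ∀ (x : X) (hx : [x] ∈ K) (n : ℕ), oneVal hx n F a = oneVal hx n F b) : a = b := by
  refine adeleProj_ext fun x n => ?_
  by_cases hx : [x] ∈ K
  · exact (zeroVal_bijective (K := link x K) hx _).1 (h x hx n)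
  · have : ∀ l ∈ link x K, l.length ≠ 0 := fun l hl h0 => hx (by
      obtain rfl := List.length_eq_zero_iff.1 h0
      exact hl)
    exact (subsingleton_lan (subsingleton_cohAdeles this) _).elim _ _

/-- The transition map on sections over infinitesimal neighbourhoods. -/
abbrev truncSuccSections (x : X) (n : ℕ) (F : X.Modules) :
    Γ((Scheme.Modules.pullback (nbhdι x (n + 1))).obj F, ⊤) →+
      Γ((Scheme.Modules.pullback (nbhdι x n)).obj F, ⊤) :=
  (((truncSucc x n).app F).app ⊤).hom

lemma truncSuccSections_oneVal {x : X} (h : [x] ∈ K) (n : ℕ) (F : Coh X)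
    (a : (cohAdeles X 1 K).obj F) :
    truncSuccSections x n F.obj (oneVal h (n + 1) F a) = oneVal h n F a := by
  refine (zeroVal_map (K := link x K) h ((truncSucc x n).app F.obj) _).symm.trans ?_
  exact congrArg _ (adeleProj_succ a x n)

lemma exists_oneVal {F : Coh X}
    (t : ∀ (x : X) (_ : [x] ∈ K) (n : ℕ), Γ((Scheme.Modules.pullback (nbhdι x n)).obj F.obj, ⊤))
    (h : ∀ (x : X) (hx : [x] ∈ K) (n : ℕ),
      truncSuccSections x n F.obj (t x hx (n + 1)) = t x hx n) :
    ∃ a : (cohAdeles X 1 K).obj F, ∀ (x : X) (hx : [x] ∈ K) (n : ℕ), oneVal hx n F a = t x hx n := by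
  classical
  let e {x : X} (hx : [x] ∈ K) (n : ℕ) :=
    Equiv.ofBijective _ (zeroVal_bijective (K := link x K) hx ((trunc x n).obj F.obj))
  obtain ⟨a, ha⟩ := exists_adeleProj (p := 0) (K := K) (F := F)
    (fun x n => if hx : [x] ∈ K then (e hx n).symm (t x hx n) else 0) (by
      intro x n
      by_cases hx : [x] ∈ K
      · rw [dif_pos hx, dif_pos hx]
        refine (e hx n).injective ?_
        refine (zeroVal_map (K := link x K) hx ((truncSucc x n).app F.obj) _).trans ?_
        refine Eq.trans (congrArg _ ?_) ((h x hx n).trans ((e hx n).apply_symm_apply _).symm)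
        exact (e hx (n + 1)).apply_symm_apply _
      · rw [dif_neg hx, dif_neg hx, map_zero])
  refine ⟨a, fun x hx n => ?_⟩
  refine (congrArg (zeroVal (K := link x K) hx _) (ha x n)).trans ?_
  rw [dif_pos hx]
  exact (e hx n).apply_symm_apply _

lemma oneVal_map {x : X} (h : [x] ∈ K) (n : ℕ) {F G : Coh X} (φ : F ⟶ G)
    (a : (cohAdeles X 1 K).obj F) :
    oneVal h n G ((cohAdeles X 1 K).map φ a) =
      ((Scheme.Modules.pullback (nbhdι x n)).map φ.hom).app ⊤ (oneVal h n F a) :=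
  (congrArg _ (adeleProj_map φ a x n)).trans
    (zeroVal_map (K := link x K) h ((trunc x n).map φ.hom) _)

/-- The components of the boundary map that keeps the only point. -/
lemma oneVal_keep {x : X} (h : [x] ∈ K) (h' : ∀ l ∈ K, FaceMap.nil.keep.face l ∈ L) (n : ℕ)
    (F : Coh X) (a : (cohAdeles X 1 L).obj F) :
    oneVal h n F ((cohBoundary (.keep .nil) L K h').app F a) = oneVal (h' _ h) n F a :=
  (congrArg _ (adeleProj_keep .nil h' a x n)).trans
    (zeroVal_boundary_nil (K := link x K) h _ _ _)

/-- The components of the boundary map that skips the only point. -/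
lemma oneVal_skip {x : X} (h : [x] ∈ K) (h' : ∀ l ∈ K, FaceMap.nil.skip.face l ∈ L) (n : ℕ)
    (F : Coh X) (s : (cohAdeles X 0 L).obj F) :
    oneVal h n F ((cohBoundary (.skip .nil) L K h').app F s) =
      pullUnit (nbhdι x n) F.obj ⊤ (zeroProj (h' _ h) F s) := by
  refine (congrArg (zeroVal (K := link x K) h _) (adeleProj_skip .nil h' s x n)).trans ?_
  refine (zeroVal_lanMk (K := link x K) h _ _).trans ?_
  exact congrArg _ (zeroProj_cohBoundary_nil (K := link x K) h _ F s)

end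

end ZeroAdeles

end

/-! ### Witnesses for the equality of two adeles -/

section

section Flags

variable {X : Scheme.{u}}

lemma singleton_mem_flags {x : X} {i : ℕ} : [x] ∈ flags X [i] ↔ Order.coheight x = i := by
  simp [flags]

lemma triple_mem_flags {x y z : X} : [x, y, z] ∈ flags X [0, 1, 2] ↔
    Order.coheight x = 0 ∧ Order.coheight y = 1 ∧ Order.coheight z = 2 ∧ x ⤳ y ∧ y ⤳ z := by
  constructor
  · rintro ⟨h, h'⟩
    have h1 : [Order.coheight x, Order.coheight y, Order.coheight z] = [0, 1, 2] := h'
    simp only [List.cons.injEq, and_true] at h1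
    simp only [List.isChain_cons_cons] at h
    exact ⟨h1.1, h1.2.1, h1.2.2, h.1.1, h.2.1.1⟩
  · rintro ⟨h3, h4, h5, h1, h2⟩
    refine ⟨?_, show [Order.coheight x, Order.coheight y, Order.coheight z] = [0, 1, 2] by
      rw [h3, h4, h5]⟩
    simp only [List.isChain_cons_cons, List.isChain_singleton, and_true]
    refine ⟨⟨h1, ?_⟩, h2, ?_⟩
    · rintro rfl
      rw [h3] at h4
      exact absurd h4 (by decide)
    · rintro rfl
      rw [h4] at h5
      exact absurd h5 (by decide)

lemma length_of_mem_link_link {l : List X} {x y : X}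
    (h : l ∈ link y (link x (flags X [0, 1, 2]))) : ∃ z, l = [z] := by
  have := congrArg List.length (show (x :: y :: l).map _ = _ from h.2)
  exact List.length_eq_one_iff.1 (by simpa using this)

variable {Y Y' : Scheme.{u}} (g : Y' ⟶ Y) (f : Y ⟶ X) (f' : Y' ⟶ X) (h : g ≫ f = f')

lemma monadMap_app_top (F : X.Modules) (t : Γ((Scheme.Modules.pullback f).obj F, ⊤)) :
    ((monadMap (pullbackPushforwardAdjunction f) (pullbackPushforwardAdjunction f')
      (pushforwardIso g f f' h)).app F).app ⊤ t = pullbackSections g f f' h F t := by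
  have h1 := pushforwardIso_hom_app_app g f f' h ((Scheme.Modules.pullback f').obj F) ⊤
  refine (congr($h1 (pullbackSections g f f' h F t))).trans ?_
  exact congr($(((Scheme.Modules.pullback f').obj F).presheaf.map_id (op ⊤)) _)

lemma truncSuccSections_eq (x : X) (n : ℕ) (F : X.Modules)
    (t : Γ((Scheme.Modules.pullback (nbhdι x (n + 1))).obj F, ⊤)) :
    truncSuccSections x n F t = pullbackSections (nbhdSucc x n) _ _ (nbhdSucc_nbhdι x n) F t :=
  monadMap_app_top _ _ _ _ F t

end Flags

section Comparison

variable {X : Scheme.{u}} [IsLocallyNoetherian X]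

/-- In a filtered colimit, two elements at the same stage become equal along a single map `v`. With
`lanMk_eq_iff` one would get two maps, and naturality could not be applied to `a` and `b` in one
sheaf. -/
lemma lanMk_eq_iff' {P : Coh X ⥤ AddCommGrpCat.{u + 1}} {Y : X.Modules} {G : Coh X} {g : G.obj ⟶ Y}
    {s s' : P.obj G} : lanMk P g s = lanMk P g s' ↔ ∃ (H : Coh X) (h : H.obj ⟶ Y) (v : G ⟶ H),
      v.hom ≫ h = g ∧ P.map v s = P.map v s' := by
  constructor
  · intro h
    obtain ⟨k, p, e⟩ := (IsColimit.eq_iff' (isColimitLan P Y)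
      (i := CostructuredArrow.mk (S := Coh.ι X) g) s s').1 h
    exact ⟨k.left, k.hom, p.left, CostructuredArrow.w p, e⟩
  · rintro ⟨H, h, v, rfl, e⟩
    rw [← lanMk_map, ← lanMk_map, e]

/-- A section of a coherent sheaf that compares an adele for a set of curves, at the component
`(y, n)`, with an adele for a set of closed points. -/
structure Witness {F : Coh X} (a : (cohAdeles X 1 (flags X [1])).obj F)
    (b : (cohAdeles X 1 (flags X [2])).obj F) (y : X) (hy : [y] ∈ flags X [1]) (n : ℕ) where
  /-- the coherent sheaf -/
  sheaf : Coh X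
  /-- the map from the given sheaf -/
  fromSheaf : F ⟶ sheaf
  /-- the map to the truncation at the curve -/
  toTrunc : sheaf.obj ⟶ (trunc y n).obj F.obj
  comp_eq : fromSheaf.hom ≫ toTrunc = (truncUnit y n).app F.obj
  /-- the section -/
  sec : Γ(sheaf.obj, ⊤)
  toTrunc_sec : toTrunc.app ⊤ sec = oneVal hy n F a
  eval_sec : ∀ (z : X) (hz : [z] ∈ flags X [2]) (_ : y ⤳ z) (m : ℕ),
    pullUnit (nbhdι z m) sheaf.obj ⊤ sec =
      ((Scheme.Modules.pullback (nbhdι z m)).map fromSheaf.hom).app ⊤ (oneVal hz m F b)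

variable {F : Coh X} (a : (cohAdeles X 1 (flags X [1])).obj F)
    (b : (cohAdeles X 1 (flags X [2])).obj F) (x : X)

lemma face_one_mem (l : List X) (hl : l ∈ link x (flags X [0, 1, 2])) :
    (FaceMap.keep (.skip .nil)).face l ∈ flags X [1] := face_mem_flags_one (x :: l) hl

lemma face_two_mem (l : List X) (hl : l ∈ link x (flags X [0, 1, 2])) :
    (FaceMap.skip (.keep .nil)).face l ∈ flags X [2] := face_mem_flags_two (x :: l) hl

/-- At `(y, n)`, the witness represents both sides in the colimit by elements over the same coherent
sheaf: for `a` by the section it carries, for `b` by the image of `b` under `fromSheaf`. Their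
values at the closed points agree by `eval_sec`. -/
lemma boundary_eq_of_witness
    (h : ∀ (y : X) (hy : [y] ∈ flags X [1]) (n : ℕ), Nonempty (Witness a b y hy n)) :
    (cohBoundary (.keep (.skip .nil)) (flags X [1]) (link x (flags X [0, 1, 2]))
      (face_one_mem x)).app F a =
    (cohBoundary (.skip (.keep .nil)) (flags X [2]) (link x (flags X [0, 1, 2]))
      (face_two_mem x)).app F b := by
  refine adeleProj_ext fun y n => ?_
  -- If no flag passes through `x` and `y`, both sides lie in a zero group.
  by_cases hne : ∀ l ∈ link y (link x (flags X [0, 1, 2])), l.length ≠ 1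
  · exact (subsingleton_lan (subsingleton_cohAdeles hne) _).elim _ _
  push Not at hne
  obtain ⟨l, hl, -⟩ := hne
  obtain ⟨z, rfl⟩ := length_of_mem_link_link hl
  have hy : [y] ∈ flags X [1] := singleton_mem_flags.2 (triple_mem_flags.1 hl).2.1
  obtain ⟨W⟩ := h y hy n
  refine (adeleProj_keep (.skip .nil) (face_one_mem x) a y n).trans ?_
  refine Eq.trans ?_ (adeleProj_skip (.keep .nil) (face_two_mem x) b y n).symm
  obtain ⟨s, hs⟩ := (zeroProj_bijective (K := link y (flags X [1])) hy W.sheaf).2 W.sec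
  have h1 : adeleProj (flags X [1]) y n F a = lanMk _ W.toTrunc s := by
    refine (zeroVal_bijective (K := link y (flags X [1])) hy _).1 ?_
    refine Eq.trans W.toTrunc_sec.symm (Eq.trans ?_ (zeroVal_lanMk _ _ _).symm)
    exact congrArg _ hs.symm
  refine (congrArg _ h1).trans ((lan_map_lanMk _ _ _).trans ?_)
  rw [← W.comp_eq, ← lanMk_map]
  refine congrArg _ (oneVal_ext fun z hz m => ?_)
  have hz' : [z] ∈ flags X [2] := singleton_mem_flags.2 (triple_mem_flags.1 hz).2.2.1
  refine (oneVal_skip hz _ m _ s).trans ?_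
  refine Eq.trans ?_ (oneVal_map hz m _ _).symm
  refine Eq.trans ?_ (congrArg _ (oneVal_keep hz _ m F b).symm)
  exact (congrArg _ hs).trans (W.eval_sec z hz' (triple_mem_flags.1 hz).2.2.2.2 m)

variable {a b x}

/-- An equality in the colimit holds in some coherent `H` over the truncation, and a representative
of the component of `a`, moved to `H`, is the desired section. The point `x` is generic, so that
each curve with a closed point on it extends to a flag. -/
lemma exists_witness_of_boundary_eq (hx : Order.coheight x = 0) (hx' : ∀ y, x ⤳ y)
    (h : (cohBoundary (.keep (.skip .nil)) (flags X [1]) (link x (flags X [0, 1, 2]))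
      (face_one_mem x)).app F a =
    (cohBoundary (.skip (.keep .nil)) (flags X [2]) (link x (flags X [0, 1, 2]))
      (face_two_mem x)).app F b)
    (y : X) (hy : [y] ∈ flags X [1]) (n : ℕ) : Nonempty (Witness a b y hy n) := by
  have h1 := (adeleProj_keep (.skip .nil) (face_one_mem x) a y n).symm.trans
    ((congrArg (adeleProj _ y n F) h).trans (adeleProj_skip (.keep .nil) (face_two_mem x) b y n))
  obtain ⟨G, g, s, hs⟩ := exists_lanMk_eq (adeleProj (flags X [1]) y n F a)
  rw [← hs] at h1
  have h2 := (lan_map_lanMk _ _ _).symm.trans h1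
  obtain ⟨H, k, v, v', h3, h4, h5⟩ := lanMk_eq_iff.1 h2
  refine ⟨⟨H, v', k, h4, v.hom.app ⊤ (zeroProj (K := link y (flags X [1])) hy G s), ?_, ?_⟩⟩
  · refine Eq.trans ?_ (congrArg (zeroVal (K := link y (flags X [1])) hy _) hs)
    refine Eq.trans ?_ (zeroVal_lanMk (K := link y (flags X [1])) hy g s).symm
    rw [← h3]
    rfl
  · intro z hz hyz m
    have hz' : [z] ∈ link y (link x (flags X [0, 1, 2])) :=
      triple_mem_flags.2 ⟨hx, singleton_mem_flags.1 hy, singleton_mem_flags.1 hz, hx' y, hyz⟩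
    have h6 := congrArg (oneVal hz' m H) h5
    refine Eq.trans ?_ (h6.trans ((oneVal_map hz' m v' _).trans
      (congrArg _ (oneVal_keep hz' _ m F b))))
    refine Eq.trans ?_ ((oneVal_map hz' m v _).trans
      (congrArg _ (oneVal_skip hz' _ m G s))).symm
    exact (pullUnit_naturality (nbhdι z m) v.hom ⊤ _).symm

end Comparison

end

/-! ### Equality of images in the triple adelic group -/

section

section Intersection

variable {X : Scheme.{u}} [IsLocallyNoetherian X] {F : Coh X}
  {a : (cohAdeles X 1 (flags X [1])).obj F} {b : (cohAdeles X 1 (flags X [2])).obj F}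

/-- The adele of a coherent sheaf `F` given by an element of `cohAdeles`. -/
def toAdeles {p : ℕ} {K : Set (List X)} (F : Coh X) (a : (cohAdeles X p K).obj F) :
    (adeles p K).obj F.obj :=
  lanMk (cohAdeles X p K) (𝟙 F.obj) a

lemma toAdeles_bijective {p : ℕ} {K : Set (List X)} (F : Coh X) :
    Function.Bijective (toAdeles (p := p) (K := K) F) := bijective_lanMk_id F

variable (a b) in
lemma mapOne_toAdeles : mapOne F.obj (toAdeles F a) = toAdeles (p := 3) F
    ((cohBoundary (.skip (.keep (.skip .nil))) (flags X [1]) (flags X [0, 1, 2])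
      face_mem_flags_one).app F a) :=
  lan_map_lanMk _ _ _

variable (a b) in
lemma mapTwo_toAdeles : mapTwo F.obj (toAdeles F b) = toAdeles (p := 3) F
    ((cohBoundary (.skip (.skip (.keep .nil))) (flags X [2]) (flags X [0, 1, 2])
      face_mem_flags_two).app F b) :=
  lan_map_lanMk _ _ _

lemma mapOne_eq_mapTwo_of_witness
    (h : ∀ (y : X) (hy : [y] ∈ flags X [1]) (n : ℕ), Nonempty (Witness a b y hy n)) :
    mapOne F.obj (toAdeles F a) = mapTwo F.obj (toAdeles F b) := by
  refine (mapOne_toAdeles a).trans (Eq.trans ?_ (mapTwo_toAdeles b).symm)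
  refine congrArg _ (adeleProj_ext fun x n => ?_)
  refine (adeleProj_skip _ face_mem_flags_one a x n).trans
    (Eq.trans ?_ (adeleProj_skip _ face_mem_flags_two b x n).symm)
  exact congrArg _ (boundary_eq_of_witness a b x h)

/-- At the generic point, the two images live in a colimit over coherent sheaves mapping to a
truncation of `F`, so they agree in one such sheaf `G`. Naturality rewrites this as an equality for
the images of `a` and `b` in `G`. -/
lemma exists_witness_of_mapOne_eq_mapTwo {x : X} (hx : Order.coheight x = 0) (hx' : ∀ y, x ⤳ y)
    (h : mapOne F.obj (toAdeles F a) = mapTwo F.obj (toAdeles F b)) (n : ℕ) :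
    ∃ (G : Coh X) (g : F ⟶ G) (k : G.obj ⟶ (trunc x n).obj F.obj),
      g.hom ≫ k = (truncUnit x n).app F.obj ∧
      ∀ (y : X) (hy : [y] ∈ flags X [1]) (m : ℕ), Nonempty (Witness
        ((cohAdeles X 1 (flags X [1])).map g a) ((cohAdeles X 1 (flags X [2])).map g b) y hy m) := by
  have h1 := (toAdeles_bijective (p := 3) F).1
    ((mapOne_toAdeles a).symm.trans (h.trans (mapTwo_toAdeles b)))
  have h2 := (adeleProj_skip _ face_mem_flags_one a x n).symm.trans
    ((congrArg (adeleProj _ x n F) h1).trans (adeleProj_skip _ face_mem_flags_two b x n))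
  obtain ⟨G, k, g, hg, h3⟩ := lanMk_eq_iff'.1 h2
  refine ⟨G, g, k, hg, exists_witness_of_boundary_eq hx hx' ?_⟩
  exact (congr($((cohBoundary _ _ _ (face_one_mem x)).naturality g) a)).trans
    (h3.trans (congr($((cohBoundary _ _ _ (face_two_mem x)).naturality g) b)).symm)

end Intersection

end

/-! ### Krull's theorem and unmixedness on charts -/

section

section KrullIntersection

variable {A : Type*} [CommRing A] [IsNoetherianRing A] {N : Type*} [AddCommGroup N] [Module A N]
  [Module.Finite A N]

/-- A consequence of Krull's intersection theorem: submodules are determined by their images modulo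
the powers of the maximal ideals. -/
lemma mem_of_forall_mem_sup (L : Submodule A N) (x : N)
    (h : ∀ m : Ideal A, m.IsMaximal → ∀ n, x ∈ L ⊔ m ^ n • (⊤ : Submodule A N)) : x ∈ L := by
  -- With zero source, `exists_approximation` says that an element of `N ⧸ L` in all powers of all
  -- maximal ideals is zero.
  obtain ⟨σ, hσ, -⟩ := exists_approximation (0 : PUnit →ₗ[A] N ⧸ L) (L.mkQ x) (fun _ _ => 0)
    (fun _ _ _ _ _ => by rw [sub_self]; exact zero_mem _) (fun m hm n => by
      have h1 := Submodule.mem_map_of_mem (f := L.mkQ) (h m hm n)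
      rw [Submodule.map_sup, Submodule.map_smul'', Submodule.map_top, Submodule.range_mkQ,
        Submodule.mkQ_map_self, bot_sup_eq] at h1
      simpa using h1)
  exact (Submodule.Quotient.mk_eq_zero _).1 hσ.symm

end KrullIntersection

section MinimalPrimes

variable {A : Type u} [CommRing A] [IsDomain A]

lemma two_le_height {p q : Ideal A} [p.IsPrime] [q.IsPrime] (hq : q ≠ ⊥) (h : q < p) :
    2 ≤ p.height := by
  have h1 : (⊥ : Ideal A).height + 1 ≤ q.height := by
    have := Ideal.height_add_one_le_of_lt_of_isPrime (bot_lt_iff_ne_bot.2 hq)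
    exact this
  have h2 : q.height + 1 ≤ p.height := Ideal.height_add_one_le_of_lt_of_isPrime h
  rw [Ideal.height_bot, zero_add] at h1
  calc (2 : ℕ∞) = 1 + 1 := by norm_num
    _ ≤ q.height + 1 := by gcongr
    _ ≤ _ := h2

lemma height_eq_one_of_mem_minimalPrimes [IsNoetherianRing A] {h : A} (hh : h ≠ 0) {p : Ideal A}
    (hp : p ∈ (Ideal.span {h}).minimalPrimes) : p.height = 1 := by
  have := hp.isPrime
  refine le_antisymm (Ideal.height_le_one_of_isPrincipal_of_mem_minimalPrimes _ p hp) ?_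
  rw [Order.one_le_iff_ne_zero, Ne, Ideal.height_eq_zero_iff_eq_bot]
  rintro rfl
  exact hh (hp.1.2 (Ideal.mem_span_singleton_self h))

lemma mem_minimalPrimes_of_height_eq_one {h : A} (hh : h ≠ 0) {p : Ideal A} [hpp : p.IsPrime]
    (hp : p.height = 1) (hhp : h ∈ p) : p ∈ (Ideal.span {h}).minimalPrimes := by
  obtain ⟨q, hq, hqp⟩ := Ideal.exists_minimalPrimes_le ((Ideal.span_singleton_le_iff_mem p).2 hhp)
  obtain rfl | hlt := hqp.eq_or_lt
  · exact hq
  · have := hq.isPrime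
    have h2 := two_le_height (fun h0 : q = ⊥ => hh (by
      have := hq.1.2 (Ideal.mem_span_singleton_self h)
      rwa [h0] at this)) hlt
    rw [hp] at h2
    exact absurd h2 (by decide)

end MinimalPrimes

section ChartRing

lemma isDomain_of_chart {X : Scheme.{u}} {A : CommRingCat.{u}} (f : Spec A ⟶ X) [IsOpenImmersion f]
    [AlgebraicGeometry.IsIntegral X] [Nonempty (Spec A)] : IsDomain A := by
  have : AlgebraicGeometry.IsIntegral (Spec A) := isIntegral_of_isOpenImmersion f
  exact (affine_isIntegral_iff A).1 this

lemma isNoetherianRing_of_chart {X : Scheme.{u}} {A : CommRingCat.{u}} (f : Spec A ⟶ X)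
    [IsOpenImmersion f] [IsLocallyNoetherian X] : IsNoetherianRing A := by
  have : IsLocallyNoetherian (Spec A) := isLocallyNoetherian_of_isOpenImmersion f
  exact (isLocallyNoetherian_Spec (R := A)).1 inferInstance

lemma coheight_chart {X : Scheme.{u}} {A : CommRingCat.{u}} (f : Spec A ⟶ X) [IsOpenImmersion f]
    (y : Spec A) : Order.coheight (f y) = y.asIdeal.height := by
  rw [coheight_eq_of_isOpenImmersion f, ← idealHeight_eq_coheight A]

variable {A : CommRingCat.{u}} [IsDomain A] [IsNoetherianRing A] {N : Type*} [AddCommGroup N] [Module A N] [Module.Free A N] [Module.Finite A N]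

/-- Here regularity enters. A non-minimal associated prime would have height at least 2, so its
stalk has a prime element that does not generate the maximal ideal (`exists_prime_not_dvd`), and
`notMem_associatedPrimes` excludes it. -/
lemma mem_minimalPrimes_of_mem_associatedPrimes {X : Scheme.{u}} (f : Spec A ⟶ X)
    [IsOpenImmersion f] (hX : ∀ x : X, IsRegularLocalRing (X.presheaf.stalk x)) {h : A} (hh : h ≠ 0) {p : Ideal A}
    (hp : p ∈ associatedPrimes A (N ⧸ Ideal.span {h} • (⊤ : Submodule A N))) :
    p ∈ (Ideal.span {h}).minimalPrimes := by
  have hpp : p.IsPrime := hp.1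
  have hhp : h ∈ p := by
    obtain ⟨-, z, hz⟩ := isAssociatedPrime_iff.1 hp
    rw [hz, Submodule.mem_colon_singleton, Submodule.mem_bot]
    obtain ⟨z, rfl⟩ := Submodule.mkQ_surjective _ z
    refine (LinearMap.map_smul _ h z).symm.trans ?_
    exact (Submodule.Quotient.mk_eq_zero _).2
      (Submodule.smul_mem_smul (Ideal.mem_span_singleton_self h) Submodule.mem_top)
  obtain ⟨q, hq, hqp⟩ := Ideal.exists_minimalPrimes_le ((Ideal.span_singleton_le_iff_mem p).2 hhp)
  obtain rfl | hlt := hqp.eq_or_lt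
  · exact hq
  exfalso
  have := hq.isPrime
  have h2 := two_le_height (fun h0 : q = ⊥ => hh (by
    have := hq.1.2 (Ideal.mem_span_singleton_self h)
    rwa [h0] at this)) hlt
  let y : Spec A := ⟨p, hpp⟩
  have hR := hX (f y)
  let := (chartStalk f y).hom.toAlgebra
  have hloc : IsLocalization.AtPrime (X.presheaf.stalk (f y)) p := isLocalization_chartStalk f y
  have hdim := IsLocalization.AtPrime.ringKrullDim_eq_height p (X.presheaf.stalk (f y))
  obtain ⟨a, b, ha, ham, hbm, hab⟩ := exists_prime_not_dvd (R := X.presheaf.stalk (f y)) (by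
    rw [hdim]
    exact WithBot.coe_le_coe.2 h2)
  refine notMem_associatedPrimes (R := X.presheaf.stalk (f y)) (fun h0 => hh ?_) ha ham hbm hab hp
  exact IsLocalization.injective (X.presheaf.stalk (f y)) p.primeCompl_le_nonZeroDivisors
    (h0.trans (map_zero _).symm)

lemma mem_smul_of_forall_mem_minimalPrimes {X : Scheme.{u}} (f : Spec A ⟶ X)
    [IsOpenImmersion f] (hX : ∀ x : X, IsRegularLocalRing (X.presheaf.stalk x)) {h : A} (hh : h ≠ 0) (z : N)
    (hz : ∀ p ∈ (Ideal.span {h}).minimalPrimes,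
      ∃ s ∉ p, s • z ∈ Ideal.span {h} • (⊤ : Submodule A N)) :
    z ∈ Ideal.span {h} • (⊤ : Submodule A N) :=
  mem_smul_of_forall_isAssociatedPrime _ z fun p hp =>
    hz p (mem_minimalPrimes_of_mem_associatedPrimes f hX hh hp)

end ChartRing

section Sections

variable {X : Scheme.{u}}

lemma pullUnit_eq_zero_of_comp {Y Y' : Scheme.{u}} (g : Y' ⟶ Y) (f : Y ⟶ X) (f' : Y' ⟶ X)
    (h : g ≫ f = f') (M : X.Modules) (U : X.Opens) (x : Γ(M, U))
    (hx : pullUnit f M U x = 0) : pullUnit f' M U x = 0 := by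
  have h1 := baseChangeSections_pullUnit g f f' h M U x
  have h2 := h1.symm.trans ((congrArg _ hx).trans (map_zero _))
  exact (bijective_presheaf_map_of_eq _ (preimage_preimage_of_comp_eq h U).le
    (preimage_preimage_of_comp_eq h U).ge).1 (h2.trans (map_zero _).symm)

lemma pullUnit_eq_of_comp {Y Y' : Scheme.{u}} (g : Y' ⟶ Y) (f : Y ⟶ X) (f' : Y' ⟶ X)
    (h : g ≫ f = f') (M : X.Modules) (U : X.Opens) {x x' : Γ(M, U)}
    (hx : pullUnit f M U x = pullUnit f M U x') : pullUnit f' M U x = pullUnit f' M U x' := by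
  rw [← sub_eq_zero, ← map_sub] at hx ⊢
  exact pullUnit_eq_zero_of_comp g f f' h M U _ hx

lemma evalSection_eq_of_comp {Y Y' : Scheme.{u}} (g : Y' ⟶ Y) (f : Y ⟶ X) (f' : Y' ⟶ X)
    (h : g ≫ f = f') (M : X.Modules) (U : X.Opens) (hU : ⊤ ≤ f' ⁻¹ᵁ U) {x x' : Γ(M, U)}
    (hx : pullUnit f M U x = pullUnit f M U x') :
    evalSection f' M U hU x = evalSection f' M U hU x' :=
  congrArg (((Scheme.Modules.pullback f').obj M).presheaf.map (homOfLE hU).op)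
    (pullUnit_eq_of_comp g f f' h M U hx)

lemma pullUnit_eq_of_le (M : X.Modules) (U : X.Opens) {I J : X.IdealSheafData} (hIJ : I ≤ J)
    {x x' : Γ(M, U)} (hx : pullUnit I.subschemeι M U x = pullUnit I.subschemeι M U x') :
    pullUnit J.subschemeι M U x = pullUnit J.subschemeι M U x' :=
  pullUnit_eq_of_comp (Scheme.IdealSheafData.inclusion hIJ) _ _
    (Scheme.IdealSheafData.inclusion_subschemeι hIJ) M U hx

end Sections

section Semilinear

variable {X : Scheme.{u}} {B B' : CommRingCat.{u}} (ψ : B ⟶ B') (j : Spec B ⟶ X) (j' : Spec B' ⟶ X)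
  (h : Spec.map ψ ≫ j = j')

lemma pullbackSections_smul (F : X.Modules) (b : B)
    (s : Γ((Scheme.Modules.pullback j).obj F, ⊤)) :
    pullbackSections (Spec.map ψ) j j' h F (b • s) =
      ψ.hom b • (show Γ((Scheme.Modules.pullback j').obj F, ⊤) from
        pullbackSections (Spec.map ψ) j j' h F s) :=
  ((appTopₗ ((baseChange (Spec.map ψ) j j' h).app F)).map_smul b s).trans
    (pushforward_smul ψ _ ⊤ b _)

end Semilinear

section NbhdMap

variable {X : Scheme.{u}} {A : CommRingCat.{u}} (f : Spec A ⟶ X) [IsOpenImmersion f] (y : Spec A)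
  (F : X.Modules)

lemma truncSuccSections_nbhdMap (n : ℕ) (z : Γ(F.restrict f, ⊤)) :
    truncSuccSections (f y) n F (nbhdMap f y F (n + 1) z) = nbhdMap f y F n z := by
  refine (truncSuccSections_eq _ _ _ _).trans ?_
  refine (congrArg _ (nbhdMap_eq_evalSection f y F (n + 1) z)).trans ?_
  refine Eq.trans ?_ (nbhdMap_eq_evalSection f y F n z).symm
  exact pullbackSections_evalSection _ _ _ _ F _ _ _ z

lemma truncSuccSections_smul (n : ℕ) (a : A)
    (t : Γ((Scheme.Modules.pullback (specNbhd (f y) (n + 1))).obj F, ⊤)) :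
    truncSuccSections (f y) n F ((chartNbhd f y (n + 1)).hom a • t) =
      (chartNbhd f y n).hom a • (show Γ((Scheme.Modules.pullback (specNbhd (f y) n)).obj F, ⊤) from
        truncSuccSections (f y) n F t) := by
  refine (truncSuccSections_eq _ _ _ _).trans ?_
  refine (pullbackSections_smul (CommRingCat.ofHom (Ideal.Quotient.factor
    (Ideal.pow_le_pow_right n.le_succ))) (specNbhd (f y) (n + 1)) (specNbhd (f y) n)
    (nbhdSucc_nbhdι (f y) n) F ((chartNbhd f y (n + 1)).hom a) t).trans ?_
  exact congrArg _ (truncSuccSections_eq _ _ _ _).symm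

end NbhdMap

end

/-! ### Gluing, and uniqueness of compatible families -/

section

section Gluing

variable {X Z : Scheme.{u}} (i : Z ⟶ X) (M : Z.Modules)

lemma section_eq_zero_of_locally (t : Γ(M, ⊤))
    (h : ∀ x : X, ∃ U : X.Opens, x ∈ U ∧ M.presheaf.map (homOfLE (le_top (a := i ⁻¹ᵁ U))).op t = 0) :
    t = 0 := by
  choose U hU ht using h
  refine TopCat.Sheaf.eq_of_locally_eq' ⟨M.presheaf, M.isSheaf⟩ (fun x : X => i ⁻¹ᵁ U x) ⊤
    (fun x => homOfLE le_top) (fun z _ => Opens.mem_iSup.2 ⟨i z, hU _⟩) t 0 fun x => ?_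
  exact (ht x).trans (map_zero _).symm

lemma section_eq_of_locally (t t' : Γ(M, ⊤))
    (h : ∀ x : X, ∃ U : X.Opens, x ∈ U ∧ M.presheaf.map (homOfLE (le_top (a := i ⁻¹ᵁ U))).op t =
      M.presheaf.map (homOfLE (le_top (a := i ⁻¹ᵁ U))).op t') :
    t = t' := by
  rw [← sub_eq_zero]
  refine section_eq_zero_of_locally i M _ fun x => ?_
  obtain ⟨U, hU, h⟩ := h x
  exact ⟨U, hU, by rw [map_sub, h, sub_self]⟩

lemma exists_section_of_locally {ι : Type u} (U : ι → X.Opens) (hU : ∀ x : X, ∃ j, x ∈ U j)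
    (t : ∀ j, Γ(M, i ⁻¹ᵁ U j))
    (h : ∀ j k, ∀ x ∈ U j ⊓ U k, ∃ (W : X.Opens) (_ : x ∈ W) (h₁ : W ≤ U j) (h₂ : W ≤ U k),
      M.presheaf.map (homOfLE (show i ⁻¹ᵁ W ≤ i ⁻¹ᵁ U j from fun _ hx => h₁ hx)).op (t j) =
        M.presheaf.map (homOfLE (show i ⁻¹ᵁ W ≤ i ⁻¹ᵁ U k from fun _ hx => h₂ hx)).op (t k)) :
    ∃ s : Γ(M, ⊤), ∀ j, M.presheaf.map (homOfLE le_top).op s = t j := by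
  obtain ⟨s, hs, -⟩ := TopCat.Sheaf.existsUnique_gluing' ⟨M.presheaf, M.isSheaf⟩
    (fun j => i ⁻¹ᵁ U j) ⊤ (fun j => homOfLE le_top)
    (fun z _ => Opens.mem_iSup.2 (hU (i z))) t (fun j k => by
      refine TopCat.Sheaf.eq_of_locally_eq' ⟨M.presheaf, M.isSheaf⟩
        (fun x : {x : X // x ∈ U j ⊓ U k} => i ⁻¹ᵁ (h j k x.1 x.2).choose)
        (i ⁻¹ᵁ U j ⊓ i ⁻¹ᵁ U k)
        (fun x => homOfLE (y := i ⁻¹ᵁ U j ⊓ i ⁻¹ᵁ U k) fun z hz => ⟨(h j k x.1 x.2).choose_spec.choose_spec.choose hz,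
          (h j k x.1 x.2).choose_spec.choose_spec.choose_spec.choose hz⟩) ?_ _ _ ?_
      · exact fun z hz => Opens.mem_iSup.2 ⟨⟨i z, hz⟩, (h j k (i z) hz).choose_spec.choose⟩
      · intro x
        refine (presheaf_map_map M _ _ (t j)).trans (Eq.trans ?_ (presheaf_map_map M _ _ (t k)).symm)
        exact (h j k x.1 x.2).choose_spec.choose_spec.choose_spec.choose_spec)
  exact ⟨s, hs⟩

end Gluing

section LimitSections

variable {X : Scheme.{u}}

lemma exists_chart_le {x : X} {U : X.Opens} (hx : x ∈ U) :
    ∃ (A : CommRingCat.{u}) (f : Spec A ⟶ X) (_ : IsOpenImmersion f),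
      x ∈ f ''ᵁ ⊤ ∧ f ''ᵁ ⊤ ≤ U := by
  obtain ⟨A, f, hf, ⟨y, hy⟩, h⟩ := Scheme.exists_affine_mem_range_and_range_subset hx
  refine ⟨A, f, hf, ⟨y, trivial, hy⟩, ?_⟩
  rintro _ ⟨z, -, rfl⟩
  exact h ⟨z, rfl⟩

variable {M : X.Modules}
variable {s : ∀ I : {I : X.IdealSheafData // I ≠ ⊥}, closedSections M I.1}
  {A : CommRingCat.{u}} (f : Spec A ⟶ X) [IsOpenImmersion f] [Nonempty (Spec A)]

lemma map_eq_pullUnit_of_le (hs : s ∈ limitClosedSections M)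
    {I J : {I : X.IdealSheafData // I ≠ ⊥}} (h : I.1 ≤ J.1) (U : X.Opens)
    (τ : Γ(M, U)) (hτ : ((Scheme.Modules.pullback I.1.subschemeι).obj M).presheaf.map
      (homOfLE le_top).op (s I) = pullUnit I.1.subschemeι M U τ) :
    ((Scheme.Modules.pullback J.1.subschemeι).obj M).presheaf.map
      (homOfLE le_top).op (s J) = pullUnit J.1.subschemeι M U τ := by
  rw [← hs I J h]
  exact map_pullbackSections_eq _ _ _ _ M U (s I) τ hτ

variable [AlgebraicGeometry.IsIntegral X]

lemma exists_pullUnit_eq [IsIso (M.restrict f).fromTildeΓ] {I : X.IdealSheafData} (hI : I ≠ ⊥)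
    (t : closedSections M I) :
    ∃ σ : Γ(M.restrict f, ⊤), ((Scheme.Modules.pullback I.subschemeι).obj M).presheaf.map
      (homOfLE le_top).op t = pullUnit I.subschemeι M (f ''ᵁ ⊤) σ := by
  obtain ⟨I', -, h⟩ := exists_ideal_ne_bot_pullUnit hI f
  obtain ⟨σ, hσ⟩ := (h M).1 (((Scheme.Modules.pullback I.subschemeι).obj M).presheaf.map
      (homOfLE le_top).op t)
  exact ⟨σ, hσ.symm⟩

lemma iInf_finset_ne_bot {ι : Type*} (S : Finset ι) (J : ι → X.IdealSheafData)
    (hJ : ∀ j ∈ S, J j ≠ ⊥) {I : X.IdealSheafData} (hI : I ≠ ⊥) :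
    ∃ K : X.IdealSheafData, K ≠ ⊥ ∧ K ≤ I ∧ ∀ j ∈ S, K ≤ J j := by
  classical
  induction S using Finset.induction_on with
  | empty => exact ⟨I, hI, le_rfl, by simp⟩
  | insert j S _ ih =>
    obtain ⟨K, hK, hKI, hKS⟩ := ih fun k hk => hJ k (Finset.mem_insert_of_mem hk)
    refine ⟨K ⊓ J j, inf_ne_bot hK (hJ j (Finset.mem_insert_self _ _)), inf_le_left.trans hKI, ?_⟩
    intro k hk
    obtain rfl | hk := Finset.mem_insert.1 hk
    · exact inf_le_right
    · exact inf_le_left.trans (hKS k hk)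

variable [IsLocallyNoetherian X]

/-- A compatible family of sections that induces zero at the closed points vanishes. -/
lemma eq_zero_of_forall_closed (hX : IsRegularSurface X) (hM : isCoherent X M)
    (hs : s ∈ limitClosedSections M)
    (h0 : ∀ (x : X) (_ : [x] ∈ flags X [2]) (n : ℕ) (I : {I : X.IdealSheafData // I ≠ ⊥})
      (g : nbhd x n ⟶ I.1.subscheme) (hg : g ≫ I.1.subschemeι = nbhdι x n),
      pullbackSections g I.1.subschemeι (nbhdι x n) hg M (s I) = 0) : s = 0 := by
  funext I
  refine section_eq_zero_of_locally I.1.subschemeι _ (s I) fun x => ?_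
  obtain ⟨A, f, hf, hx, -⟩ := exists_chart_le (show x ∈ (⊤ : X.Opens) from trivial)
  refine ⟨f ''ᵁ ⊤, hx, ?_⟩
  have : Nonempty (Spec A) := ⟨hx.choose⟩
  have hfin := isFiniteOnChart_of_isCoherent hM f
  have := hfin.1
  have := hfin.2
  have := isNoetherianRing_of_chart f
  obtain ⟨σ, hσ⟩ := exists_pullUnit_eq f I.2 (s I)
  obtain ⟨I', -, hI'⟩ := exists_ideal_ne_bot_pullUnit I.2 f
  refine hσ.trans (((hI' M).2 σ).2 (mem_of_forall_mem_sup _ _ fun m hm n => ?_))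
  let y : Spec A := ⟨m, hm.isPrime⟩
  have := hX.jacobsonSpace
  have hy : Order.coheight (f y) = 2 := (hX.isClosed_iff _).1 (isClosed_of_isMaximal f y hm)
  -- `K` defines the union of the given subscheme and the neighbourhood of the closed point. A local
  -- lift `τ` of its section is congruent to `σ` modulo `I'` and lies in `m ^ n` times the module.
  let K : {I : X.IdealSheafData // I ≠ ⊥} := ⟨I.1 ⊓ (nbhdι (f y) n).ker,
    inf_ne_bot I.2 (ker_nbhdι_ne_bot _ (by rw [hy]; decide) n)⟩
  obtain ⟨τ, hτ⟩ := exists_pullUnit_eq f K.2 (s K)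
  have h1 := map_eq_pullUnit_of_le hs (I := K) (J := I) inf_le_left _ τ hτ
  have h2 : σ - τ ∈ I' • (⊤ : Submodule A Γ(M.restrict f, ⊤)) := by
    rw [← (hI' M).2]
    exact (map_sub (pullUnit I.1.subschemeι M (f ''ᵁ ⊤)) _ _).trans
      (sub_eq_zero.2 (hσ.symm.trans h1))
  obtain ⟨g, hg⟩ := exists_lift_nbhdι (x := f y) (n := n) (I := K.1) inf_le_right
  have h3 := pullbackSections_eq_evalSection g _ _ hg M (f ''ᵁ ⊤) (top_le_preimage_nbhdι f y n)
    (s K) τ hτ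
  rw [h0 (f y) (singleton_mem_flags.2 hy) n K g hg] at h3
  have h4 : τ ∈ m ^ n • (⊤ : Submodule A Γ(M.restrict f, ⊤)) :=
    (nbhdMap_eq_zero_iff_of_isMaximal f y M hm n τ).1
      ((nbhdMap_eq_evalSection f y M n τ).trans h3.symm)
  have := Submodule.add_mem_sup h2 h4
  rwa [sub_add_cancel] at this

/-- A compatible family of sections that induces zero at the curves vanishes. -/
lemma eq_zero_of_forall_curve (hX : IsRegularSurface X) (hM : IsLocallyFreeOfFiniteRank M)
    (hs : s ∈ limitClosedSections M)
    (h0 : ∀ (x : X) (_ : [x] ∈ flags X [1]) (n : ℕ) (I : {I : X.IdealSheafData // I ≠ ⊥})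
      (g : nbhd x n ⟶ I.1.subscheme) (hg : g ≫ I.1.subschemeι = nbhdι x n),
      pullbackSections g I.1.subschemeι (nbhdι x n) hg M (s I) = 0) : s = 0 := by
  funext I
  refine section_eq_zero_of_locally I.1.subschemeι _ (s I) fun x => ?_
  obtain ⟨A, f, hf, ⟨z, hz⟩, hfin, hfree⟩ := hM.exists_chart x
  refine ⟨f ''ᵁ ⊤, ⟨z, trivial, hz⟩, ?_⟩
  have : Nonempty (Spec A) := ⟨z⟩
  have := hfin.1
  have := hfin.2
  have := isNoetherianRing_of_chart f
  have := isDomain_of_chart f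
  obtain ⟨I', hI'0, hI'⟩ := exists_ideal_ne_bot_pullUnit I.2 f
  obtain ⟨h, hhI, hh⟩ := Submodule.exists_mem_ne_zero_of_ne_bot hI'0
  -- For each curve in the divisor of `h`, an order of vanishing that forces local divisibility by
  -- `h`.
  have hn : ∀ p ∈ (Ideal.span {h}).minimalPrimes, ∃ n : ℕ, ∀ z : Γ(M.restrict f, ⊤),
      (∃ s ∉ p, s • z ∈ p ^ n • (⊤ : Submodule A Γ(M.restrict f, ⊤))) →
      ∃ s ∉ p, s • z ∈ Ideal.span {h} • (⊤ : Submodule A Γ(M.restrict f, ⊤)) := by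
    intro p hp
    obtain ⟨n, hn⟩ := exists_forall_smul_mem_of_mem_minimalPrimes
      (LinearMap.id (R := A) (M := Γ(M.restrict f, ⊤))) Function.injective_id h p hp
    exact ⟨n, hn n le_rfl⟩
  choose! n hn using hn
  have hfinite : (Ideal.span {h}).minimalPrimes.Finite :=
    Ideal.finite_minimalPrimes_of_isNoetherianRing A _
  let y (p : (Ideal.span {h}).minimalPrimes) : Spec A := ⟨p.1, p.2.isPrime⟩
  have hy (p) : Order.coheight (f (y p)) = 1 := by
    rw [coheight_chart]
    exact height_eq_one_of_mem_minimalPrimes hh p.2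
  have := hfinite.to_subtype
  have := Fintype.ofFinite (Ideal.span {h}).minimalPrimes
  -- One proper closed subscheme contains the given one and all these neighbourhoods, so a single
  -- lift `τ` is tested at every minimal prime over `h`; unmixedness then makes it divisible by `h`.
  obtain ⟨K, hK, hKI, hKp⟩ := iInf_finset_ne_bot Finset.univ (fun p => (nbhdι (f (y p)) (n p)).ker)
    (fun p _ => ker_nbhdι_ne_bot _ (by rw [hy]; decide) _) I.2
  obtain ⟨τ, hτ⟩ := exists_pullUnit_eq f hK (s ⟨K, hK⟩)
  refine (map_eq_pullUnit_of_le hs (I := ⟨K, hK⟩) (J := I) hKI _ τ hτ).trans (((hI' M).2 τ).2 ?_)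
  refine Submodule.smul_mono_left ((Ideal.span_singleton_le_iff_mem _).2 hhI)
    (mem_smul_of_forall_mem_minimalPrimes f hX.isRegularLocalRing hh τ fun p hp => hn p hp τ ?_)
  obtain ⟨g, hg⟩ := exists_lift_nbhdι (hKp ⟨p, hp⟩ (Finset.mem_univ _))
  have h3 := pullbackSections_eq_evalSection g _ _ hg M (f ''ᵁ ⊤)
    (top_le_preimage_nbhdι f (y ⟨p, hp⟩) (n p)) (s ⟨K, hK⟩) τ hτ
  rw [h0 _ (singleton_mem_flags.2 (hy _)) _ ⟨K, hK⟩ g hg] at h3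
  exact (nbhdMap_eq_zero_iff f (y ⟨p, hp⟩) M (n p) τ).1
    ((nbhdMap_eq_evalSection f (y ⟨p, hp⟩) M (n p) τ).trans h3.symm)

end LimitSections

end

/-! ### Adeles induced by compatible families -/

section

section InducedAdeles

variable {X : Scheme.{u}}

lemma ker_nbhdι_mono (x : X) (n : ℕ) : (nbhdι x (n + 1)).ker ≤ (nbhdι x n).ker := by
  rw [← nbhdSucc_nbhdι x n]
  exact (nbhdSucc x n).le_ker_comp (nbhdι x (n + 1))

lemma evalSection_top {Y : Scheme.{u}} (f : Y ⟶ X) (M : X.Modules) (x : Γ(M, ⊤)) :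
    evalSection f M ⊤ le_rfl x = pullUnit f M ⊤ x :=
  congr($(((Scheme.Modules.pullback f).obj M).presheaf.map_id (op ⊤)) (pullUnit f M ⊤ x))

lemma pullUnit_eq_of_map_eq {Y : Scheme.{u}} (f : Y ⟶ X) {M N : X.Modules} (φ : M ⟶ N)
    {U : X.Opens} (hU : ⊤ ≤ f ⁻¹ᵁ U) (t : Γ(N, ⊤)) (τ : Γ(M, U))
    (h : N.presheaf.map (homOfLE le_top).op t = φ.app U τ) :
    pullUnit f N ⊤ t = ((Scheme.Modules.pullback f).map φ).app ⊤ (evalSection f M U hU τ) := by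
  rw [evalSection_naturality, ← h, evalSection_map f N le_top le_rfl hU, evalSection_top]

variable [AlgebraicGeometry.IsIntegral X]

/-- Near every point, the sections over a closed subscheme come from sections over `X`. -/
lemma exists_local_pullUnit_eq {M : X.Modules} (hM : isCoherent X M) (x : X) {I : X.IdealSheafData}
    (hI : I ≠ ⊥) (t : closedSections M I) : ∃ (U : X.Opens) (_ : x ∈ U)
    (_ : ∀ n, ⊤ ≤ nbhdι x n ⁻¹ᵁ U) (τ : Γ(M, U)),
    ((Scheme.Modules.pullback I.subschemeι).obj M).presheaf.map (homOfLE le_top).op t =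
      pullUnit I.subschemeι M U τ := by
  obtain ⟨A, f, hf, hx, -⟩ := exists_chart_le (show x ∈ (⊤ : X.Opens) from trivial)
  obtain ⟨y, -, rfl⟩ := hx
  have : Nonempty (Spec A) := ⟨y⟩
  have := (isFiniteOnChart_of_isCoherent hM f).1
  obtain ⟨σ, hσ⟩ := exists_pullUnit_eq f hI t
  exact ⟨f ''ᵁ ⊤, ⟨y, trivial, rfl⟩, fun n => top_le_preimage_nbhdι f y n, σ, hσ⟩

variable [IsLocallyNoetherian X] {M : X.Modules} {s : ∀ I : {I : X.IdealSheafData // I ≠ ⊥}, closedSections M I.1}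

lemma pullbackSections_eq_of_le (hM : isCoherent X M) (hs : s ∈ limitClosedSections M) {x : X}
    {n : ℕ} {I J : {I : X.IdealSheafData // I ≠ ⊥}} (h : I.1 ≤ J.1)
    (g : nbhd x n ⟶ I.1.subscheme) (hg : g ≫ I.1.subschemeι = nbhdι x n)
    (g' : nbhd x n ⟶ J.1.subscheme) (hg' : g' ≫ J.1.subschemeι = nbhdι x n) :
    pullbackSections g I.1.subschemeι (nbhdι x n) hg M (s I) =
      pullbackSections g' J.1.subschemeι (nbhdι x n) hg' M (s J) := by
  obtain ⟨U, hx, hU, τ, hτ⟩ := exists_local_pullUnit_eq hM x I.2 (s I)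
  refine (pullbackSections_eq_evalSection g _ _ hg M U (hU n) (s I) τ hτ).trans ?_
  exact (pullbackSections_eq_evalSection g' _ _ hg' M U (hU n) (s J) τ
    (map_eq_pullUnit_of_le hs h U τ hτ)).symm

/-- A compatible family of sections induces adeles for sets of points of positive codimension. -/
lemma exists_oneVal_eq_pullbackSections {F : Coh X} {K : Set (List X)}
    (hK : ∀ x : X, [x] ∈ K → Order.coheight x ≠ 0)
    {s : ∀ I : {I : X.IdealSheafData // I ≠ ⊥}, closedSections F.obj I.1}
    (hs : s ∈ limitClosedSections F.obj) :
    ∃ a : (cohAdeles X 1 K).obj F, ∀ (x : X) (hx : [x] ∈ K) (n : ℕ)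
      (I : {I : X.IdealSheafData // I ≠ ⊥}) (g : nbhd x n ⟶ I.1.subscheme)
      (hg : g ≫ I.1.subschemeι = nbhdι x n), oneVal hx n F a =
        pullbackSections g I.1.subschemeι (nbhdι x n) hg F.obj (s I) := by
  have key : ∀ (x : X) (_ : [x] ∈ K) (n : ℕ), ∃ t : Γ((Scheme.Modules.pullback (nbhdι x n)).obj F.obj, ⊤),
      ∀ (I : {I : X.IdealSheafData // I ≠ ⊥}) (g : nbhd x n ⟶ I.1.subscheme)
        (hg : g ≫ I.1.subschemeι = nbhdι x n),
        t = pullbackSections g I.1.subschemeι (nbhdι x n) hg F.obj (s I) := by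
    intro x hx n
    -- The scheme-theoretic image is the smallest closed subscheme containing the neighbourhood, so
    -- its section gives the same value as all others.
    let J : {I : X.IdealSheafData // I ≠ ⊥} := ⟨(nbhdι x n).ker, ker_nbhdι_ne_bot x (hK x hx) n⟩
    obtain ⟨γ, hγ⟩ := exists_lift_nbhdι (x := x) (n := n) (I := J.1) le_rfl
    exact ⟨_, fun I g hg => (pullbackSections_eq_of_le F.property hs (J := J)
      (le_ker_of_comp_eq g hg) g hg γ hγ).symm⟩
  choose t ht using key
  refine (exists_oneVal (F := F) (K := K) t fun x hx n => ?_).imp fun a ha x hx n I g hg =>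
    (ha x hx n).trans (ht x hx n I g hg)
  -- The image of the neighbourhood of order `n + 1` contains both neighbourhoods, so one local lift
  -- computes both components.
  let J : {I : X.IdealSheafData // I ≠ ⊥} :=
    ⟨(nbhdι x (n + 1)).ker, ker_nbhdι_ne_bot x (hK x hx) (n + 1)⟩
  obtain ⟨γ, hγ⟩ := exists_lift_nbhdι (x := x) (n := n + 1) (I := J.1) le_rfl
  obtain ⟨γ', hγ'⟩ := exists_lift_nbhdι (x := x) (n := n) (I := J.1) (ker_nbhdι_mono x n)
  obtain ⟨U, -, hU, τ, hτ⟩ := exists_local_pullUnit_eq F.property x J.2 (s J)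
  have h1 := (ht x hx (n + 1) J γ hγ).trans
    (pullbackSections_eq_evalSection γ _ _ hγ F.obj U (hU (n + 1)) (s J) τ hτ)
  have h2 := (ht x hx n J γ' hγ').trans
    (pullbackSections_eq_evalSection γ' _ _ hγ' F.obj U (hU n) (s J) τ hτ)
  rw [h1, h2, truncSuccSections_eq]
  exact pullbackSections_evalSection _ _ _ _ F.obj U _ (hU n) τ

/-- The adeles induced by a compatible family of sections have the same image. -/
lemma mapOne_eq_mapTwo_of_eq_pullbackSections {F : Coh X}
    {s : ∀ I : {I : X.IdealSheafData // I ≠ ⊥}, closedSections F.obj I.1}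
    (hs : s ∈ limitClosedSections F.obj) {a : (cohAdeles X 1 (flags X [1])).obj F}
    {b : (cohAdeles X 1 (flags X [2])).obj F}
    (ha : ∀ (x : X) (hx : [x] ∈ flags X [1]) (n : ℕ)
      (I : {I : X.IdealSheafData // I ≠ ⊥}) (g : nbhd x n ⟶ I.1.subscheme)
      (hg : g ≫ I.1.subschemeι = nbhdι x n), oneVal hx n F a =
        pullbackSections g I.1.subschemeι (nbhdι x n) hg F.obj (s I))
    (hb : ∀ (x : X) (hx : [x] ∈ flags X [2]) (n : ℕ)
      (I : {I : X.IdealSheafData // I ≠ ⊥}) (g : nbhd x n ⟶ I.1.subscheme)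
      (hg : g ≫ I.1.subschemeι = nbhdι x n), oneVal hx n F b =
        pullbackSections g I.1.subschemeι (nbhdι x n) hg F.obj (s I)) :
    mapOne F.obj (toAdeles F a) = mapTwo F.obj (toAdeles F b) := by
  refine mapOne_eq_mapTwo_of_witness fun y hy n => ?_
  have hy0 : Order.coheight y ≠ 0 := by rw [singleton_mem_flags.1 hy]; decide
  let I : {I : X.IdealSheafData // I ≠ ⊥} := ⟨(nbhdι y n).ker, ker_nbhdι_ne_bot y hy0 n⟩
  obtain ⟨g, hg⟩ := exists_lift_nbhdι (x := y) (n := n) (I := (nbhdι y n).ker) le_rfl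
  let i := I.1.subschemeι
  -- The witness is `i_* i^* F` with the section `s I`, where `i` embeds the scheme-theoretic image
  -- of the neighbourhood of `y`.
  refine ⟨⟨⟨_, isCoherent_pushforward_pullback i F.property⟩,
    ⟨(pullbackPushforwardAdjunction i).unit.app F.obj⟩,
    (monadMap (pullbackPushforwardAdjunction i) (pullbackPushforwardAdjunction (nbhdι y n))
      (pushforwardIso g i (nbhdι y n) hg)).app F.obj, ?_, s I, ?_, ?_⟩⟩
  · exact congr(($(unit_monadMap (pullbackPushforwardAdjunction i)
      (pullbackPushforwardAdjunction (nbhdι y n)) (pushforwardIso g i (nbhdι y n) hg))).app F.obj)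
  · exact (monadMap_app_top g i (nbhdι y n) hg F.obj (s I)).trans (ha y hy n I g hg).symm
  · intro z hz _ m
    -- A union again: near `z` one lift represents `s I` and also computes the component of `b`.
    let K : {I : X.IdealSheafData // I ≠ ⊥} := ⟨I.1 ⊓ (nbhdι z m).ker, inf_ne_bot I.2
      (ker_nbhdι_ne_bot z (by rw [singleton_mem_flags.1 hz]; decide) m)⟩
    obtain ⟨U, -, hU, τ, hτ⟩ := exists_local_pullUnit_eq F.property z K.2 (s K)
    have h1 := map_eq_pullUnit_of_le hs (I := K) (J := I) inf_le_left U τ hτ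
    obtain ⟨g', hg'⟩ := exists_lift_nbhdι (x := z) (n := m) (I := K.1) inf_le_right
    have h2 := (hb z hz m K g' hg').trans
      (pullbackSections_eq_evalSection g' _ _ hg' F.obj U (hU m) (s K) τ hτ)
    refine Eq.trans ?_ (congrArg _ h2).symm
    exact pullUnit_eq_of_map_eq (nbhdι z m) ((pullbackPushforwardAdjunction i).unit.app F.obj)
      (hU m) (s I) τ h1

end InducedAdeles

end

/-! ### Witnesses over a chart -/

section

section ChartHom

variable {X : Scheme.{u}} {A B : CommRingCat.{u}} (f : Spec A ⟶ X) [IsOpenImmersion f] (φ : A ⟶ B)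
  (j : Spec B ⟶ X) (h : Spec.map φ ≫ f = j) {M : X.Modules} {Y : (Spec B).Modules}
  (q : M ⟶ (pushforward j).obj Y)

/-- For an open immersion `f : Spec A ⟶ X`, the morphism from the restriction of `M` along `f` that
is given by a morphism from `M` to a direct image from `Spec B`. -/
def chartHom : M.restrict f ⟶ (pushforward (Spec.map φ)).obj Y :=
  ((restrictAdjunction f).homEquiv _ _).symm (q ≫ (pushforwardIso _ _ _ h).inv.app _)

lemma chartHom_app (hU : ⊤ ≤ j ⁻¹ᵁ f ''ᵁ ⊤) :
    (chartHom f φ j h q).app ⊤ = q.app (f ''ᵁ ⊤) ≫ Y.presheaf.map (homOfLE hU).op := by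
  rw [chartHom, Adjunction.homEquiv_counit, Functor.map_comp, Category.assoc, Hom.comp_app]
  refine congrArg (fun v => q.app (f ''ᵁ ⊤) ≫ v) ?_
  rw [Hom.comp_app]
  refine Eq.trans (congrArg₂ (· ≫ ·) (pushforwardIso_inv_app_app _ _ _ h _ (f ''ᵁ ⊤))
    (restrictAdjunction_counit_app_app _ _ _)) ?_
  exact (Y.presheaf.map_comp _ _).symm

end ChartHom

section ChartWitness

variable {X : Scheme.{u}} {A : CommRingCat.{u}} (f : Spec A ⟶ X) [IsOpenImmersion f]

/-- The map on sections over a chart given by a morphism of sheaves of modules. -/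
def chartSections {M N : X.Modules} (φ : M ⟶ N) : Γ(M.restrict f, ⊤) →ₗ[A] Γ(N.restrict f, ⊤) :=
  appTopₗ ((restrictFunctor f).map φ)

lemma nbhdMap_chartSections {M N : X.Modules} (φ : M ⟶ N) (y : Spec A) (n : ℕ)
    (z : Γ(M.restrict f, ⊤)) : nbhdMap f y N n (chartSections f φ z) =
      ((Scheme.Modules.pullback (nbhdι (f y) n)).map φ).app ⊤ (nbhdMap f y M n z) := by
  refine (nbhdMap_eq_evalSection f y N n _).trans ?_
  refine Eq.trans ?_ (congrArg _ (nbhdMap_eq_evalSection f y M n z).symm)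
  exact (evalSection_naturality (nbhdι (f y) n) φ (f ''ᵁ ⊤) _ z).symm

/-- The module of sections of `M` over an infinitesimal neighbourhood of a point of the chart. -/
abbrev nbhdModule (y : Spec A) (n : ℕ) (M : X.Modules) : Type u :=
  Γ((pushforward (Spec.map (chartNbhd f y n))).obj
    ((Scheme.Modules.pullback (specNbhd (f y) n)).obj M), ⊤)

lemma nbhdModule_smul (y : Spec A) (n : ℕ) (M : X.Modules) (a : A) (t : nbhdModule f y n M) :
    a • t = (show nbhdModule f y n M from (chartNbhd f y n).hom a •
      (show Γ((Scheme.Modules.pullback (specNbhd (f y) n)).obj M, ⊤) from t)) :=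
  pushforward_smul _ _ ⊤ a t

lemma nbhdModule_smul_eq_zero (y : Spec A) (n : ℕ) (M : X.Modules) {a : A}
    (ha : a ∈ y.asIdeal ^ n) (t : nbhdModule f y n M) : a • t = 0 := by
  refine (nbhdModule_smul f y n M a t).trans ?_
  have h : (chartNbhd f y n).hom a = 0 :=
    ((isQuotLoc_chartNbhd f y n).ker a).2 ⟨1, Submonoid.one_mem _, by rwa [one_mul]⟩
  rw [h]
  exact zero_smul _ (show Γ((Scheme.Modules.pullback (specNbhd (f y) n)).obj M, ⊤) from t)

variable [IsLocallyNoetherian X] {G : Coh X} {a : (cohAdeles X 1 (flags X [1])).obj G}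
  {b : (cohAdeles X 1 (flags X [2])).obj G} {y : Spec A} {hy : [f y] ∈ flags X [1]} {n : ℕ}

namespace Witness

variable (W : Witness a b (f y) hy n)

/-- The section over a chart given by the comparing section. -/
def chartSec : Γ(W.sheaf.obj.restrict f, ⊤) :=
  W.sheaf.obj.presheaf.map (homOfLE (le_top (a := f ''ᵁ ⊤))).op W.sec

/-- The map over a chart to the truncation at the curve. -/
def chartTrunc : Γ(W.sheaf.obj.restrict f, ⊤) →ₗ[A] nbhdModule f y n G.obj :=
  appTopₗ (chartHom f (chartNbhd f y n) (specNbhd (f y) n) (specMap_chartNbhd f y n) W.toTrunc)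

lemma chartTrunc_apply (z : Γ(W.sheaf.obj.restrict f, ⊤)) : W.chartTrunc f z =
    ((Scheme.Modules.pullback (nbhdι (f y) n)).obj G.obj).presheaf.map
      (homOfLE (top_le_preimage_nbhdι f y n)).op (W.toTrunc.app (f ''ᵁ ⊤) z) :=
  congr($(chartHom_app f (chartNbhd f y n) (specNbhd (f y) n) (specMap_chartNbhd f y n) W.toTrunc
    (top_le_preimage_nbhdι f y n)) z)

lemma chartTrunc_fromSheaf (z : Γ(G.obj.restrict f, ⊤)) :
    W.chartTrunc f (chartSections f W.fromSheaf.hom z) = nbhdMap f y G.obj n z := by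
  refine (W.chartTrunc_apply f _).trans ?_
  refine Eq.trans ?_ (nbhdMap_eq_evalSection f y G.obj n z).symm
  exact congrArg _ (congr(($(W.comp_eq)).app (f ''ᵁ ⊤) z))

lemma chartTrunc_chartSec : W.chartTrunc f (W.chartSec f) = oneVal hy n G a := by
  refine (W.chartTrunc_apply f _).trans ?_
  refine Eq.trans ?_ W.toTrunc_sec
  refine (congrArg _ (app_presheaf_map W.toTrunc (le_top (a := f ''ᵁ ⊤)) W.sec)).trans ?_
  refine (presheaf_map_map ((Scheme.Modules.pullback (nbhdι (f y) n)).obj G.obj)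
    (U := ⊤) (top_le_preimage_nbhdι f y n) le_top (W.toTrunc.app ⊤ W.sec)).trans ?_
  exact congr($(((Scheme.Modules.pullback (nbhdι (f y) n)).obj G.obj).presheaf.map_id (op ⊤)) _)

lemma nbhdMap_chartSec {x : Spec A} (hx : [f x] ∈ flags X [2]) (hyx : y.asIdeal ≤ x.asIdeal)
    (m : ℕ) : nbhdMap f x W.sheaf.obj m (W.chartSec f) =
      ((Scheme.Modules.pullback (nbhdι (f x) m)).map W.fromSheaf.hom).app ⊤ (oneVal hx m G b) := by
  refine Eq.trans ?_ (W.eval_sec (f x) hx ?_ m)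
  · refine (nbhdMap_eq_evalSection f x W.sheaf.obj m _).trans ?_
    refine (evalSection_map (nbhdι (f x) m) W.sheaf.obj le_top le_rfl _ W.sec).trans ?_
    exact evalSection_top _ _ _
  · exact ((PrimeSpectrum.le_iff_specializes y x).1 hyx).map f.continuous

end Witness

end ChartWitness

end

/-! ### Values of sections at curves and closed points -/

section

section Semilinear

variable {A B N N' P P' : Type*} [CommRing A] [CommRing B] [AddCommGroup N] [Module A N]
  [AddCommGroup N'] [Module A N'] [AddCommGroup P] [Module B P] [AddCommGroup P'] [Module B P']
  {φ : A →+* B} {p : Ideal A}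

/-- Up to an element outside `p`, `t` is some `c e`. Comparison in `P'` shows that a multiple of `e`
differs from an element of `L` by something that `d ∘ g` kills, and this is locally in `L`. With `g`
the map from `F` to a larger sheaf, congruences proved in the larger sheaf are brought back to `F`.
-/
lemma exists_smul_eq_of_comp (hp : p.IsPrime) {c : N →ₛₗ[φ] P} {d : N' →ₛₗ[φ] P'} (g : N →ₗ[A] N')
    (l : P →ₗ[B] P') (hl : ∀ z, l (c z) = d (g z)) (L : Submodule A N)
    (hn : ∀ z, d (g z) = 0 → ∃ s ∉ p, s • z ∈ L) (t : P) (ht : ∃ s ∉ p, ∃ z, φ s • t = c z)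
    (ht' : ∃ s ∉ p, ∃ z ∈ L, φ s • l t = d (g z)) : ∃ s ∉ p, ∃ z ∈ L, φ s • t = c z := by
  obtain ⟨s, hs, z, hz, h1⟩ := ht'
  obtain ⟨s', hs', e, h2⟩ := ht
  have h3 : d (g (s • e - s' • z)) = 0 := by
    rw [← hl, map_sub, map_smulₛₗ, map_smulₛₗ, map_sub, map_smul, map_smul, hl z, ← h1, ← h2,
      map_smul, smul_comm, sub_self]
  obtain ⟨r, hr, h4⟩ := hn _ h3
  refine ⟨r * (s * s'), hp.mul_notMem hr (hp.mul_notMem hs hs'), r • s • e, ?_, ?_⟩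
  · rw [smul_sub] at h4
    have := L.add_mem h4 (L.smul_mem r (L.smul_mem s' hz))
    rwa [sub_add_cancel] at this
  · rw [map_smulₛₗ, map_smulₛₗ, ← h2, map_mul, map_mul, mul_smul, mul_smul]

end Semilinear

section LocalSections

variable {X : Scheme.{u}} {A : CommRingCat.{u}} (f : Spec A ⟶ X) [IsOpenImmersion f]

lemma IsRegularSurface.chart_mem_flags_two_iff (hX : IsRegularSurface X) (x : Spec A) :
    [f x] ∈ flags X [2] ↔ x.asIdeal.IsMaximal := by
  have := hX.jacobsonSpace
  rw [singleton_mem_flags]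
  exact ⟨fun h => isMaximal_of_isClosed f x ((hX.isClosed_iff _).2 h),
    fun h => (hX.isClosed_iff _).1 (isClosed_of_isMaximal f x h)⟩

section

variable {M G : X.Modules} (y : Spec A) (n : ℕ) (g : M ⟶ G)

/-- If the values of a section at the generic point of a chart determine it, then so does
its image under a morphism through which the values are defined. -/
lemma chartSections_injective [AlgebraicGeometry.IsIntegral X] [Nonempty (Spec A)] [IsDomain A]
    [IsIso (M.restrict f).fromTildeΓ] [Module.Free A Γ(M.restrict f, ⊤)] (hy : y.asIdeal = ⊥)
    (k : G ⟶ (trunc (f y) 1).obj M) (hk : g ≫ k = (truncUnit (f y) 1).app M) :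
    Function.Injective (chartSections f g) := by
  rw [injective_iff_map_eq_zero]
  intro z hz
  have h1 : pullUnit (nbhdι (f y) 1) M (f ''ᵁ ⊤) z = 0 := by
    refine (congr(($hk).app (f ''ᵁ ⊤) z)).symm.trans ?_
    exact (congrArg (k.app (f ''ᵁ ⊤)) hz).trans (map_zero _)
  have h2 : nbhdMap f y M 1 z = 0 :=
    (nbhdMap_eq_evalSection f y M 1 z).trans ((congrArg (((Scheme.Modules.pullback
      (nbhdι (f y) 1)).obj M).presheaf.map (homOfLE (top_le_preimage_nbhdι f y 1)).op) h1).trans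
      (map_zero (((Scheme.Modules.pullback (nbhdι (f y) 1)).obj M).presheaf.map
        (homOfLE (top_le_preimage_nbhdι f y 1)).op).hom))
  obtain ⟨s, hs, h3⟩ := (nbhdMap_eq_zero_iff f y M 1 z).1 h2
  rw [hy, pow_one, Submodule.bot_smul, Submodule.mem_bot] at h3
  rw [hy, Submodule.mem_bot] at hs
  exact (smul_eq_zero.1 h3).resolve_left hs

lemma exists_smul_eq_nbhdMap_of_comp [IsIso (M.restrict f).fromTildeΓ]
    [IsIso (G.restrict f).fromTildeΓ] (L : Submodule A Γ(M.restrict f, ⊤))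
    (hn : ∀ z : Γ(M.restrict f, ⊤), (∃ s ∉ y.asIdeal, s • chartSections f g z ∈
      y.asIdeal ^ n • (⊤ : Submodule A Γ(G.restrict f, ⊤))) → ∃ s ∉ y.asIdeal, s • z ∈ L)
    (t : Γ((Scheme.Modules.pullback (specNbhd (f y) n)).obj M, ⊤))
    (ht : ∃ s ∉ y.asIdeal, ∃ z ∈ L, (chartNbhd f y n).hom s •
      (show Γ((Scheme.Modules.pullback (specNbhd (f y) n)).obj G, ⊤) from
        ((Scheme.Modules.pullback (nbhdι (f y) n)).map g).app ⊤ t) =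
      nbhdMap f y G n (chartSections f g z)) :
    ∃ s ∉ y.asIdeal, ∃ z ∈ L, (chartNbhd f y n).hom s • t = nbhdMap f y M n z := by
  exact exists_smul_eq_of_comp (isPrime_asIdeal A y) (c := nbhdMap f y M n)
    (d := nbhdMap f y G n) (chartSections f g)
    (appTopₗ ((Scheme.Modules.pullback (specNbhd (f y) n)).map g))
    (fun z => (nbhdMap_chartSections f g y n z).symm) L
    (fun z hz => hn z ((nbhdMap_eq_zero_iff f y G n _).1 hz)) t (exists_smul_eq_nbhdMap f y M n t) ht

end

section

variable [IsLocallyNoetherian X] {F : Coh X} {K : Set (List X)} (a : (cohAdeles X 1 K).obj F)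
  (y : Spec A) (hy : [f y] ∈ K)

lemma nbhdMap_eq_oneVal_of_le {m m' : ℕ} (h : m ≤ m') (z : Γ(F.obj.restrict f, ⊤))
    (hz : nbhdMap f y F.obj m' z = oneVal hy m' F a) : nbhdMap f y F.obj m z = oneVal hy m F a := by
  induction m', h using Nat.le_induction with
  | base => exact hz
  | succ n _ ih =>
    refine ih ?_
    refine (truncSuccSections_nbhdMap f y F.obj n z).symm.trans ?_
    exact (congrArg _ hz).trans (truncSuccSections_oneVal hy n F a)

/-- The transition maps lower the exponent. This is needed because the congruence is obtained at a
large exponent dictated by Artin–Rees. -/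
lemma exists_smul_eq_nbhdMap_of_le {m m' : ℕ} (h : m ≤ m') (σ : Γ(F.obj.restrict f, ⊤))
    (L : Submodule A Γ(F.obj.restrict f, ⊤))
    (hσ : ∃ s ∉ y.asIdeal, ∃ z ∈ L, (chartNbhd f y m').hom s •
      ((show Γ((Scheme.Modules.pullback (specNbhd (f y) m')).obj F.obj, ⊤) from
        oneVal hy m' F a) - nbhdMap f y F.obj m' σ) = nbhdMap f y F.obj m' z) :
    ∃ s ∉ y.asIdeal, ∃ z ∈ L, (chartNbhd f y m).hom s •
      ((show Γ((Scheme.Modules.pullback (specNbhd (f y) m)).obj F.obj, ⊤) from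
        oneVal hy m F a) - nbhdMap f y F.obj m σ) = nbhdMap f y F.obj m z := by
  induction m', h using Nat.le_induction with
  | base => exact hσ
  | succ n _ ih =>
    refine ih ?_
    obtain ⟨s, hs, z, hz, h1⟩ := hσ
    refine ⟨s, hs, z, hz, ?_⟩
    have h2 := congrArg (truncSuccSections (f y) n F.obj) h1
    refine Eq.trans ?_ (h2.trans (truncSuccSections_nbhdMap f y F.obj n z))
    refine Eq.trans ?_ (truncSuccSections_smul f y F.obj n s _).symm
    refine congrArg _ ?_
    refine Eq.trans ?_ (map_sub (truncSuccSections (f y) n F.obj) _ _).symm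
    exact congrArg₂ _ (truncSuccSections_oneVal hy n F a).symm
      (truncSuccSections_nbhdMap f y F.obj n σ).symm

/-- At closed points the components lift to sections over the chart by `nbhdMap_surjective`. The
family is indexed by all ideals to fit `exists_global_approximation`; its values at non-maximal ones
do not matter. -/
lemma exists_family_nbhdMap_eq (hX : IsRegularSurface X) [IsIso (F.obj.restrict f).fromTildeΓ]
    (b : (cohAdeles X 1 (flags X [2])).obj F) : ∃ β : Ideal A → ℕ → Γ(F.obj.restrict f, ⊤),
      ∀ (x : Spec A) (hx : [f x] ∈ flags X [2]) (m : ℕ),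
        nbhdMap f x F.obj m (β x.asIdeal m) = oneVal hx m F b := by
  classical
  have h (x : Spec A) (hx : [f x] ∈ flags X [2]) (m : ℕ) :
      ∃ z, nbhdMap f x F.obj m z = oneVal hx m F b :=
    nbhdMap_surjective f x F.obj ((hX.chart_mem_flags_two_iff f x).1 hx) m _
  choose γ hγ using h
  refine ⟨fun I m => if hI : I.IsMaximal then
    γ ⟨I, hI.isPrime⟩ ((hX.chart_mem_flags_two_iff f _).2 hI) m else 0, fun x hx m => ?_⟩
  dsimp only
  rw [dif_pos ((hX.chart_mem_flags_two_iff f x).1 hx)]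
  exact hγ x hx m

end

end LocalSections

end

/-! ### The local section induced by two adeles -/

section

section LocalSection

lemma sub_mem_of_nbhdMap_eq {X : Scheme.{u}} {A : CommRingCat.{u}}
    (f : Spec A ⟶ X) [IsOpenImmersion f] {M : X.Modules} [IsIso (M.restrict f).fromTildeΓ] {x : Spec A}
    (hx : x.asIdeal.IsMaximal) {m : ℕ} {z z' : Γ(M.restrict f, ⊤)}
    (h : nbhdMap f x M m z = nbhdMap f x M m z') :
    z - z' ∈ x.asIdeal ^ m • (⊤ : Submodule A Γ(M.restrict f, ⊤)) := by
  rw [← nbhdMap_eq_zero_iff_of_isMaximal f x M hx m, map_sub, h, sub_self]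

variable {X : Scheme.{u}} [AlgebraicGeometry.IsIntegral X] [IsLocallyNoetherian X]
  {A : CommRingCat.{u}} (f : Spec A ⟶ X) [IsOpenImmersion f] [Nonempty (Spec A)]

/-- Two adeles, for the curves and for the closed points, with the same image are both induced,
modulo `h`, by a section over a chart. -/
theorem exists_section_of_mapOne_eq_mapTwo (hX : IsRegularSurface X) {F : Coh X}
    {a : (cohAdeles X 1 (flags X [1])).obj F} {b : (cohAdeles X 1 (flags X [2])).obj F}
    (hab : mapOne F.obj (toAdeles F a) = mapTwo F.obj (toAdeles F b))
    [Module.Free A Γ(F.obj.restrict f, ⊤)] {h : A} (hh : h ≠ 0) (ν : ℕ) :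
    ∃ σ : Γ(F.obj.restrict f, ⊤),
      (∀ (x : Spec A) (hx : [f x] ∈ flags X [2]) (m : ℕ),
        ∃ z ∈ Ideal.span {h} • (⊤ : Submodule A Γ(F.obj.restrict f, ⊤)),
          nbhdMap f x F.obj m (σ + z) = oneVal hx m F b) ∧
      ∀ (y : Spec A) (hy : [f y] ∈ flags X [1]) (n : ℕ), n ≤ ν →
        (∀ z ∈ Ideal.span {h} • (⊤ : Submodule A Γ(F.obj.restrict f, ⊤)),
          nbhdMap f y F.obj n z = 0) →
        nbhdMap f y F.obj n σ = oneVal hy n F a := by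
  have := isNoetherianRing_of_chart f
  have := isDomain_of_chart f
  have hF := isFiniteOnChart_of_isCoherent F.property f
  have := hF.1
  have := hF.2
  have : AlgebraicGeometry.IsIntegral (Spec A) := isIntegral_of_isOpenImmersion f
  let η : Spec A := genericPoint (Spec A)
  have hη : η.asIdeal = ⊥ := congrArg PrimeSpectrum.asIdeal (genericPoint_eq_bot_of_affine A)
  have hη0 : Order.coheight (f η) = 0 := by rw [coheight_chart, hη, Ideal.height_bot]
  have hη1 : ∀ y, f η ⤳ y := fun y =>
    (genericPoint_eq_of_isOpenImmersion f) ▸ genericPoint_specializes y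
  -- Exponent 1 already gives the whole stalk at the generic point, whose maximal ideal is zero
  -- (exponent 0 would give nothing). Hence `F → G` is injective on the chart, as `Γ(F)` is
  -- torsion-free.
  obtain ⟨G, g, k, hk, hW⟩ := exists_witness_of_mapOne_eq_mapTwo hη0 hη1 hab 1
  have hG := isFiniteOnChart_of_isCoherent G.property f
  have := hG.1
  have := hG.2
  have hg := chartSections_injective f η g.hom hη k hk
  have : Finite (Ideal.span {h}).minimalPrimes :=
    (Ideal.finite_minimalPrimes_of_isNoetherianRing A _).to_subtype
  let y (i : (Ideal.span {h}).minimalPrimes) : Spec A := ⟨i.1, i.2.isPrime⟩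
  have hy (i) : [f (y i)] ∈ flags X [1] := by
    rw [singleton_mem_flags, coheight_chart]
    exact height_eq_one_of_mem_minimalPrimes hh i.2
  -- The exponent is taken large for Artin–Rees in `G`, and at least `ν` to control the values of
  -- `a` up to that order.
  have hn₀ (i : (Ideal.span {h}).minimalPrimes) : ∃ n, ν ≤ n ∧ ∀ z : Γ(F.obj.restrict f, ⊤),
      (∃ s ∉ i.1, s • chartSections f g.hom z ∈
        i.1 ^ n • (⊤ : Submodule A Γ(G.obj.restrict f, ⊤))) →
      ∃ s ∉ i.1, s • z ∈ Ideal.span {h} • (⊤ : Submodule A Γ(F.obj.restrict f, ⊤)) := by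
    obtain ⟨n, hn⟩ := exists_forall_smul_mem_of_mem_minimalPrimes
      (chartSections f g.hom) hg h i.1 i.2
    exact ⟨max ν n, le_max_left _ _, hn _ (le_max_right _ _)⟩
  choose n hνn hn using hn₀
  let W i := (hW (f (y i)) (hy i) (n i)).some
  have hH (i) := isFiniteOnChart_of_isCoherent (W i).sheaf.property f
  have hH1 (i) := (hH i).1
  have hH2 (i) := (hH i).2
  have hpr (i : (Ideal.span {h}).minimalPrimes) : i.1.IsPrime := i.2.isPrime
  obtain ⟨β, hβ⟩ := exists_family_nbhdMap_eq f hX b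
  -- The modules `H` belong to the witnesses at the curves in the divisor of `h`; the truncations
  -- `P` are those of `G`, not of `F`, because the witnesses live over `G`.
  obtain ⟨σ, h1, h2⟩ := exists_global_approximation h
    (fun i : (Ideal.span {h}).minimalPrimes => i.1)
    (N := Γ(F.obj.restrict f, ⊤))
    (fun z hz => mem_smul_of_forall_mem_minimalPrimes f hX.isRegularLocalRing hh z
      fun p hp => hz ⟨p, hp⟩) n
    (H := fun i => Γ((W i).sheaf.obj.restrict f, ⊤))
    (P := fun i => nbhdModule f (y i) (n i) G.obj)
    (fun i r hr t => nbhdModule_smul_eq_zero f (y i) (n i) G.obj hr t)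
    (fun i => chartSections f (W i).fromSheaf.hom ∘ₗ chartSections f g.hom)
    (fun i => (W i).chartTrunc f)
    (fun i z hz => hn i z ((nbhdMap_eq_zero_iff f (y i) G.obj (n i) _).1
      (((W i).chartTrunc_fromSheaf f _).symm.trans hz)))
    (fun i => (W i).chartSec f) β
    (fun x hx m m' hm => by
      let x' : Spec A := ⟨x, hx.isPrime⟩
      have hx' := (hX.chart_mem_flags_two_iff f x').2 hx
      exact sub_mem_of_nbhdMap_eq f (x := x') hx ((nbhdMap_eq_oneVal_of_le f b x' hx' hm _
        (hβ x' hx' m')).trans (hβ x' hx' m).symm))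
    (fun i x hx hpx m => by
      let x' : Spec A := ⟨x, hx.isPrime⟩
      have hx' := (hX.chart_mem_flags_two_iff f x').2 hx
      refine sub_mem_of_nbhdMap_eq f (x := x') hx ?_
      refine ((W i).nbhdMap_chartSec f hx' hpx m).trans ?_
      refine Eq.trans ?_ (nbhdMap_chartSections f (W i).fromSheaf.hom x' m _).symm
      refine congrArg _ ?_
      refine (oneVal_map hx' m g b).trans ?_
      refine Eq.trans ?_ (nbhdMap_chartSections f g.hom x' m _).symm
      exact congrArg _ (hβ x' hx' m).symm)
  refine ⟨σ, fun x hx m => ?_, fun x hx m hm h0 => ?_⟩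
  · obtain ⟨z₁, hz₁, z₂, hz₂, h3⟩ := Submodule.mem_sup.1
      (h1 x.asIdeal ((hX.chart_mem_flags_two_iff f x).1 hx) m)
    refine ⟨-z₂, Submodule.neg_mem _ hz₂, ?_⟩
    rw [← hβ x hx m, ← sub_eq_zero, ← map_sub,
      nbhdMap_eq_zero_iff_of_isMaximal f x F.obj ((hX.chart_mem_flags_two_iff f x).1 hx) m]
    have h4 : σ + -z₂ - β x.asIdeal m = z₁ := by
      refine Eq.trans ?_ (eq_sub_of_add_eq h3).symm
      abel
    rwa [h4]
  -- Up to an invertible factor, the difference of `a` and `σ` at the curve is a value of `hN`. For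
  -- curves in the divisor of `h` this is the second conclusion of the approximation, moved from `G`
  -- to `F` and down to order `m`.
  · have key : ∃ s ∉ x.asIdeal, ∃ z ∈ Ideal.span {h} • (⊤ : Submodule A Γ(F.obj.restrict f, ⊤)),
        (chartNbhd f x m).hom s •
          ((show Γ((Scheme.Modules.pullback (specNbhd (f x) m)).obj F.obj, ⊤) from
            oneVal hx m F a) - nbhdMap f x F.obj m σ) = nbhdMap f x F.obj m z := by
      by_cases hhx : h ∈ x.asIdeal
      · have hx1 : x.asIdeal ∈ (Ideal.span {h}).minimalPrimes :=
          mem_minimalPrimes_of_height_eq_one hh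
            ((coheight_chart f x).symm.trans (singleton_mem_flags.1 hx)) hhx
        let i : (Ideal.span {h}).minimalPrimes := ⟨x.asIdeal, hx1⟩
        refine exists_smul_eq_nbhdMap_of_le f a x hx (hm.trans (hνn i)) σ _ ?_
        refine exists_smul_eq_nbhdMap_of_comp f x (n i) g.hom _ (hn i) _ ?_
        obtain ⟨s, hs, z, hz, h3⟩ := h2 i
        refine ⟨s, hs, z, hz, ?_⟩
        refine Eq.trans ?_ (h3.trans ((W i).chartTrunc_fromSheaf f _))
        refine Eq.trans ?_ (nbhdModule_smul f (y i) (n i) G.obj s _).symm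
        refine congrArg _ ?_
        refine (map_sub (((Scheme.Modules.pullback (nbhdι (f x) (n i))).map g.hom).app ⊤).hom
          _ _).trans ?_
        refine congrArg₂ _ ?_ ?_
        · exact (oneVal_map hx (n i) g a).symm.trans ((W i).chartTrunc_chartSec f).symm
        · exact (nbhdMap_chartSections f g.hom x (n i) σ).symm.trans
            ((W i).chartTrunc_fromSheaf f _).symm
      -- Off the divisor, `h` itself may be absorbed in the denominator.
      · obtain ⟨s, hs, z, h3⟩ := exists_smul_eq_nbhdMap f x F.obj m
          ((show Γ((Scheme.Modules.pullback (specNbhd (f x) m)).obj F.obj, ⊤) from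
            oneVal hx m F a) - nbhdMap f x F.obj m σ)
        refine ⟨h * s, x.isPrime.mul_notMem hhx hs, h • z, Submodule.smul_mem_smul
          (Ideal.mem_span_singleton_self h) Submodule.mem_top, ?_⟩
        rw [map_mul, mul_smul, h3, map_smulₛₗ]
    obtain ⟨s, hs, z, hz, h3⟩ := key
    rw [h0 z hz] at h3
    have h4 := ((isQuotLoc_chartNbhd f x m).isUnit s hs).smul_eq_zero.1 h3
    exact (sub_eq_zero.1 h4).symm

end LocalSection

end

/-! ### Gluing the local sections -/

section

section GlobalSections

variable {X : Scheme.{u}}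

lemma top_le_preimage_nbhdι_of_mem {x : X} {U : X.Opens} (hx : x ∈ U) (n : ℕ) :
    ⊤ ≤ nbhdι x n ⁻¹ᵁ U := by
  obtain ⟨A, f, hf, ⟨y, -, rfl⟩, hU⟩ := exists_chart_le hx
  exact fun z hz => hU (top_le_preimage_nbhdι f y n hz)

variable {F : Coh X} (b : (cohAdeles X 1 (flags X [2])).obj F)

/-- Modulo the ideal sheaf `I`, the section `σ` of `F` induces the adele `b` at the closed points
of `U`. -/
def IsInducedModulo (I : X.IdealSheafData) (U : X.Opens) (σ : Γ(F.obj, U)) : Prop :=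
  ∀ (z : X) (hz : [z] ∈ flags X [2]) (hU : z ∈ U) (m : ℕ), ∃ u : Γ(F.obj, U),
    evalSection (nbhdι z m) F.obj U (top_le_preimage_nbhdι_of_mem hU m) u = oneVal hz m F b ∧
      pullUnit I.subschemeι F.obj U u = pullUnit I.subschemeι F.obj U σ

/-- The section `t` over a closed subscheme is locally given by sections that induce `b`. -/
def IsLocallyInduced (I : X.IdealSheafData) (t : closedSections F.obj I) : Prop :=
  ∀ x : X, ∃ (U : X.Opens) (_ : x ∈ U) (σ : Γ(F.obj, U)), IsInducedModulo b I U σ ∧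
    ((Scheme.Modules.pullback I.subschemeι).obj F.obj).presheaf.map (homOfLE le_top).op t =
      pullUnit I.subschemeι F.obj U σ

variable {b}

namespace IsInducedModulo

variable {I J : X.IdealSheafData} {U V : X.Opens}

lemma map {σ : Γ(F.obj, U)} (h : IsInducedModulo b I U σ) (hV : V ≤ U) :
    IsInducedModulo b I V (F.obj.presheaf.map (homOfLE hV).op σ) := by
  intro z hz hzV m
  obtain ⟨u, h1, h2⟩ := h z hz (hV hzV) m
  refine ⟨F.obj.presheaf.map (homOfLE hV).op u,
    (evalSection_map (nbhdι z m) F.obj hV _ _ u).trans h1, ?_⟩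
  refine (pullUnit_map _ _ hV u).trans (Eq.trans ?_ (pullUnit_map _ _ hV σ).symm)
  exact congrArg _ h2

lemma mono {σ : Γ(F.obj, U)} (h : IsInducedModulo b I U σ) (hIJ : I ≤ J) :
    IsInducedModulo b J U σ := fun z hz hU m =>
  (h z hz hU m).imp fun _ h => ⟨h.1, pullUnit_eq_of_le F.obj U hIJ h.2⟩

variable [AlgebraicGeometry.IsIntegral X] [IsLocallyNoetherian X]

/-- By Krull it is enough to compare modulo `x ^ m`. Modulo the ideal of the subscheme both sections
can be replaced by sections whose value there is exactly that of `b`. -/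
lemma pullUnit_eq_of_chart (hX : IsRegularSurface X) {A : CommRingCat.{u}} (f : Spec A ⟶ X)
    [IsOpenImmersion f] [Nonempty (Spec A)] (hI : I ≠ ⊥) {σ σ' : Γ(F.obj, f ''ᵁ ⊤)}
    (h : IsInducedModulo b I (f ''ᵁ ⊤) σ) (h' : IsInducedModulo b I (f ''ᵁ ⊤) σ') :
    pullUnit I.subschemeι F.obj (f ''ᵁ ⊤) σ = pullUnit I.subschemeι F.obj (f ''ᵁ ⊤) σ' := by
  have := isNoetherianRing_of_chart f
  have hF := isFiniteOnChart_of_isCoherent F.property f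
  have := hF.1
  have := hF.2
  obtain ⟨I', -, hI'⟩ := exists_ideal_ne_bot_pullUnit hI f
  have key : ∀ z z' : Γ(F.obj.restrict f, ⊤), pullUnit I.subschemeι F.obj (f ''ᵁ ⊤) z =
      pullUnit I.subschemeι F.obj (f ''ᵁ ⊤) z' ↔
      z - z' ∈ I' • (⊤ : Submodule A Γ(F.obj.restrict f, ⊤)) := by
    intro z z'
    rw [← (hI' F.obj).2, ← sub_eq_zero]
    exact Eq.congr_left (map_sub (pullUnit I.subschemeι F.obj (f ''ᵁ ⊤)) z z').symm
  refine (key σ σ').2 (mem_of_forall_mem_sup _ _ fun x hx m => ?_)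
  let y : Spec A := ⟨x, hx.isPrime⟩
  have hy := (hX.chart_mem_flags_two_iff f y).2 hx
  obtain ⟨u, h1, h2⟩ := h (f y) hy ⟨y, trivial, rfl⟩ m
  obtain ⟨u', h1', h2'⟩ := h' (f y) hy ⟨y, trivial, rfl⟩ m
  have h3 := sub_mem_of_nbhdMap_eq f (x := y) hx (m := m) (z := u) (z' := u')
    ((nbhdMap_eq_evalSection f y F.obj m u).trans ((h1.trans h1'.symm).trans
      (nbhdMap_eq_evalSection f y F.obj m u').symm))
  have h4 := (key σ u).1 h2.symm
  have h5 := (key u' σ').1 h2'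
  have h6 := Submodule.add_mem_sup (add_mem h4 h5) h3
  refine (congrArg (· ∈ _) ?_).mp h6
  abel

lemma exists_pullUnit_eq (hX : IsRegularSurface X) (hI : I ≠ ⊥) {σ : Γ(F.obj, U)} {σ' : Γ(F.obj, V)}
    (h : IsInducedModulo b I U σ) (h' : IsInducedModulo b I V σ') (x : X) (hx : x ∈ U ⊓ V) :
    ∃ (W : X.Opens) (_ : x ∈ W) (hU : W ≤ U) (hV : W ≤ V),
      pullUnit I.subschemeι F.obj W (F.obj.presheaf.map (homOfLE hU).op σ) =
        pullUnit I.subschemeι F.obj W (F.obj.presheaf.map (homOfLE hV).op σ') := by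
  obtain ⟨A, f, hf, hx, hle⟩ := exists_chart_le hx
  have : Nonempty (Spec A) := ⟨hx.choose⟩
  exact ⟨f ''ᵁ ⊤, hx, hle.trans inf_le_left, hle.trans inf_le_right,
    pullUnit_eq_of_chart hX f hI (h.map _) (h'.map _)⟩

end IsInducedModulo

namespace IsLocallyInduced

variable {I J : X.IdealSheafData}

lemma closedRestrict {t : closedSections F.obj I} (ht : IsLocallyInduced b I t) (h : I ≤ J) :
    IsLocallyInduced b J (closedRestrict F.obj h t) := by
  intro x
  obtain ⟨U, hx, σ, hσ, h1⟩ := ht x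
  exact ⟨U, hx, σ, hσ.mono h, map_pullbackSections_eq _ _ _ _ F.obj U t σ h1⟩

variable [AlgebraicGeometry.IsIntegral X] [IsLocallyNoetherian X]

lemma exists_map_eq_pullUnit (hX : IsRegularSurface X) (hI : I ≠ ⊥) {t : closedSections F.obj I}
    (ht : IsLocallyInduced b I t) {V : X.Opens} {σ : Γ(F.obj, V)} (hσ : IsInducedModulo b I V σ)
    (x : X) (hx : x ∈ V) : ∃ (W : X.Opens) (_ : x ∈ W) (hW : W ≤ V),
    ((Scheme.Modules.pullback I.subschemeι).obj F.obj).presheaf.map (homOfLE le_top).op t =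
      pullUnit I.subschemeι F.obj W (F.obj.presheaf.map (homOfLE hW).op σ) := by
  obtain ⟨U, hxU, τ, hτ, h1⟩ := ht x
  obtain ⟨W, hxW, hU, hV, h2⟩ := hτ.exists_pullUnit_eq hX hI hσ x ⟨hxU, hx⟩
  refine ⟨W, hxW, hV, Eq.trans ?_ h2⟩
  refine Eq.trans ?_ (pullUnit_map _ _ hU τ).symm
  refine Eq.trans ?_ (congrArg _ h1)
  exact (presheaf_map_map _ _ _ _).symm

lemma eq (hX : IsRegularSurface X) (hI : I ≠ ⊥) {t t' : closedSections F.obj I}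
    (ht : IsLocallyInduced b I t) (ht' : IsLocallyInduced b I t') : t = t' := by
  refine section_eq_of_locally I.subschemeι _ t t' fun x => ?_
  obtain ⟨U, hxU, τ, hτ, h1⟩ := ht' x
  obtain ⟨W, hxW, hW, h2⟩ := ht.exists_map_eq_pullUnit hX hI hτ x hxU
  refine ⟨W, hxW, h2.trans ?_⟩
  refine (pullUnit_map _ _ hW τ).trans ?_
  refine Eq.trans (congrArg _ h1.symm) ?_
  exact presheaf_map_map _ _ _ _

end IsLocallyInduced

variable [AlgebraicGeometry.IsIntegral X] [IsLocallyNoetherian X]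

/-- Local sections inducing the same `b` agree near each point of an overlap by
`exists_pullUnit_eq`, which is the gluing condition. -/
lemma exists_isLocallyInduced (hX : IsRegularSurface X) {I : X.IdealSheafData} (hI : I ≠ ⊥)
    (h : ∀ x : X, ∃ (U : X.Opens) (_ : x ∈ U) (σ : Γ(F.obj, U)), IsInducedModulo b I U σ) :
    ∃ t : closedSections F.obj I, IsLocallyInduced b I t := by
  choose U hU σ hσ using h
  obtain ⟨t, ht⟩ := exists_section_of_locally I.subschemeι
    ((Scheme.Modules.pullback I.subschemeι).obj F.obj) U (fun x => ⟨x, hU x⟩)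
    (fun x => pullUnit I.subschemeι F.obj (U x) (σ x)) (fun j k x hx => by
      obtain ⟨W, hxW, h1, h2, h3⟩ := (hσ j).exists_pullUnit_eq hX hI (hσ k) x hx
      exact ⟨W, hxW, h1, h2, (pullUnit_map _ _ h1 _).symm.trans
        (h3.trans (pullUnit_map _ _ h2 _))⟩)
  exact ⟨t, fun x => ⟨U x, hU x, σ x, hσ x, ht x⟩⟩

/-- Locally, two adeles with the same image are induced by sections. -/
lemma exists_isInducedModulo (hX : IsRegularSurface X) (hF : IsLocallyFreeOfFiniteRank F.obj)
    {a : (cohAdeles X 1 (flags X [1])).obj F}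
    (hab : mapOne F.obj (toAdeles F a) = mapTwo F.obj (toAdeles F b)) {I : X.IdealSheafData}
    (hI : I ≠ ⊥) (ν : ℕ) (x : X) : ∃ (U : X.Opens) (_ : x ∈ U) (σ : Γ(F.obj, U)),
      IsInducedModulo b I U σ ∧ ∀ (y : X) (hy : [y] ∈ flags X [1]) (hyU : y ∈ U) (n : ℕ), n ≤ ν →
        I ≤ (nbhdι y n).ker →
        evalSection (nbhdι y n) F.obj U (top_le_preimage_nbhdι_of_mem hyU n) σ =
          oneVal hy n F a := by
  obtain ⟨A, f, hf, ⟨z, hz⟩, hfin, hfree⟩ := hF.exists_chart x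
  have : Nonempty (Spec A) := ⟨z⟩
  have := hfin.1
  obtain ⟨I', hI'0, hI'⟩ := exists_ideal_ne_bot_pullUnit hI f
  -- One nonzero element of the ideal suffices, since congruence modulo `h` implies congruence
  -- modulo `I'`.
  obtain ⟨h, hhI, hh⟩ := Submodule.exists_mem_ne_zero_of_ne_bot hI'0
  have hzero : ∀ z ∈ Ideal.span {h} • (⊤ : Submodule A Γ(F.obj.restrict f, ⊤)),
      pullUnit I.subschemeι F.obj (f ''ᵁ ⊤) z = 0 := fun z hz => ((hI' F.obj).2 z).2
    (Submodule.smul_mono_left ((Ideal.span_singleton_le_iff_mem _).2 hhI) hz)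
  obtain ⟨σ, h1, h2⟩ := exists_section_of_mapOne_eq_mapTwo f hX hab hh ν
  refine ⟨f ''ᵁ ⊤, ⟨z, trivial, hz⟩, σ, ?_, ?_⟩
  · rintro _ hy ⟨y, -, rfl⟩ m
    obtain ⟨e, he, h3⟩ := h1 y hy m
    refine ⟨σ + e, (nbhdMap_eq_evalSection f y F.obj m _).symm.trans h3, ?_⟩
    refine (map_add (pullUnit I.subschemeι F.obj (f ''ᵁ ⊤)) σ e).trans ?_
    exact (congrArg (_ + ·) (hzero e he)).trans (add_zero _)
  · rintro _ hy ⟨y, -, rfl⟩ n hn hI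
    refine (nbhdMap_eq_evalSection f y F.obj n σ).symm.trans (h2 y hy n hn fun e he => ?_)
    obtain ⟨g, hg⟩ := exists_lift_nbhdι hI
    refine (nbhdMap_eq_evalSection f y F.obj n e).trans ?_
    have h3 := pullUnit_eq_zero_of_comp g _ _ hg F.obj (f ''ᵁ ⊤) e (hzero e he)
    exact (congrArg (((Scheme.Modules.pullback (nbhdι (f y) n)).obj F.obj).presheaf.map
      (homOfLE (top_le_preimage_nbhdι f y n)).op) h3).trans (map_zero
        (((Scheme.Modules.pullback (nbhdι (f y) n)).obj F.obj).presheaf.map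
          (homOfLE (top_le_preimage_nbhdι f y n)).op).hom)

/-- Two adeles, for the curves and for the closed points, with the same image are induced by a
compatible family of sections over the closed subschemes. -/
theorem exists_limitClosedSections (hX : IsRegularSurface X) (hF : IsLocallyFreeOfFiniteRank F.obj)
    {a : (cohAdeles X 1 (flags X [1])).obj F}
    (hab : mapOne F.obj (toAdeles F a) = mapTwo F.obj (toAdeles F b)) :
    ∃ s ∈ limitClosedSections F.obj,
      (∀ (x : X) (hx : [x] ∈ flags X [1]) (n : ℕ) (I : {I : X.IdealSheafData // I ≠ ⊥})
        (g : nbhd x n ⟶ I.1.subscheme) (hg : g ≫ I.1.subschemeι = nbhdι x n),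
        oneVal hx n F a = pullbackSections g I.1.subschemeι (nbhdι x n) hg F.obj (s I)) ∧
      ∀ (x : X) (hx : [x] ∈ flags X [2]) (n : ℕ) (I : {I : X.IdealSheafData // I ≠ ⊥})
        (g : nbhd x n ⟶ I.1.subscheme) (hg : g ≫ I.1.subschemeι = nbhdι x n),
        oneVal hx n F b = pullbackSections g I.1.subschemeι (nbhdι x n) hg F.obj (s I) := by
  have h (I : {I : X.IdealSheafData // I ≠ ⊥}) :
      ∃ t : closedSections F.obj I.1, IsLocallyInduced b I.1 t :=
    exists_isLocallyInduced hX I.2 fun x => by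
      -- The closed points alone determine the section, so the order at the curves plays no role and
      -- is set to 0.
      obtain ⟨U, hx, σ, hσ, -⟩ := exists_isInducedModulo hX hF hab I.2 0 x
      exact ⟨U, hx, σ, hσ⟩
  choose s hs using h
  refine ⟨s, fun I J hIJ => ((hs I).closedRestrict hIJ).eq hX J.2 (hs J), ?_, ?_⟩
  · intro x hx n I g hg
    -- A local section adapted to order `n` at the curves still induces `b`, hence by uniqueness
    -- represents `s I` near `x`.
    obtain ⟨U, hxU, σ, hσ, h1⟩ := exists_isInducedModulo hX hF hab I.2 n x
    obtain ⟨W, hxW, hW, h2⟩ := (hs I).exists_map_eq_pullUnit hX I.2 hσ x hxU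
    refine (h1 x hx hxU n le_rfl (le_ker_of_comp_eq g hg)).symm.trans ?_
    refine Eq.trans ?_ (pullbackSections_eq_evalSection g _ _ hg F.obj W
      (top_le_preimage_nbhdι_of_mem hxW n) (s I) _ h2).symm
    exact (evalSection_map (nbhdι x n) F.obj hW _ _ σ).symm
  · intro x hx n I g hg
    obtain ⟨U, hxU, σ, hσ, h1⟩ := hs I x
    obtain ⟨u, h2, h3⟩ := hσ x hx hxU n
    refine h2.symm.trans ?_
    refine Eq.trans ?_ (pullbackSections_eq_evalSection g _ _ hg F.obj U
      (top_le_preimage_nbhdι_of_mem hxU n) (s I) _ h1).symm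
    exact evalSection_eq_of_comp g _ _ hg F.obj U _ h3

end GlobalSections

end

/-! ### The canonical isomorphism -/

section

section Relation

/-- Adeles and families are matched by a relation with no preferred choices of `a` and `b`; an
additive relation that is total and single-valued in both directions is the graph of exactly one
isomorphism. -/
lemma existsUnique_addEquiv {G H : Type*} [AddCommGroup G] [AddCommGroup H] (R : G → H → Prop)
    (hadd : ∀ c c' s s', R c s → R c' s' → R (c + c') (s + s')) (htot : ∀ c, ∃ s, R c s)
    (hsurj : ∀ s, ∃ c, R c s) (huniq : ∀ c s s', R c s → R c s' → s = s')
    (hinj : ∀ c c' s, R c s → R c' s → c = c') : ∃! Φ : G ≃+ H, ∀ c, R c (Φ c) := by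
  choose φ hφ using htot
  refine ⟨AddEquiv.ofBijective (AddMonoidHom.mk' φ fun c c' =>
    huniq _ _ _ (hφ _) (hadd _ _ _ _ (hφ c) (hφ c'))) ⟨fun c c' h => ?_, fun s => ?_⟩, hφ,
    fun Ψ hΨ => AddEquiv.ext fun c => huniq _ _ _ (hΨ c) (hφ c)⟩
  · exact hinj c c' (φ c) (hφ c) ((show φ c = φ c' from h) ▸ hφ c')
  · obtain ⟨c, hc⟩ := hsurj s
    exact ⟨c, huniq _ _ _ (hφ c) hc⟩

end Relation

namespace IsInducedBy

variable {X : Scheme.{u}} {M : X.Modules} {i : ℕ} {a a' : adeleGroup [i] M}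
  {s s' : ∀ I : {I : X.IdealSheafData // I ≠ ⊥}, closedSections M I.1}

lemma add (h : IsInducedBy a s) (h' : IsInducedBy a' s') : IsInducedBy (a + a') (s + s') :=
  fun x hx n I g hg => (map_add (component (flags X [i]) x n hx M) a a').trans
    ((congrArg₂ _ (h x hx n I g hg) (h' x hx n I g hg)).trans
      (map_add (pullbackSections g I.1.subschemeι (nbhdι x n) hg M) (s I) (s' I)).symm)

lemma sub (h : IsInducedBy a s) (h' : IsInducedBy a' s') : IsInducedBy (a - a') (s - s') :=
  fun x hx n I g hg => (map_sub (component (flags X [i]) x n hx M) a a').trans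
    ((congrArg₂ _ (h x hx n I g hg) (h' x hx n I g hg)).trans
      (map_sub (pullbackSections g I.1.subschemeι (nbhdι x n) hg M) (s I) (s' I)).symm)

end IsInducedBy

section Isomorphism

variable {X : Scheme.{u}}

lemma coheight_ne_zero_of_mem_flags {i : ℕ} (hi : i ≠ 0) {x : X} (hx : [x] ∈ flags X [i]) :
    Order.coheight x ≠ 0 := by
  rw [singleton_mem_flags.1 hx]
  exact_mod_cast hi

section

variable [IsLocallyNoetherian X]

lemma isInducedBy_toAdeles_iff {F : Coh X} {i : ℕ} {a : (cohAdeles X 1 (flags X [i])).obj F}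
    {s : ∀ I : {I : X.IdealSheafData // I ≠ ⊥}, closedSections F.obj I.1} :
    IsInducedBy (i := i) (toAdeles (p := 1) F a) s ↔
      ∀ (x : X) (hx : [x] ∈ flags X [i]) (n : ℕ) (I : {I : X.IdealSheafData // I ≠ ⊥})
        (g : nbhd x n ⟶ I.1.subscheme) (hg : g ≫ I.1.subschemeι = nbhdι x n),
        oneVal hx n F a = pullbackSections g I.1.subschemeι (nbhdι x n) hg F.obj (s I) := by
  refine forall₃_congr fun x hx n => forall₃_congr fun I g hg => ?_
  exact Eq.congr_left (component_lanMk hx n F a)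

end

variable [AlgebraicGeometry.IsIntegral X] [IsLocallyNoetherian X]

/-- An adele that is induced by zero is zero. -/
lemma IsInducedBy.eq_zero (F : Coh X) {i : ℕ} (hi : i ≠ 0) {a : adeleGroup [i] F.obj}
    (h : IsInducedBy a (0 : ∀ I : {I : X.IdealSheafData // I ≠ ⊥}, closedSections F.obj I.1)) :
    a = 0 := by
  obtain ⟨a, rfl⟩ := (toAdeles_bijective (p := 1) (K := flags X [i]) F).2 a
  rw [isInducedBy_toAdeles_iff] at h
  have h0 : a = 0 := by
    refine oneVal_ext fun x hx n => ?_
    have hx0 := coheight_ne_zero_of_mem_flags hi hx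
    obtain ⟨g, hg⟩ := exists_lift_nbhdι (x := x) (n := n) (I := (nbhdι x n).ker) le_rfl
    refine (h x hx n ⟨_, ker_nbhdι_ne_bot x hx0 n⟩ g hg).trans ?_
    exact (map_zero (pullbackSections g _ (nbhdι x n) hg F.obj)).trans
      (map_zero (oneVal hx n F)).symm
  rw [h0]
  exact map_zero (lanMk _ (𝟙 F.obj))

lemma exists_mapOne_toAdeles_eq {F : Coh X}
    {s : ∀ I : {I : X.IdealSheafData // I ≠ ⊥}, closedSections F.obj I.1}
    (hs : s ∈ limitClosedSections F.obj) :
    ∃ (a : (cohAdeles X 1 (flags X [1])).obj F) (b : (cohAdeles X 1 (flags X [2])).obj F),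
      mapOne F.obj (toAdeles F a) = mapTwo F.obj (toAdeles F b) ∧
      IsInducedBy (i := 1) (toAdeles (p := 1) F a) s ∧
      IsInducedBy (i := 2) (toAdeles (p := 1) F b) s := by
  obtain ⟨a, ha⟩ := exists_oneVal_eq_pullbackSections (F := F) (K := flags X [1])
    (fun x hx => coheight_ne_zero_of_mem_flags one_ne_zero hx) hs
  obtain ⟨b, hb⟩ := exists_oneVal_eq_pullbackSections (F := F) (K := flags X [2])
    (fun x hx => coheight_ne_zero_of_mem_flags two_ne_zero hx) hs
  exact ⟨a, b, mapOne_eq_mapTwo_of_eq_pullbackSections hs ha hb,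
    isInducedBy_toAdeles_iff.2 ha, isInducedBy_toAdeles_iff.2 hb⟩

lemma exists_mapOne_eq_mapTwo {M : X.Modules} (hM : IsLocallyFreeOfFiniteRank M)
    {s : ∀ I : {I : X.IdealSheafData // I ≠ ⊥}, closedSections M I.1}
    (hs : s ∈ limitClosedSections M) :
    ∃ (a : adeleGroup [1] M) (b : adeleGroup [2] M), mapOne M a = mapTwo M b ∧
      IsInducedBy a s ∧ IsInducedBy b s := by
  obtain ⟨a, b, h, h1, h2⟩ := exists_mapOne_toAdeles_eq (F := ⟨M, hM.isCoherent⟩) hs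
  exact ⟨_, _, h, h1, h2⟩

variable {M : X.Modules} {s : ∀ I : {I : X.IdealSheafData // I ≠ ⊥}, closedSections M I.1}

lemma eq_zero_of_isInducedBy_one (hX : IsRegularSurface X) (hM : IsLocallyFreeOfFiniteRank M)
    (hs : s ∈ limitClosedSections M)
    (h : IsInducedBy (0 : adeleGroup [1] M) s) : s = 0 :=
  eq_zero_of_forall_curve hX hM hs fun x hx n I g hg =>
    (h x hx n I g hg).symm.trans (map_zero (component (flags X [1]) x n hx M))

lemma eq_zero_of_isInducedBy_two (hX : IsRegularSurface X) (hM : IsLocallyFreeOfFiniteRank M)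
    (hs : s ∈ limitClosedSections M)
    (h : IsInducedBy (0 : adeleGroup [2] M) s) : s = 0 :=
  eq_zero_of_forall_closed hX hM.isCoherent hs fun x hx n I g hg =>
    (h x hx n I g hg).symm.trans (map_zero (component (flags X [2]) x n hx M))

lemma exists_isInducedBy (hX : IsRegularSurface X) (hM : IsLocallyFreeOfFiniteRank M)
    {a : adeleGroup [1] M} {b : adeleGroup [2] M}
    (hab : mapOne M a = mapTwo M b) :
    ∃ s ∈ limitClosedSections M, IsInducedBy a s ∧ IsInducedBy b s := by
  let F : Coh X := ⟨M, hM.isCoherent⟩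
  obtain ⟨a, rfl⟩ := (toAdeles_bijective (p := 1) (K := flags X [1]) F).2 a
  obtain ⟨b, rfl⟩ := (toAdeles_bijective (p := 1) (K := flags X [2]) F).2 b
  obtain ⟨s, hs, h1, h2⟩ := exists_limitClosedSections hX (F := F) hM hab
  exact ⟨s, hs, isInducedBy_toAdeles_iff.2 h1, isInducedBy_toAdeles_iff.2 h2⟩

/-- If `a` maps to zero, the pair `(a, 0)` is induced by a family. It vanishes at all closed points,
so it is zero by Krull, and then so is `a`. -/
lemma mapOne_injective (hX : IsRegularSurface X) (hM : IsLocallyFreeOfFiniteRank M) :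
    Function.Injective (mapOne M) := by
  rw [injective_iff_map_eq_zero]
  intro a ha
  obtain ⟨s, hs, h1, h2⟩ := exists_isInducedBy hX hM (a := a) (b := 0) (ha.trans (map_zero _).symm)
  obtain rfl := eq_zero_of_isInducedBy_two hX hM hs h2
  exact h1.eq_zero ⟨M, hM.isCoherent⟩ one_ne_zero

theorem existsUnique_addEquiv_limitClosedSections (hX : IsRegularSurface X) (hM : IsLocallyFreeOfFiniteRank M)
    :
    ∃! Φ : adeleInter M ≃+ limitClosedSections M, ∀ c : adeleInter M,
      ∃ (a : adeleGroup [1] M) (b : adeleGroup [2] M),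
        mapOne M a = c.1 ∧ mapTwo M b = c.1 ∧
          IsInducedBy a (Φ c).1 ∧ IsInducedBy b (Φ c).1 := by
  refine existsUnique_addEquiv (fun (c : adeleInter M) (s : limitClosedSections M) =>
    ∃ (a : adeleGroup [1] M) (b : adeleGroup [2] M), mapOne M a = c.1 ∧ mapTwo M b = c.1 ∧
      IsInducedBy a s.1 ∧ IsInducedBy b s.1) ?_ ?_ ?_ ?_ ?_
  · rintro c c' s s' ⟨a, b, h1, h2, h3, h4⟩ ⟨a', b', h1', h2', h3', h4'⟩
    refine ⟨a + a', b + b', ?_, ?_, h3.add h3', h4.add h4'⟩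
    · rw [map_add, h1, h1']
      rfl
    · rw [map_add, h2, h2']
      rfl
  · rintro ⟨_, ⟨a, rfl⟩, b, hb⟩
    obtain ⟨s, hs, h1, h2⟩ := exists_isInducedBy hX hM hb.symm
    exact ⟨⟨s, hs⟩, a, b, rfl, hb, h1, h2⟩
  · rintro ⟨s, hs⟩
    obtain ⟨a, b, h, h1, h2⟩ := exists_mapOne_eq_mapTwo hM hs
    exact ⟨⟨mapOne M a, ⟨a, rfl⟩, b, h.symm⟩, a, b, rfl, h.symm, h1, h2⟩
  · rintro c s s' ⟨a, b, h1, h2, h3, h4⟩ ⟨a', b', h1', h2', h3', h4'⟩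
    -- By injectivity both families induce the same `a`, and values at the curves determine a
    -- family.
    obtain rfl := mapOne_injective hX hM (h1.trans h1'.symm)
    have h5 := h3.sub h3'
    rw [sub_self] at h5
    have h6 := eq_zero_of_isInducedBy_one hX hM (sub_mem s.2 s'.2) h5
    exact Subtype.ext (sub_eq_zero.1 h6)
  · rintro c c' s ⟨a, b, h1, h2, h3, h4⟩ ⟨a', b', h1', h2', h3', h4'⟩
    have h5 := h3.sub h3'
    rw [sub_self] at h5
    have h6 := sub_eq_zero.1 (h5.eq_zero ⟨M, hM.isCoherent⟩ one_ne_zero)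
    exact Subtype.ext (h1.symm.trans ((congrArg _ h6).trans h1'))

end Isomorphism

end

end BeilinsonAdeles

end

theorem mainTheorem3 {k : Type u} [Field k] {X : Scheme.{u}} (π : X ⟶ Spec (.of k))
    [LocallyOfFiniteType π] [QuasiCompact π] [IrreducibleSpace X]
    (hreg : ∀ x : X, IsRegularLocalRing (X.presheaf.stalk x)) (hdim : topologicalKrullDim X = 2)
    (F : X.Modules) (hF : IsLocallyFreeOfFiniteRank F) :
    ∃! Φ : adeleInter F ≃+ limitClosedSections F, ∀ c : adeleInter F,
      ∃ (a : adeleGroup [1] F) (b : adeleGroup [2] F),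
        mapOne F a = c.1 ∧ mapTwo F b = c.1 ∧
          IsInducedBy a (Φ c).1 ∧ IsInducedBy b (Φ c).1 := by
  have hX := isRegularSurface π hreg hdim
  have := hX.isIntegral
  have := hX.isNoetherian
  exact existsUnique_addEquiv_limitClosedSections hX hF
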